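/- **Notation.** Let $n\ge 0$. For an $n\times n$ complex matrix $A$ let $\delta_kA$ be the matrix with $(\delta_kA)_{ij}=A_{ij}$ if $i,j\le k$ or $i=j$, and $0$ otherwise. Put $[X,Y]=\mathrm{ad}_XY=XY-YX$ and $z^{\mathrm{ad}X}Y=z^XYz^{-X}$. In the coordinates $z_1,\dots,z_n$ let $u_0=0$, $u_m=z_1+z_1z_2+\dots+z_1\cdots z_m$, $u=\mathrm{diag}(u_1,\dots,u_n)$, and let $\mathrm{ad}_u^{-1}A$ have entries $A_{ij}/(u_i-u_j)$ for $i\neq j$ and $0$ for $i=j$. The $n$-th isomonodromy equation is $$\frac{\partial}{\partial z_j}\Phi=[\mathrm{ad}_u^{-1}\mathrm{ad}_{\partial u/\partial z_j}\Phi,\Phi],\qquad j=1,\dots,n,$$ and for $0\le k\le n$ the $(k,n)$-equation for $\Phi_k(z_1,\dots,z_k)$ is $$\frac{\partial}{\partial z_j}\Phi_k=[(\mathrm{ad}_u^{-1}\mathrm{ad}_{\partial u/\partial z_j}-z_j^{-1})\delta_k\Phi_k,\Phi_k],\qquad j=1,\dots,k.$$ All functions are functions of $(\ln z_1,\dots,\ln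 z_k)$, i.e. they live on the universal covering of $(\mathbb C\setminus\{0\})^k$, so that $\arg z_j$ and powers of $z_j$ are well defined; solutions are holomorphic. **The operators $\mathcal s_k$.** For $1\le k\le n$, fixed $z_1,\dots,z_{k-1}$ and a constant matrix $X$, let $\mathcal s_k(X)=\sum_{m\ge0}z_k^{-m}\phi_m(z_k)$, where $\phi_0=z_k^{-\mathrm{ad}\,\delta_{k-1}X}X$ and, recursively for $m\ge 0$, $$\delta_{k-1}\phi_{m+1}=z_k^{m+1}\!\int^{z_k}\! z_k^{-(m+1)}b_{m+2}\frac{dz_k}{z_k},\qquad z_k^{\mathrm{ad}\,\delta_{k-1}X}\phi_{m+1}=z_k^{m+1}\!\int^{z_k}\! z_k^{-(m+1)}a_{m+2}\frac{dz_k}{z_k},$$ $$b_{m+2}=\sum_{p=1}^{m+1}\sum_{i+j=m+1-p}(-1)^p\big[U^p,(\delta_k-\delta_{k-1})\phi_i\cdot(\delta_k-\delta_{k-1})\phi_j\big],$$ $$a_{m+2}=\sum_{i+j=m+1,\ i<m+1}z_k^{\mathrm{ad}\,\delta_{k-1}X}[\phi_i,\delta_{k-1}\phi_j]+\sum_{p=1}^{m+1}\sum_{i+j=m+1-p}(-1)^pz_k^{\mathrm{ad}\,\delta_{k-1}X}\big[U^p(\delta_k-\delta_{k-1})\phi_i+(\delta_k-\delta_{k-1})\phi_i\,U^p,\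 \phi_j\big].$$ Here $U$ is the diagonal matrix with $i$-th entry $(u_{k-1}-u_i)/(z_1\cdots z_{k-1})$ for $i\le k-1$ and $0$ for $i\ge k$, and $\int^z$ is defined on finite sums of terms $z^s(\ln z)^t$ by $\int^z z^s(\ln z)^t\frac{dz}z=(\frac{d}{ds})^t\frac{z^s}{s}$ if $s\ne0$ and $\frac{(\ln z)^{t+1}}{t+1}$ if $s=0$. **Domains.** Fix real numbers $\alpha_k\le\beta_k$ $(1\le k\le n)$. Let $\Omega$ be a nonempty connected open set of points $(\ln z_1,\dots,\ln z_n)\in\mathbb C^n$ on which $u_1,\dots,u_n$ are pairwise distinct, and let $\Omega_k$ be its projection to the first $k$ coordinates. Assume that every point of $\Omega_{k-1}$ $(1\le k\le n)$ has a neighbourhood $V$ and an $R$ such that $(z_1,\dots,z_k)\in\Omega_k$ whenever $(z_1,\dots,z_{k-1})\in V$, $|z_k|>R$, $\arg z_k\in[\alpha_k,\beta_k]$. The limit $z_k\to\infty$ always means $|z_k|\to\infty$ with $\arg z_k\in[\alpha_k,\beta_k]$. **Shrinking solutions.** A constant matrix $\Phi_0$ satisfies the boundary condition if, for every $k\le n-1$,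 $|\mathrm{Re}(\lambda-\mu)|<1$ for all eigenvalues $\lambda,\mu$ of the upper left $k\times k$ submatrix of $\Phi_0$. A solution $\Phi$ of the $n$-th isomonodromy equation on $\Omega$ is a shrinking solution with boundary value $\Phi_0$ if $\Phi_0$ satisfies the boundary condition and $\Phi=\mathcal s_n\circ\dots\circ\mathcal s_1(\Phi_0)$, that is, there are $\Phi_1,\dots,\Phi_n=\Phi$ such that $\Phi_k$ solves the $(k,n)$-equation on $\Omega_k$ for each $k$, and, for $1\le k\le n$ and every $(z_1,\dots,z_{k-1})\in\Omega_{k-1}$, the series $\mathcal s_k(\Phi_{k-1}(z_1,\dots,z_{k-1}))$ converges absolutely to $\Phi_k(z_1,\dots,z_k)$ for all sufficiently large $z_k$ with $\arg z_k\in[\alpha_k,\beta_k]$. **Theorem.** Let $\Psi_n$ be a solution of the $n$-th isomonodromy equation on $\Omega$. Suppose there are matrix-valued functions $\Psi_{n-1},\dots,\Psi_0$, with $\Psi_k$ a function of $(z_1,\dots,z_k)\in\Omega_k$, such that for every $1\le k\le n$, locally uniformly on $\Omega_{k-1}$, $$\lim_{z_k\to\infty}\delta_{k-1}\Psi_k=\delta_{k-1}\Psi_{k-1},\qquad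 \lim_{z_k\to\infty}z_k^{\mathrm{ad}\,\delta_{k-1}\Psi_{k-1}}\Psi_k=\Psi_{k-1},$$ and that the constant matrix $\Psi_0$ satisfies the boundary condition. Then $\Psi_n$ is a shrinking solution with boundary value $\Psi_0$, and it is the only one: every shrinking solution on $\Omega$ with boundary value $\Psi_0$ coincides with $\Psi_n$ on $\Omega$. -/

import Mathlib

open Filter Topology

noncomputable section

namespace Shrinking

/-! Points of the universal covering of `(ℂ \ {0})^k` are written in logarithmic coordinates
`w = (ln z_1, …, ln z_k)`, so that `z_j = exp w_j` and every complex power `z_j ^ s = exp (s w_j)`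
and every `ln z_j = w_j` has a definite branch. Indices `1, …, k` of the mathematics are the
elements `0, …, k - 1` of `Fin k`. -/

/-- `δ_k A`: keep the upper left `k × k` block and the diagonal. -/
def delta {n : ℕ} (k : ℕ) (A : Matrix (Fin n) (Fin n) ℂ) : Matrix (Fin n) (Fin n) ℂ :=
  Matrix.of fun i j => if (i.val < k ∧ j.val < k) ∨ i = j then A i j else 0

/-- `ad_u⁻¹ A` for the diagonal matrix `u = diag (u_1, …, u_n)`. -/
def adInv {n : ℕ} (u : Fin n → ℂ) (A : Matrix (Fin n) (Fin n) ℂ) : Matrix (Fin n) (Fin n) ℂ :=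
  Matrix.of fun i j => if i = j then 0 else 1 / (u i - u j) * A i j

/-- `z ^ {ad X} Y = z ^ X * Y * z ^ (-X)`, where `w = ln z`. -/
def adPow {n : ℕ} (w : ℂ) (X Y : Matrix (Fin n) (Fin n) ℂ) : Matrix (Fin n) (Fin n) ℂ :=
  NormedSpace.exp (w • X) * Y * NormedSpace.exp (-(w • X))

/-- `u_m = z_1 + z_1 z_2 + ⋯ + z_1 ⋯ z_m` for `0 ≤ m ≤ k`; thus `u_0 = 0`, and
`(u_m - u_{m-1}) / (u_{m-1} - u_{m-2}) = z_m` with `u_{-1} = -1`.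
(For `m > k`, where further variables would be needed, the value is `u_k`.) -/
def uVal {k : ℕ} (w : Fin k → ℂ) (m : ℕ) : ℂ :=
  ∑ l : Fin k with l.val < m, ∏ j : Fin k with j ≤ l, Complex.exp (w j)

/-- The diagonal `(u_1, …, u_n)` as a function of the first `k` variables. Its entries beyond the
`k`-th are only placeholders: the `(k,n)`-equation does not involve them. -/
def uDiag (n : ℕ) {k : ℕ} (w : Fin k → ℂ) : Fin n → ℂ := fun i => uVal w (i.val + 1)

/-- `∂ f / ∂ z_j` in the logarithmic coordinates. -/
def dz {k : ℕ} (j : Fin k) (f : (Fin k → ℂ) → ℂ) (w : Fin k → ℂ) : ℂ :=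
  Complex.exp (-(w j)) * fderiv ℂ f w (Pi.single j 1)

/-- The diagonal matrix `∂ u / ∂ z_j`. -/
def duMat (n : ℕ) {k : ℕ} (j : Fin k) (w : Fin k → ℂ) : Matrix (Fin n) (Fin n) ℂ :=
  Matrix.diagonal fun i => dz j (fun w' => uDiag n w' i) w

/-- `Φ` is a holomorphic solution on `Ω` of the `n`-th isomonodromy equation
`∂Φ/∂z_j = [ad_u⁻¹ ad_{∂u/∂z_j} Φ, Φ]`, `j = 1, …, n`. -/
structure IsIsomonodromySolution {n : ℕ} (Ω : Set (Fin n → ℂ))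
    (Φ : (Fin n → ℂ) → Matrix (Fin n) (Fin n) ℂ) : Prop where
  holomorphic : ∀ a b, DifferentiableOn ℂ (fun w => Φ w a b) Ω
  equation : ∀ w ∈ Ω, ∀ j a b,
    dz j (fun w' => Φ w' a b) w = ⁅adInv (uDiag n w) ⁅duMat n j w, Φ w⁆, Φ w⁆ a b

/-- `Φ` is a holomorphic solution on `Ω` of the `(k,n)`-equation
`∂Φ/∂z_j = [(ad_u⁻¹ ad_{∂u/∂z_j} - z_j⁻¹) δ_k Φ, Φ]`, `j = 1, …, k`. -/
structure IsDegenerateSolution {n : ℕ} (k : ℕ) (Ω : Set (Fin k → ℂ))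
    (Φ : (Fin k → ℂ) → Matrix (Fin n) (Fin n) ℂ) : Prop where
  holomorphic : ∀ a b, DifferentiableOn ℂ (fun w => Φ w a b) Ω
  equation : ∀ w ∈ Ω, ∀ j a b,
    dz j (fun w' => Φ w' a b) w =
      ⁅adInv (uDiag n w) ⁅duMat n j w, delta k (Φ w)⁆
        - (Complex.exp (w j))⁻¹ • delta k (Φ w), Φ w⁆ a b

/-- The boundary condition: for `k ≤ n - 1`, the real parts of any two eigenvalues of the upper
left `k × k` submatrix differ by less than `1`. -/
def BoundaryCondition {n : ℕ} (Φ₀ : Matrix (Fin n) (Fin n) ℂ) : Prop :=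
  ∀ (k : ℕ) (hk : k < n),
    ∀ x ∈ spectrum ℂ (Φ₀.submatrix (Fin.castLE hk.le) (Fin.castLE hk.le)),
    ∀ y ∈ spectrum ℂ (Φ₀.submatrix (Fin.castLE hk.le) (Fin.castLE hk.le)),
      |(x - y).re| < 1

/-! ### The formal series -/

/-- The convention for `∫^z z^s (ln z)^t dz/z`, as a function of `w = ln z`. -/
def logPrimitive (s : ℂ) (t : ℕ) (w : ℂ) : ℂ :=
  if s = 0 then w ^ (t + 1) / (t + 1)
  else iteratedDeriv t (fun x : ℂ => Complex.exp (x * w) / x) s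

/-- `f = ∑ c_{s,t} z^s (ln z)^t` is a finite sum, and `F = ∑ c_{s,t} ∫^z z^s (ln z)^t dz/z`. -/
def IsFormalPrimitive (f F : ℂ → ℂ) : Prop :=
  ∃ c : (ℂ × ℕ) →₀ ℂ,
    (∀ w, f w = c.sum fun d x => x * (Complex.exp (d.1 * w) * w ^ d.2)) ∧
    ∀ w, F w = c.sum fun d x => x * logPrimitive d.1 d.2 w

/-- The diagonal matrix `U_{(k)}`, `k = K + 1`, as a function of `z_1, …, z_{k-1}`: its `i`-th
entry is `(u_{k-1} - u_i) / (u_{k-1} - u_{k-2})` for `i ≤ k - 1` (so `0` for `i = k - 1`), and `0`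
for `i ≥ k`. Here `u_{k-1} - u_{k-2} = z_1 ⋯ z_{k-1}`. -/
def UMat (n : ℕ) {K : ℕ} (v : Fin K → ℂ) : Matrix (Fin n) (Fin n) ℂ :=
  Matrix.diagonal fun i =>
    if i.val < K then (uVal v K - uVal v (i.val + 1)) / ∏ j, Complex.exp (v j) else 0

/-- `(δ_k - δ_{k-1}) A` with `k = K + 1`. -/
def deltaDiff {n : ℕ} (K : ℕ) (A : Matrix (Fin n) (Fin n) ℂ) : Matrix (Fin n) (Fin n) ℂ :=
  delta (K + 1) A - delta K A

/-- `b_{m+2}(z_k)`, built from coefficients `φ_0, …, φ_m`; here `k = K + 1` and `s = ln z_k`. -/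
def bCoeff {n K : ℕ} (v : Fin K → ℂ) (φ : ℕ → ℂ → Matrix (Fin n) (Fin n) ℂ) (m : ℕ) (s : ℂ) :
    Matrix (Fin n) (Fin n) ℂ :=
  ∑ p ∈ Finset.Icc 1 (m + 1), ∑ q ∈ Finset.HasAntidiagonal.antidiagonal (m + 1 - p),
    (-1 : ℂ) ^ p • ⁅UMat n v ^ p, deltaDiff K (φ q.1 s) * deltaDiff K (φ q.2 s)⁆

/-- `a_{m+2}(z_k)`, built from `φ_0, …, φ_m`, `δ_{k-1} φ_{m+1}` and `X = Φ_{k-1}`; here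
`k = K + 1` and `s = ln z_k`. -/
def aCoeff {n K : ℕ} (v : Fin K → ℂ) (X : Matrix (Fin n) (Fin n) ℂ)
    (φ : ℕ → ℂ → Matrix (Fin n) (Fin n) ℂ) (m : ℕ) (s : ℂ) : Matrix (Fin n) (Fin n) ℂ :=
  ∑ q ∈ Finset.HasAntidiagonal.antidiagonal (m + 1) with q.1 < m + 1,
      adPow s (delta K X) ⁅φ q.1 s, delta K (φ q.2 s)⁆
    + ∑ p ∈ Finset.Icc 1 (m + 1), ∑ q ∈ Finset.HasAntidiagonal.antidiagonal (m + 1 - p),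
        (-1 : ℂ) ^ p • adPow s (delta K X)
          ⁅UMat n v ^ p * deltaDiff K (φ q.1 s) + deltaDiff K (φ q.1 s) * UMat n v ^ p, φ q.2 s⁆

/-- `φ_m` (`m ∈ ℕ`), as functions of `s = ln z_k`, are the coefficients of the formal series
`𝓈_k(X) = ∑ z_k^{-m} φ_m(z_k)` for the constant matrix `X = Φ_{k-1}(z_1, …, z_{k-1})`, `k = K + 1`.
The three clauses determine the `φ_m` recursively. -/
structure IsSeriesCoeff {n K : ℕ} (v : Fin K → ℂ) (X : Matrix (Fin n) (Fin n) ℂ)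
    (φ : ℕ → ℂ → Matrix (Fin n) (Fin n) ℂ) : Prop where
  /-- `φ_0 = z_k ^ {- ad δ_{k-1} X} X` -/
  zero : ∀ s, φ 0 s = adPow (-s) (delta K X) X
  /-- `δ_{k-1} φ_{m+1} = z_k^{m+1} ∫ z_k^{-(m+1)} b_{m+2} dz_k/z_k` -/
  delta_succ : ∀ (m : ℕ) (a b : Fin n), ∃ F : ℂ → ℂ,
    IsFormalPrimitive (fun s => Complex.exp (-(((m : ℂ) + 1) * s)) * bCoeff v φ m s a b) F ∧
    ∀ s, delta K (φ (m + 1) s) a b = Complex.exp (((m : ℂ) + 1) * s) * F s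
  /-- `z_k ^ {ad δ_{k-1} X} φ_{m+1} = z_k^{m+1} ∫ z_k^{-(m+1)} a_{m+2} dz_k/z_k` -/
  succ : ∀ (m : ℕ) (a b : Fin n), ∃ F : ℂ → ℂ,
    IsFormalPrimitive (fun s => Complex.exp (-(((m : ℂ) + 1) * s)) * aCoeff v X φ m s a b) F ∧
    ∀ s, adPow s (delta K X) (φ (m + 1) s) a b = Complex.exp (((m : ℂ) + 1) * s) * F s

/-! ### Domains, limits and shrinking solutions -/

/-- The filter `z → ∞`, `arg z ∈ [a, b]`, in the coordinate `s = ln z`. -/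
def sector (a b : ℝ) : Filter ℂ :=
  comap Complex.re atTop ⊓ 𝓟 {s | s.im ∈ Set.Icc a b}

/-- The projection of `Ω` to the first `k` coordinates (`k ≤ n`). -/
def proj {n : ℕ} (k : ℕ) (Ω : Set (Fin n → ℂ)) : Set (Fin k → ℂ) :=
  {v | ∃ w ∈ Ω, ∀ (i : Fin k) (j : Fin n), i.val = j.val → v i = w j}

/-- The point `(z_1, …, z_k, z_{k+1})`. -/
def extend {k : ℕ} (v : Fin k → ℂ) (s : ℂ) : Fin (k + 1) → ℂ :=
  Fin.snoc (α := fun _ => ℂ) v s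

/-- `Ω` is a domain off the fat diagonal on which, for every `k`, the limit `z_k → ∞` with
`arg z_k ∈ [a_k, b_k]` can be taken locally uniformly in `(z_1, …, z_{k-1})`: locally in these
variables, all `z_k` with `arg z_k ∈ [a_k, b_k]` and `|z_k|` large belong to the domain. -/
structure IsSectorialDomain {n : ℕ} (a b : Fin n → ℝ) (Ω : Set (Fin n → ℂ)) : Prop where
  isOpen : IsOpen Ω
  isConnected : IsConnected Ω
  distinct : ∀ w ∈ Ω, Function.Injective (uDiag n w)
  nonempty_sector : ∀ k, a k ≤ b k
  sector_mem : ∀ k : Fin n, ∀ v ∈ proj k.val Ω,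
    ∀ᶠ p in 𝓝 v ×ˢ sector (a k) (b k), extend p.1 p.2 ∈ proj (k.val + 1) Ω

/-- `Φ` is (on `Ω`) the shrinking solution with boundary value `Φ₀`: a solution of the
isomonodromy equation with `Φ = 𝓈_n ∘ ⋯ ∘ 𝓈_1 (Φ₀)`, where `Φ₀` satisfies the boundary condition.
The intermediate functions `F k = 𝓈_k ∘ ⋯ ∘ 𝓈_1 (Φ₀)` are solutions of the `(k,n)`-equations, and
`F (k+1) = 𝓈_{k+1} (F k)` means that the series converges to `F (k+1)` for large `z_{k+1}`. -/
def IsShrinkingSolution {n : ℕ} (a b : Fin n → ℝ) (Ω : Set (Fin n → ℂ))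
    (Φ₀ : Matrix (Fin n) (Fin n) ℂ) (Φ : (Fin n → ℂ) → Matrix (Fin n) (Fin n) ℂ) : Prop :=
  BoundaryCondition Φ₀ ∧ IsIsomonodromySolution Ω Φ ∧
  ∃ F : (k : ℕ) → (Fin k → ℂ) → Matrix (Fin n) (Fin n) ℂ,
    F 0 Fin.elim0 = Φ₀ ∧ Set.EqOn (F n) Φ Ω ∧
    (∀ k ≤ n, IsDegenerateSolution k (proj k Ω) (F k)) ∧
    ∀ k : Fin n, ∀ v ∈ proj k.val Ω, ∃ φ : ℕ → ℂ → Matrix (Fin n) (Fin n) ℂ,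
      IsSeriesCoeff v (F k.val v) φ ∧
      ∀ᶠ s in sector (a k) (b k),
        HasSum (fun m : ℕ => Complex.exp (-((m : ℂ) * s)) • φ m s) (F (k.val + 1) (extend v s))

end Shrinking

end

open Filter Topology

noncomputable section

namespace Shrinking

open scoped Matrix.Norms.Operator

/-! ### Block projections, conjugation by z^X, and matrices supported in the head block. -/

section



/-! Fix a level k, put K = k - 1, z = z_k, s = ln z and A = δ_K Ψ_K, and pass to the gauge Θ = z^{ad
A} Ψ_k. The two limits in the hypotheses then say that z^{-ad A}(δ_K Θ - A) → 0 and Θ → Ψ_K. Let N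
be the part of Θ coupling the first K coordinates (the "head") to the next one, and let g =
-U(z+U)⁻¹, G = z^{ad A} g. In the direction of s the (k,n)-equation becomes Θ' = [Θ, δ_K Θ - A] +
[GN + NG, Θ] (`gaugeRHS`). Its block part can be integrated by variation of constants: the
derivative of z^{-ad A}(δ_K Θ - A) is [g, z^{-ad A} N²] (`hasDerivAt_of_gaugeRHS`). The perturbation
g is O(1/z) and lives in the head block, where conjugation by z^A grows at most like |z|^σ. The
eigenvalue condition is exactly what gives σ < 1 (`exists_headBound`), so every error term is
O(|z|^{-(1-σ)}) and integrable up to infinity (`ConjBound.norm_kernel`).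

This has two consequences for the gauged equation with prescribed asymptotics. A bounded solution is
unique for large z, because the difference of two solutions is controlled by a small multiple of its
own supremum along the ray (`GaugeSol.eq_of_large`). A solution is also produced by the formal
series: in the gauge, the m-th term of the series is an exponential polynomial with exponents of
real part at most -m(1-σ) (`exists_gaugeCoeff`), a majorant sequence makes the series summable
(`exists_majorant`, `GaugeCoeff.norm_le`), and the sum solves the equation with the right limits
(`GaugeCoeff.gaugeSol`). Hence the series converges to Ψ_k (`Level.exists_series`).

To apply this at every level, two facts about the limit functions are needed.

They solve their equations. This descends from level K + 1 to level K by exchanging limit and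
derivative. For δ_K Ψ_K the error is a commutator of an O(1/z) head matrix with N² and dies
(`Level.hasFDerivAt_delta`). Thus A moves by a commutator, which makes the derivative of z^{ad A}
explicit, and the same exchange applies to Ψ_K (`Level.isoSol`). The delicate error is z^{ad A}
applied to the operator ad_u⁻¹ ad_{u'} - τ evaluated at δ_K Ψ_{K+1} - A, since this operator does
not commute with z^{ad A}. The identity `isoOp_lie_pert` rewrites the operator on [g, Y] through a
commutator again, and the kernel estimate applies.

They satisfy the eigenvalue condition everywhere. At some point of each level it follows from the
condition on Ψ_0, because the conjugations by z^{ad} in the limits preserve the spectra of larger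
head blocks and the condition is open (`LimitChain.exists_blockGap`). It then spreads over the
connected domain because the evolution of δ_K Ψ_K by commutators is isospectral (`Level.blockGap`).

For uniqueness of the shrinking solution, the coefficients of the series are determined by Ψ_K:
formal primitives are unique since the functions z^s (ln z)^t are linearly independent
(`linearIndependent_expMono`). So two chains that agree at one level agree at some point of the next
level, and uniqueness for the differential equation propagates this over the connected domain
(`IsoSol.eqOn`). -/

/-- Square matrices with complex entries. -/
abbrev Mat (n : ℕ) : Type := Matrix (Fin n) (Fin n) ℂ

variable {n : ℕ}

/-! ### The projections `delta` and `deltaDiff` -/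

theorem delta_apply (k : ℕ) (A : Mat n) (i j : Fin n) :
    delta k A i j = if (i.val < k ∧ j.val < k) ∨ i = j then A i j else 0 := rfl

theorem deltaDiff_apply (K : ℕ) (A : Mat n) (i j : Fin n) :
    deltaDiff K A i j =
      if (i.val < K ∧ j.val = K) ∨ (i.val = K ∧ j.val < K) then A i j else 0 := by
  simp only [deltaDiff, Matrix.sub_apply, delta_apply, Fin.ext_iff]
  split_ifs <;> first | (exfalso; omega) | simp

theorem norm_matrix_le {A B : Mat n} (h : ∀ i j, ‖A i j‖ ≤ ‖B i j‖) : ‖A‖ ≤ ‖B‖ := by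
  rw [Matrix.linfty_opNorm_def, Matrix.linfty_opNorm_def, NNReal.coe_le_coe]
  refine Finset.sup_mono_fun fun i _ => Finset.sum_le_sum fun j _ => ?_
  exact h i j

theorem norm_delta_le (k : ℕ) (A : Mat n) : ‖delta k A‖ ≤ ‖A‖ := by
  refine norm_matrix_le fun i j => ?_
  rw [delta_apply]; split_ifs <;> simp

theorem norm_deltaDiff_le (k : ℕ) (A : Mat n) : ‖deltaDiff k A‖ ≤ ‖A‖ := by
  refine norm_matrix_le fun i j => ?_
  rw [deltaDiff_apply]; split_ifs <;> simp

/-- `delta` as a continuous linear map. -/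
def deltaL (k : ℕ) : Mat n →L[ℂ] Mat n :=
  LinearMap.mkContinuous
    { toFun := delta k
      map_add' := fun A B => by ext i j; simp only [delta_apply, Matrix.add_apply]; split_ifs <;> simp
      map_smul' := fun c A => by
        ext i j; simp only [delta_apply, Matrix.smul_apply, RingHom.id_apply]; split_ifs <;> simp }
    1 fun A => by simpa using norm_delta_le k A

/-- `deltaDiff` as a continuous linear map. -/
def deltaDiffL (k : ℕ) : Mat n →L[ℂ] Mat n := deltaL (k + 1) - deltaL k

theorem delta_add (k : ℕ) (A B : Mat n) : delta k (A + B) = delta k A + delta k B :=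
  map_add (deltaL k) A B

theorem delta_sub (k : ℕ) (A B : Mat n) : delta k (A - B) = delta k A - delta k B :=
  map_sub (deltaL k) A B

theorem delta_smul (k : ℕ) (c : ℂ) (A : Mat n) : delta k (c • A) = c • delta k A :=
  map_smul (deltaL k) c A

theorem delta_sum {ι : Type*} (k : ℕ) (s : Finset ι) (f : ι → Mat n) :
    delta k (∑ i ∈ s, f i) = ∑ i ∈ s, delta k (f i) := map_sum (deltaL k) f s

theorem deltaDiff_add (k : ℕ) (A B : Mat n) :
    deltaDiff k (A + B) = deltaDiff k A + deltaDiff k B := map_add (deltaDiffL k) A B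

theorem deltaDiff_sub (k : ℕ) (A B : Mat n) :
    deltaDiff k (A - B) = deltaDiff k A - deltaDiff k B := map_sub (deltaDiffL k) A B

theorem deltaDiff_smul (k : ℕ) (c : ℂ) (A : Mat n) : deltaDiff k (c • A) = c • deltaDiff k A :=
  map_smul (deltaDiffL k) c A

@[simp] theorem delta_one (k : ℕ) : delta k (1 : Mat n) = 1 := by
  ext i j; rw [delta_apply, Matrix.one_apply]; split_ifs <;> simp_all

theorem delta_of_le {k l : ℕ} (h : k ≤ l) (A : Mat n) : delta l (delta k A) = delta k A := by
  ext i j; simp only [delta_apply]; split_ifs <;> first | rfl | (exfalso; omega)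

@[simp] theorem delta_delta (k : ℕ) (A : Mat n) : delta k (delta k A) = delta k A :=
  delta_of_le le_rfl A

theorem delta_diagonal (k : ℕ) (d : Fin n → ℂ) :
    delta k (Matrix.diagonal d) = Matrix.diagonal d := by
  ext i j; rw [delta_apply, Matrix.diagonal_apply]; split_ifs <;> simp_all

theorem delta_top (A : Mat n) : delta n A = A := by
  ext i j; simp [delta_apply]

theorem delta_mul_left (k : ℕ) (B Y : Mat n) :
    delta k (delta k B * Y) = delta k B * delta k Y := by
  ext i j
  simp only [delta_apply, Matrix.mul_apply]
  split_ifs with h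
  · refine Finset.sum_congr rfl fun l _ => ?_
    split_ifs <;> first | rfl | (exfalso; omega) | simp
  · symm; refine Finset.sum_eq_zero fun l _ => ?_
    split_ifs <;> first | (exfalso; omega) | simp

theorem delta_mul_right (k : ℕ) (Y B : Mat n) :
    delta k (Y * delta k B) = delta k Y * delta k B := by
  ext i j
  simp only [delta_apply, Matrix.mul_apply]
  split_ifs with h
  · refine Finset.sum_congr rfl fun l _ => ?_
    split_ifs <;> first | rfl | (exfalso; omega) | simp
  · symm; refine Finset.sum_eq_zero fun l _ => ?_
    split_ifs <;> first | (exfalso; omega) | simp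

theorem deltaDiff_mul_left (k : ℕ) (B Y : Mat n) :
    deltaDiff k (delta k B * Y) = delta k B * deltaDiff k Y := by
  ext i j
  simp only [delta_apply, deltaDiff_apply, Matrix.mul_apply]
  split_ifs with h
  · refine Finset.sum_congr rfl fun l _ => ?_
    split_ifs <;> first | rfl | (exfalso; omega) | simp
  · symm; refine Finset.sum_eq_zero fun l _ => ?_
    split_ifs <;> first | (exfalso; omega) | simp

theorem deltaDiff_mul_right (k : ℕ) (Y B : Mat n) :
    deltaDiff k (Y * delta k B) = deltaDiff k Y * delta k B := by
  ext i j
  simp only [delta_apply, deltaDiff_apply, Matrix.mul_apply]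
  split_ifs with h
  · refine Finset.sum_congr rfl fun l _ => ?_
    split_ifs <;> first | rfl | (exfalso; omega) | simp
  · symm; refine Finset.sum_eq_zero fun l _ => ?_
    split_ifs <;> first | (exfalso; omega) | simp

/-- A matrix in the image of `deltaDiff k` exchanges the first k coordinates with the next one, so a
product returns to the block pattern only through an opposite exchange in the other factor. This is
why the block equation is driven by the square of the off-block part. -/
theorem delta_deltaDiff_mul (k : ℕ) (Z Y : Mat n) :
    delta k (deltaDiff k Z * Y) = deltaDiff k Z * deltaDiff k Y := by
  ext i j
  simp only [delta_apply, deltaDiff_apply, Matrix.mul_apply]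
  split_ifs with h
  · refine Finset.sum_congr rfl fun l _ => ?_
    split_ifs <;> first | rfl | (exfalso; omega) | simp
  · symm; refine Finset.sum_eq_zero fun l _ => ?_
    split_ifs <;> first | (exfalso; omega) | simp

theorem delta_mul_deltaDiff (k : ℕ) (Y Z : Mat n) :
    delta k (Y * deltaDiff k Z) = deltaDiff k Y * deltaDiff k Z := by
  ext i j
  simp only [delta_apply, deltaDiff_apply, Matrix.mul_apply]
  split_ifs with h
  · refine Finset.sum_congr rfl fun l _ => ?_
    split_ifs <;> first | rfl | (exfalso; omega) | simp
  · symm; refine Finset.sum_eq_zero fun l _ => ?_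
    split_ifs <;> first | (exfalso; omega) | simp

/-- The matrices fixed by `delta k` form a subalgebra. -/
def deltaAlg (n k : ℕ) : Subalgebra ℂ (Mat n) where
  carrier := {A | delta k A = A}
  mul_mem' := fun {A B} hA hB => by
    have hA : delta k A = A := hA
    have hB : delta k B = B := hB
    change delta k (A * B) = A * B
    rw [← hA, delta_mul_left, hA, hB]
  add_mem' := fun {A B} hA hB => by
    have hA : delta k A = A := hA
    have hB : delta k B = B := hB
    change delta k (A + B) = A + B
    rw [delta_add, hA, hB]
  algebraMap_mem' := fun c => by
    change delta k (algebraMap ℂ (Mat n) c) = _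
    rw [Algebra.algebraMap_eq_smul_one, delta_smul, delta_one]

theorem mem_deltaAlg {k : ℕ} {A : Mat n} : A ∈ deltaAlg n k ↔ delta k A = A := Iff.rfl

theorem delta_mem (k : ℕ) (A : Mat n) : delta k A ∈ deltaAlg n k := delta_delta k A

theorem delta_mul_of_mem_left {k : ℕ} {B : Mat n} (hB : B ∈ deltaAlg n k) (Y : Mat n) :
    delta k (B * Y) = B * delta k Y := by
  have h := delta_mul_left k B Y
  rwa [mem_deltaAlg.1 hB] at h

theorem delta_mul_of_mem_right {k : ℕ} {B : Mat n} (hB : B ∈ deltaAlg n k) (Y : Mat n) :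
    delta k (Y * B) = delta k Y * B := by
  have h := delta_mul_right k Y B
  rwa [mem_deltaAlg.1 hB] at h

theorem deltaDiff_mul_of_mem_left {k : ℕ} {B : Mat n} (hB : B ∈ deltaAlg n k) (Y : Mat n) :
    deltaDiff k (B * Y) = B * deltaDiff k Y := by
  have h := deltaDiff_mul_left k B Y
  rwa [mem_deltaAlg.1 hB] at h

theorem deltaDiff_mul_of_mem_right {k : ℕ} {B : Mat n} (hB : B ∈ deltaAlg n k) (Y : Mat n) :
    deltaDiff k (Y * B) = deltaDiff k Y * B := by
  have h := deltaDiff_mul_right k Y B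
  rwa [mem_deltaAlg.1 hB] at h

theorem deltaAlg_mono {k l : ℕ} (h : k ≤ l) : deltaAlg n k ≤ deltaAlg n l := fun A hA => by
  rw [mem_deltaAlg] at *
  rw [← hA, delta_of_le h]

theorem isClosed_deltaAlg (n k : ℕ) : IsClosed (deltaAlg n k : Set (Mat n)) :=
  isClosed_eq (deltaL k).continuous continuous_id

theorem exp_mem_deltaAlg {k : ℕ} {A : Mat n} (hA : A ∈ deltaAlg n k) :
    NormedSpace.exp A ∈ deltaAlg n k :=
  NormedSpace.exp_mem (isClosed_deltaAlg n k) hA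

/-! ### Conjugation by `z ^ X` -/

theorem exp_smul_mul_exp_neg (w : ℂ) (X : Mat n) :
    NormedSpace.exp (w • X) * NormedSpace.exp (-(w • X)) = 1 := by
  rw [← Matrix.exp_add_of_commute _ _ (Commute.neg_right (Commute.refl (w • X))), add_neg_cancel,
    NormedSpace.exp_zero]

theorem exp_neg_mul_exp_smul (w : ℂ) (X : Mat n) :
    NormedSpace.exp (-(w • X)) * NormedSpace.exp (w • X) = 1 := by
  rw [← Matrix.exp_add_of_commute _ _ (Commute.neg_left (Commute.refl (w • X))), neg_add_cancel,
    NormedSpace.exp_zero]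

theorem exp_add_smul (w w' : ℂ) (X : Mat n) :
    NormedSpace.exp ((w + w') • X) = NormedSpace.exp (w • X) * NormedSpace.exp (w' • X) := by
  rw [add_smul]
  exact Matrix.exp_add_of_commute _ _ ((Commute.refl X).smul_left w |>.smul_right w')

theorem adPow_add (w w' : ℂ) (X Y : Mat n) :
    adPow (w + w') X Y = adPow w X (adPow w' X Y) := by
  have h : -((w + w') • X) = (-w' + -w) • X := by module
  simp only [adPow, h, exp_add_smul, neg_smul, Matrix.mul_assoc]

@[simp] theorem adPow_zero (X Y : Mat n) : adPow 0 X Y = Y := by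
  simp [adPow]

theorem adPow_neg_adPow (w : ℂ) (X Y : Mat n) : adPow (-w) X (adPow w X Y) = Y := by
  rw [← adPow_add]; simp

theorem adPow_adPow_neg (w : ℂ) (X Y : Mat n) : adPow w X (adPow (-w) X Y) = Y := by
  rw [← adPow_add]; simp

theorem adPow_mul (w : ℂ) (X Y Z : Mat n) :
    adPow w X (Y * Z) = adPow w X Y * adPow w X Z := by
  have : adPow w X Y * adPow w X Z = NormedSpace.exp (w • X) * Y *
      (NormedSpace.exp (-(w • X)) * NormedSpace.exp (w • X)) * Z * NormedSpace.exp (-(w • X)) := by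
    simp only [adPow, Matrix.mul_assoc]
  rw [this, exp_neg_mul_exp_smul]; simp only [adPow, Matrix.mul_assoc, Matrix.one_mul]

/-- `adPow w X` as a continuous linear map. -/
def adPowL (w : ℂ) (X : Mat n) : Mat n →L[ℂ] Mat n :=
  (ContinuousLinearMap.mul ℂ (Mat n)).flip (NormedSpace.exp (-(w • X))) ∘L
    ContinuousLinearMap.mul ℂ (Mat n) (NormedSpace.exp (w • X))

theorem adPow_add_right (w : ℂ) (X Y Z : Mat n) :
    adPow w X (Y + Z) = adPow w X Y + adPow w X Z := map_add (adPowL w X) Y Z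

theorem adPow_sub_right (w : ℂ) (X Y Z : Mat n) :
    adPow w X (Y - Z) = adPow w X Y - adPow w X Z := map_sub (adPowL w X) Y Z

theorem adPow_smul_right (w c : ℂ) (X Y : Mat n) :
    adPow w X (c • Y) = c • adPow w X Y := map_smul (adPowL w X) c Y

theorem adPow_sum {ι : Type*} (w : ℂ) (X : Mat n) (s : Finset ι) (f : ι → Mat n) :
    adPow w X (∑ i ∈ s, f i) = ∑ i ∈ s, adPow w X (f i) := map_sum (adPowL w X) f s

@[simp] theorem adPow_zero_right (w : ℂ) (X : Mat n) : adPow w X 0 = 0 := map_zero (adPowL w X)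

theorem adPow_lie (w : ℂ) (X Y Z : Mat n) :
    adPow w X ⁅Y, Z⁆ = ⁅adPow w X Y, adPow w X Z⁆ := by
  simp only [Ring.lie_def, adPow_sub_right, adPow_mul]

theorem adPow_self (w : ℂ) (X : Mat n) : adPow w X X = X := by
  have h : Commute X (NormedSpace.exp (w • X)) := ((Commute.refl X).smul_right w).exp_right
  rw [adPow, ← h.eq, Matrix.mul_assoc, exp_smul_mul_exp_neg, Matrix.mul_one]

theorem smul_mem_deltaAlg {k : ℕ} {X : Mat n} (hX : X ∈ deltaAlg n k) (w : ℂ) :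
    w • X ∈ deltaAlg n k := Subalgebra.smul_mem _ hX w

theorem delta_adPow {k : ℕ} {X : Mat n} (hX : X ∈ deltaAlg n k) (w : ℂ) (Y : Mat n) :
    delta k (adPow w X Y) = adPow w X (delta k Y) := by
  rw [adPow, delta_mul_of_mem_right (exp_mem_deltaAlg (Subalgebra.neg_mem _
    (smul_mem_deltaAlg hX w))), delta_mul_of_mem_left (exp_mem_deltaAlg (smul_mem_deltaAlg hX w)),
    adPow]

theorem deltaDiff_adPow {k : ℕ} {X : Mat n} (hX : X ∈ deltaAlg n k) (w : ℂ) (Y : Mat n) :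
    deltaDiff k (adPow w X Y) = adPow w X (deltaDiff k Y) := by
  rw [adPow, deltaDiff_mul_of_mem_right (exp_mem_deltaAlg (Subalgebra.neg_mem _
    (smul_mem_deltaAlg hX w))),
    deltaDiff_mul_of_mem_left (exp_mem_deltaAlg (smul_mem_deltaAlg hX w)), adPow]

theorem adPow_mem_deltaAlg {k : ℕ} {X Y : Mat n} (hX : X ∈ deltaAlg n k) (w : ℂ)
    (hY : Y ∈ deltaAlg n k) : adPow w X Y ∈ deltaAlg n k := by
  rw [mem_deltaAlg, delta_adPow hX, mem_deltaAlg.1 hY]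

theorem hasDerivAt_exp_smul (X : Mat n) (w : ℂ) :
    HasDerivAt (fun w : ℂ => NormedSpace.exp (w • X)) (X * NormedSpace.exp (w • X)) w :=
  hasDerivAt_exp_smul_const' X w

theorem hasDerivAt_exp_neg_smul (X : Mat n) (w : ℂ) :
    HasDerivAt (fun w : ℂ => NormedSpace.exp (-(w • X))) (-(NormedSpace.exp (-(w • X)) * X)) w := by
  have h := (hasDerivAt_exp_smul_const (𝕂 := ℂ) (-X) w)
  simp only [smul_neg, mul_neg] at h
  exact h

theorem hasDerivAt_adPow {X : Mat n} {f : ℂ → Mat n} {f' : Mat n} {w : ℂ}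
    (hf : HasDerivAt f f' w) :
    HasDerivAt (fun w => adPow w X (f w)) (⁅X, adPow w X (f w)⁆ + adPow w X f') w := by
  have h := ((hasDerivAt_exp_smul X w).mul hf).mul (hasDerivAt_exp_neg_smul X w)
  refine h.congr_deriv ?_
  simp only [adPow, Ring.lie_def, Pi.mul_apply]
  noncomm_ring

/-- The form suited to variation of constants: if the derivative of f is ⁅X, f⁆ + h, the linear term
cancels and only the conjugate of h remains. -/
theorem hasDerivAt_adPow_neg {X : Mat n} {f : ℂ → Mat n} {f' : Mat n} {w : ℂ}
    (hf : HasDerivAt f f' w) :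
    HasDerivAt (fun w => adPow (-w) X (f w)) (adPow (-w) X (f' - ⁅X, f w⁆)) w := by
  have h := (((hasDerivAt_exp_neg_smul X w).mul hf).mul (hasDerivAt_exp_smul X w))
  have h2 : (fun w => adPow (-w) X (f w)) = fun w =>
      NormedSpace.exp (-(w • X)) * f w * NormedSpace.exp (w • X) := by
    funext w; simp [adPow]
  rw [h2]
  refine h.congr_deriv ?_
  simp only [adPow, Ring.lie_def, neg_smul, neg_neg, Pi.mul_apply]
  noncomm_ring

/-! ### Head projection -/

/-- The projection to the first `K` coordinates. -/
def headProj (n K : ℕ) : Mat n := Matrix.diagonal fun i => if i.val < K then 1 else 0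

theorem headProj_mul_self (K : ℕ) : headProj n K * headProj n K = headProj n K := by
  simp only [headProj, Matrix.diagonal_mul_diagonal]
  congr 1; ext i; split_ifs <;> simp

theorem headProj_mul_apply (K : ℕ) (A : Mat n) (i j : Fin n) :
    (headProj n K * A) i j = if i.val < K then A i j else 0 := by
  rw [headProj, Matrix.diagonal_mul]; split_ifs <;> simp

theorem mul_headProj_apply (K : ℕ) (A : Mat n) (i j : Fin n) :
    (A * headProj n K) i j = if j.val < K then A i j else 0 := by
  rw [headProj, Matrix.mul_diagonal]; split_ifs <;> simp

theorem headProj_commute {K : ℕ} {A : Mat n} (hA : A ∈ deltaAlg n K) :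
    Commute (headProj n K) A := by
  change _ = _
  rw [← mem_deltaAlg.1 hA]
  ext i j
  rw [headProj_mul_apply, mul_headProj_apply, delta_apply]
  split_ifs <;> first | rfl | (exfalso; omega)

theorem headProj_mem (K : ℕ) : headProj n K ∈ deltaAlg n K := delta_diagonal _ _

theorem deltaDiff_mul_deltaDiff_mem (K : ℕ) (Y Z : Mat n) :
    deltaDiff K Y * deltaDiff K Z ∈ deltaAlg n K := by
  rw [mem_deltaAlg, ← delta_deltaDiff_mul, delta_delta]

theorem norm_headProj_le (K : ℕ) : ‖headProj n K‖ ≤ 1 := by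
  have h : ‖headProj n K‖ ≤ ‖(1 : Mat n)‖ := by
    refine norm_matrix_le fun i j => ?_
    rw [headProj, Matrix.diagonal_apply, Matrix.one_apply]
    split_ifs <;> simp
  refine h.trans ?_
  rcases isEmpty_or_nonempty (Fin n) with h | h
  · rw [Subsingleton.elim (1 : Mat n) 0]; simp
  · simp

/-- A matrix supported in the upper left `K × K` block. -/
def IsHead (K : ℕ) (A : Mat n) : Prop := headProj n K * A * headProj n K = A

theorem IsHead.left {K : ℕ} {A : Mat n} (h : IsHead K A) : headProj n K * A = A := by
  rw [IsHead] at h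
  rw [← h, ← Matrix.mul_assoc, ← Matrix.mul_assoc, headProj_mul_self]

theorem IsHead.right {K : ℕ} {A : Mat n} (h : IsHead K A) : A * headProj n K = A := by
  rw [IsHead] at h
  rw [← h, Matrix.mul_assoc, headProj_mul_self]

theorem IsHead.mem {K : ℕ} {A : Mat n} (h : IsHead K A) : A ∈ deltaAlg n K := by
  rw [mem_deltaAlg, ← h]
  ext i j
  rw [delta_apply, mul_headProj_apply, headProj_mul_apply]
  split_ifs <;> first | rfl | (exfalso; omega)

theorem isHead_diagonal {K : ℕ} {d : Fin n → ℂ} (h : ∀ i : Fin n, ¬ i.val < K → d i = 0) :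
    IsHead K (Matrix.diagonal d) := by
  rw [IsHead]
  ext i j
  rw [mul_headProj_apply, headProj_mul_apply, Matrix.diagonal_apply]
  split_ifs with h1 h2 h3 <;> first | rfl | (subst_vars; exact (h _ ‹_›).symm)

end

/-! ### Exponential polynomials: independence, formal primitives, filtration by exponents. -/

section



/-! ### Exponential polynomials -/

/-- The function `z ^ d * (ln z) ^ t` of `w = ln z`. -/
def expMono (d : ℂ) (t : ℕ) : ℂ → ℂ := fun w => Complex.exp (d * w) * w ^ t

theorem hasDerivAt_expMono_zero (d w : ℂ) :
    HasDerivAt (expMono d 0) (d * expMono d 0 w) w := by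
  have h : HasDerivAt (fun w : ℂ => Complex.exp (d * w)) (Complex.exp (d * w) * (d * 1)) w :=
    ((hasDerivAt_id w).const_mul d).cexp
  have hE : expMono d 0 = fun w : ℂ => Complex.exp (d * w) := by funext w; simp [expMono]
  rw [hE]
  exact h.congr_deriv (by ring)

theorem hasDerivAt_expMono_succ (d : ℂ) (t : ℕ) (w : ℂ) :
    HasDerivAt (expMono d (t + 1)) (d * expMono d (t + 1) w + (t + 1) * expMono d t w) w := by
  have h : HasDerivAt (fun w : ℂ => Complex.exp (d * w)) (Complex.exp (d * w) * (d * 1)) w :=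
    ((hasDerivAt_id w).const_mul d).cexp
  have h2 := h.mul (hasDerivAt_pow (t + 1) w)
  refine h2.congr_deriv ?_
  simp only [expMono, Nat.add_sub_cancel, Nat.cast_add, Nat.cast_one]
  ring

theorem differentiable_expMono (d : ℂ) (t : ℕ) : Differentiable ℂ (expMono d t) := by
  unfold expMono; fun_prop

/-- Entire functions, as a submodule. -/
def entire : Submodule ℂ (ℂ → ℂ) where
  carrier := {f | Differentiable ℂ f}
  add_mem' := fun hf hg => Differentiable.add hf hg
  zero_mem' := differentiable_const 0
  smul_mem' := fun c _ hf => Differentiable.const_smul hf c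

/-- Differentiation of entire functions. -/
def entireDeriv : Module.End ℂ entire where
  toFun f := ⟨deriv f.1, Differentiable.deriv f.2⟩
  map_add' f g := by
    ext w
    exact deriv_add (f.2 w) (g.2 w)
  map_smul' c f := by
    ext w
    exact deriv_const_smul c (f.2 w)

/-- `expMono` as an entire function. -/
def expMonoE (d : ℂ) (t : ℕ) : entire := ⟨expMono d t, differentiable_expMono d t⟩

/-- The operator d/dw - d lowers the power of w by one, so t + 1 applications annihilate the
monomial. -/
theorem expMonoE_mem (d : ℂ) (t : ℕ) : expMonoE d t ∈ entireDeriv.maxGenEigenspace d := by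
  rw [Module.End.mem_maxGenEigenspace]
  refine ⟨t + 1, ?_⟩
  induction t with
  | zero =>
    rw [zero_add, pow_one]
    ext w
    change deriv (expMono d 0) w - d * expMono d 0 w = 0
    rw [(hasDerivAt_expMono_zero d w).deriv, sub_self]
  | succ t ih =>
    have h : (entireDeriv - d • 1) (expMonoE d (t + 1)) = ((t : ℂ) + 1) • expMonoE d t := by
      ext w
      change deriv (expMono d (t + 1)) w - d * expMono d (t + 1) w = ((t : ℂ) + 1) * expMono d t w
      rw [(hasDerivAt_expMono_succ d t w).deriv]; ring
    rw [pow_succ, Module.End.mul_apply, h, map_smul, ih, smul_zero]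

/-- Generalised eigenspaces of differentiation for distinct exponents are independent, so a relation
splits by exponent. For a single exponent, dividing by the exponential leaves a polynomial that
vanishes everywhere. This makes the formal primitive, and hence the whole formal series, well
defined. -/
theorem linearIndependent_expMono :
    LinearIndependent ℂ (fun p : ℂ × ℕ => expMono p.1 p.2) := by
  classical
  rw [linearIndependent_iff]
  intro c hc
  have hind := (iSupIndep_iff_finsetSum_eq_zero_imp_eq_zero _).1
    (Module.End.independent_maxGenEigenspace entireDeriv)
  let g : ℂ → entire := fun d => ∑ p ∈ c.support with p.1 = d, c p • expMonoE p.1 p.2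
  have hg : ∀ d, g d ∈ entireDeriv.maxGenEigenspace d := fun d => by
    refine Submodule.sum_mem _ fun p hp => Submodule.smul_mem _ _ ?_
    rw [← (Finset.mem_filter.1 hp).2]
    exact expMonoE_mem _ _
  have hsum : ∑ d ∈ c.support.image Prod.fst, g d = 0 := by
    have h1 : ∑ d ∈ c.support.image Prod.fst, g d = ∑ p ∈ c.support, c p • expMonoE p.1 p.2 :=
      Finset.sum_fiberwise_of_maps_to (fun p hp => Finset.mem_image_of_mem _ hp) _
    rw [h1]
    ext w
    have := congrFun hc w
    rw [Finsupp.linearCombination_apply, Finsupp.sum] at this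
    change _ = (0 : ℂ)
    change _ = (0 : ℂ) at this
    rw [← this]
    simp [expMonoE]
  ext ⟨d, t⟩
  by_contra hne
  have hd : d ∈ c.support.image Prod.fst :=
    Finset.mem_image.2 ⟨(d, t), Finsupp.mem_support_iff.2 hne, rfl⟩
  have h0 : g d = 0 := hind _ g (fun d _ => hg d) hsum d hd
  let Q : Polynomial ℂ := ∑ p ∈ c.support with p.1 = d, Polynomial.C (c p) * Polynomial.X ^ p.2
  have hQ : Q = 0 := by
    refine Polynomial.funext fun w => ?_
    have h1 : (g d).1 w = 0 := by rw [h0]; rfl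
    have h2 : (g d).1 w = Complex.exp (d * w) * Q.eval w := by
      simp only [g, Q, Polynomial.eval_finsetSum, Finset.mul_sum, AddSubmonoidClass.coe_finsetSum,
        Finset.sum_apply]
      refine Finset.sum_congr rfl fun p hp => ?_
      simp only [expMonoE, expMono, (Finset.mem_filter.1 hp).2, Submodule.coe_smul, Pi.smul_apply,
        smul_eq_mul, Polynomial.eval_mul, Polynomial.eval_C, Polynomial.eval_pow,
        Polynomial.eval_X]
      ring
    rw [h2] at h1
    simpa [Complex.exp_ne_zero] using h1
  have hcoeff : Q.coeff t = c (d, t) := by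
    simp only [Q, Polynomial.finsetSum_coeff, Polynomial.coeff_C_mul, Polynomial.coeff_X_pow]
    rw [Finset.sum_eq_single (d, t)]
    · simp
    · rintro ⟨d', t'⟩ hp hne'
      have : d' = d := (Finset.mem_filter.1 hp).2
      subst this
      have : ¬ t = t' := fun h => hne' (by rw [h])
      simp [this]
    · intro h
      have : c (d, t) = 0 := by
        by_contra h'
        exact h (Finset.mem_filter.2 ⟨Finsupp.mem_support_iff.2 h', rfl⟩)
      simp [this]
  rw [hQ, Polynomial.coeff_zero] at hcoeff
  exact hne hcoeff.symm

theorem isFormalPrimitive_iff {f F : ℂ → ℂ} :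
    IsFormalPrimitive f F ↔ ∃ c : (ℂ × ℕ) →₀ ℂ,
      f = Finsupp.linearCombination ℂ (fun p : ℂ × ℕ => expMono p.1 p.2) c ∧
      F = Finsupp.linearCombination ℂ (fun p : ℂ × ℕ => logPrimitive p.1 p.2) c := by
  simp only [IsFormalPrimitive, funext_iff, Finsupp.linearCombination_apply, Finsupp.sum,
    Finset.sum_apply, Pi.smul_apply, smul_eq_mul, expMono]

theorem IsFormalPrimitive.unique {f F G : ℂ → ℂ} (hF : IsFormalPrimitive f F)
    (hG : IsFormalPrimitive f G) : F = G := by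
  obtain ⟨c, hc, rfl⟩ := isFormalPrimitive_iff.1 hF
  obtain ⟨c', hc', rfl⟩ := isFormalPrimitive_iff.1 hG
  rw [linearIndependent_expMono (hc.symm.trans hc')]

theorem IsFormalPrimitive.add {f F g G : ℂ → ℂ} (hF : IsFormalPrimitive f F)
    (hG : IsFormalPrimitive g G) : IsFormalPrimitive (f + g) (F + G) := by
  obtain ⟨c, rfl, rfl⟩ := isFormalPrimitive_iff.1 hF
  obtain ⟨c', rfl, rfl⟩ := isFormalPrimitive_iff.1 hG
  exact isFormalPrimitive_iff.2 ⟨c + c', (map_add _ _ _).symm, (map_add _ _ _).symm⟩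

theorem IsFormalPrimitive.const_smul {f F : ℂ → ℂ} (a : ℂ) (hF : IsFormalPrimitive f F) :
    IsFormalPrimitive (a • f) (a • F) := by
  obtain ⟨c, rfl, rfl⟩ := isFormalPrimitive_iff.1 hF
  exact isFormalPrimitive_iff.2 ⟨a • c, (map_smul _ _ _).symm, (map_smul _ _ _).symm⟩

theorem isFormalPrimitive_zero : IsFormalPrimitive 0 0 :=
  isFormalPrimitive_iff.2 ⟨0, (map_zero _).symm, (map_zero _).symm⟩

theorem IsFormalPrimitive.sum {ι : Type*} {s : Finset ι} {f F : ι → ℂ → ℂ}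
    (h : ∀ i ∈ s, IsFormalPrimitive (f i) (F i)) :
    IsFormalPrimitive (∑ i ∈ s, f i) (∑ i ∈ s, F i) := by
  classical
  induction s using Finset.induction_on with
  | empty => simpa using isFormalPrimitive_zero
  | insert a s ha ih =>
    rw [Finset.sum_insert ha, Finset.sum_insert ha]
    exact (h a (Finset.mem_insert_self _ _)).add (ih fun i hi => h i (Finset.mem_insert_of_mem hi))

/-! ### The formal primitive of a monomial -/

theorem iteratedDeriv_inv_apply (k : ℕ) (x : ℂ) :
    iteratedDeriv k (fun x : ℂ => x⁻¹) x = (-1) ^ k * k.factorial * x ^ (-1 - k : ℤ) := by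
  rw [iteratedDeriv_eq_iterate, iter_deriv_inv]

/-- Leibniz rule for e^{xw} · x⁻¹. It shows that the primitive is again an exponential polynomial
with the same exponent s, which is what the filtration by exponents needs. -/
theorem logPrimitive_eq {s : ℂ} (hs : s ≠ 0) (t : ℕ) (w : ℂ) :
    logPrimitive s t w = ∑ i ∈ Finset.range (t + 1),
      ((t.choose i : ℂ) * ((-1) ^ (t - i) * (t - i).factorial * s ^ (-1 - ((t - i : ℕ) : ℤ)))) *
        expMono s i w := by
  rw [logPrimitive, if_neg hs]
  simp only [div_eq_mul_inv]
  rw [iteratedDeriv_fun_mul (by fun_prop) (contDiffAt_inv ℂ hs)]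
  refine Finset.sum_congr rfl fun i _ => ?_
  have h : (fun x : ℂ => Complex.exp (x * w)) = fun x => Complex.exp (w * x) := by
    funext x; rw [mul_comm]
  rw [iteratedDeriv_inv_apply, h, iteratedDeriv_cexp_const_mul, expMono]
  simp only [mul_comm w s]
  ring

theorem hasDerivAt_logPrimitive (s : ℂ) (t : ℕ) (w : ℂ) :
    HasDerivAt (logPrimitive s t) (expMono s t w) w := by
  by_cases hs : s = 0
  · have h := (hasDerivAt_pow (t + 1) w).div_const ((t : ℂ) + 1)
    have h2 : logPrimitive s t = fun w => w ^ (t + 1) / ((t : ℂ) + 1) := by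
      funext w; rw [logPrimitive, if_pos hs]
    rw [h2]
    refine h.congr_deriv ?_
    have : (t : ℂ) + 1 ≠ 0 := by exact_mod_cast Nat.succ_ne_zero t
    rw [hs, expMono]; simp [this]
  · have h2 : logPrimitive s t = fun w => ∑ i ∈ Finset.range (t + 1),
      ((t.choose i : ℂ) * ((-1) ^ (t - i) * (t - i).factorial * s ^ (-1 - ((t - i : ℕ) : ℤ)))) *
        expMono s i w := funext fun w => logPrimitive_eq hs t w
    rw [h2]
    set a : ℕ → ℂ := fun i =>
      (t.choose i : ℂ) * ((-1) ^ (t - i) * (t - i).factorial * s ^ (-1 - ((t - i : ℕ) : ℤ))) with ha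
    have hd : ∀ i : ℕ, HasDerivAt (expMono s i) (s * expMono s i w + i * expMono s (i - 1) w) w := by
      intro i
      cases i with
      | zero => simpa using hasDerivAt_expMono_zero s w
      | succ i => simpa using hasDerivAt_expMono_succ s i w
    have h := HasDerivAt.fun_sum fun i (_ : i ∈ Finset.range (t + 1)) => (hd i).const_mul (a i)
    refine h.congr_deriv ?_
    set b : ℕ → ℂ := fun i => a i * i * expMono s (i - 1) w with hb
    -- The coefficients satisfy s a_i = -(i + 1) a_{i+1}, so the derivatives telescope and only the
    -- top term, with a_t = 1/s, survives.
    have key : ∀ i < t, a i * (s * expMono s i w + i * expMono s (i - 1) w) = b i - b (i + 1) := by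
      intro i hi
      obtain ⟨j, rfl⟩ : ∃ j, t = i + j + 1 := ⟨t - i - 1, by omega⟩
      have e1 : i + j + 1 - i = j + 1 := by omega
      have e2 : i + j + 1 - (i + 1) = j := by omega
      have e3 := Nat.choose_succ_right_eq (i + j + 1) i
      rw [e1] at e3
      have e3 : (((i + j + 1).choose (i + 1) : ℕ) : ℂ) * ((i : ℂ) + 1) =
          ((i + j + 1).choose i : ℕ) * ((j : ℂ) + 1) := by exact_mod_cast e3
      have e4 : s ^ (-1 - ((j + 1 : ℕ) : ℤ)) * s = s ^ (-1 - (j : ℤ)) := by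
        rw [← zpow_add_one₀ hs]; congr 1; push_cast; ring
      simp only [hb, ha, e1, e2, Nat.add_sub_cancel, Nat.factorial_succ, Nat.cast_mul,
        Nat.cast_add, Nat.cast_one, pow_succ, ← e4]
      push_cast at e4 ⊢
      linear_combination (expMono s i w * (-1) ^ j * j.factorial * s ^ (-1 - ((j : ℤ) + 1)) * s) * e3
    rw [Finset.sum_range_succ, Finset.sum_congr rfl fun i hi => key i (Finset.mem_range.1 hi),
      Finset.sum_range_sub']
    simp only [hb, ha]
    simp only [Nat.choose_self, Nat.sub_self, Nat.cast_zero, Nat.factorial_zero]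
    have : s ^ (-1 - (0 : ℤ)) * s = 1 := by simp [hs]
    push_cast
    rw [sub_zero] at this
    linear_combination (expMono s t w) * this

theorem IsFormalPrimitive.hasDerivAt {f F : ℂ → ℂ} (h : IsFormalPrimitive f F) (w : ℂ) :
    HasDerivAt F (f w) w := by
  obtain ⟨c, rfl, rfl⟩ := isFormalPrimitive_iff.1 h
  simp only [Finsupp.linearCombination_apply, Finsupp.sum]
  have := HasDerivAt.sum fun i (_ : i ∈ c.support) =>
    (hasDerivAt_logPrimitive i.1 i.2 w).const_smul (c i)
  refine this.congr_deriv ?_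
  simp

/-! ### Filtration by the real parts of the exponents -/

/-- Exponential polynomials whose exponents have real part at most `ρ`. -/
def EP (ρ : ℝ) : Submodule ℂ (ℂ → ℂ) :=
  Submodule.span ℂ {f | ∃ (d : ℂ) (t : ℕ), d.re ≤ ρ ∧ f = expMono d t}

theorem expMono_mem {ρ : ℝ} {d : ℂ} (h : d.re ≤ ρ) (t : ℕ) : expMono d t ∈ EP ρ :=
  Submodule.subset_span ⟨d, t, h, rfl⟩

theorem EP_mono {ρ ρ' : ℝ} (h : ρ ≤ ρ') : EP ρ ≤ EP ρ' :=
  Submodule.span_mono fun _ ⟨d, t, hd, hf⟩ => ⟨d, t, hd.trans h, hf⟩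

theorem const_mem_EP {ρ : ℝ} (h : 0 ≤ ρ) (c : ℂ) : (fun _ => c) ∈ EP ρ := by
  have : (fun _ => c) = c • expMono 0 0 := by funext w; simp [expMono]
  rw [this]
  exact Submodule.smul_mem _ _ (expMono_mem (by simpa using h) 0)

theorem mul_mem_EP {ρ ρ' : ℝ} {f g : ℂ → ℂ} (hf : f ∈ EP ρ) (hg : g ∈ EP ρ') :
    f * g ∈ EP (ρ + ρ') := by
  induction hf using Submodule.span_induction with
  | mem f hf =>
    obtain ⟨d, t, hd, rfl⟩ := hf
    induction hg using Submodule.span_induction with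
    | mem g hg =>
      obtain ⟨d', t', hd', rfl⟩ := hg
      have : expMono d t * expMono d' t' = expMono (d + d') (t + t') := by
        funext w; simp only [expMono, Pi.mul_apply, add_mul, Complex.exp_add, pow_add]; ring
      rw [this]
      exact expMono_mem (by simpa using add_le_add hd hd') _
    | zero => rw [mul_zero]; exact Submodule.zero_mem _
    | add x y _ _ hx hy => rw [mul_add]; exact Submodule.add_mem _ hx hy
    | smul a x _ hx => rw [mul_smul_comm]; exact Submodule.smul_mem _ _ hx
  | zero => rw [zero_mul]; exact Submodule.zero_mem _
  | add x y _ _ hx hy => rw [add_mul]; exact Submodule.add_mem _ hx hy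
  | smul a x _ hx => rw [smul_mul_assoc]; exact Submodule.smul_mem _ _ hx

theorem logPrimitive_mem {ρ : ℝ} {s : ℂ} (h : s.re ≤ ρ) (t : ℕ) : logPrimitive s t ∈ EP ρ := by
  by_cases hs : s = 0
  · have h2 : logPrimitive s t = (((t : ℂ) + 1)⁻¹) • expMono s (t + 1) := by
      funext w; rw [logPrimitive, if_pos hs, hs]; simp [expMono]; ring
    rw [h2]
    exact Submodule.smul_mem _ _ (expMono_mem h _)
  · have h2 : logPrimitive s t = ∑ i ∈ Finset.range (t + 1),
      ((t.choose i : ℂ) * ((-1) ^ (t - i) * (t - i).factorial * s ^ (-1 - ((t - i : ℕ) : ℤ)))) •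
        expMono s i := by
      funext w; rw [logPrimitive_eq hs]; simp
    rw [h2]
    exact Submodule.sum_mem _ fun i _ => Submodule.smul_mem _ _ (expMono_mem h _)

theorem exists_primitive_of_mem {ρ : ℝ} {f : ℂ → ℂ} (hf : f ∈ EP ρ) :
    ∃ F ∈ EP ρ, IsFormalPrimitive f F := by
  induction hf using Submodule.span_induction with
  | mem f hf =>
    obtain ⟨d, t, hd, rfl⟩ := hf
    refine ⟨logPrimitive d t, logPrimitive_mem hd t,
      isFormalPrimitive_iff.2 ⟨Finsupp.single (d, t) 1, ?_, ?_⟩⟩ <;> simp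
  | zero => exact ⟨0, Submodule.zero_mem _, isFormalPrimitive_zero⟩
  | add x y _ _ hx hy =>
    obtain ⟨F, hF, h⟩ := hx
    obtain ⟨G, hG, h'⟩ := hy
    exact ⟨F + G, Submodule.add_mem _ hF hG, h.add h'⟩
  | smul a x _ hx =>
    obtain ⟨F, hF, h⟩ := hx
    exact ⟨a • F, Submodule.smul_mem _ _ hF, h.const_smul a⟩

/-- By uniqueness, it suffices to bound the exponents of one conveniently built primitive. -/
theorem IsFormalPrimitive.mem {ρ : ℝ} {f F : ℂ → ℂ} (h : IsFormalPrimitive f F) (hf : f ∈ EP ρ) :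
    F ∈ EP ρ := by
  obtain ⟨G, hG, h'⟩ := exists_primitive_of_mem hf
  rwa [h.unique h']

theorem tendsto_expMono {d : ℂ} (hd : d.re < 0) (t : ℕ) (s : ℂ) :
    Tendsto (fun x : ℝ => expMono d t (s + x)) atTop (𝓝 0) := by
  have h1 : Tendsto (fun u : ℝ => u ^ t * Real.exp (-(-d.re) * u)) atTop (𝓝 0) := by
    have h := (isLittleO_pow_exp_pos_mul_atTop t (neg_pos.2 hd)).tendsto_div_nhds_zero
    refine h.congr fun u => ?_
    rw [div_eq_mul_inv, ← Real.exp_neg]; ring_nf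
  have h2 := (h1.comp (tendsto_atTop_add_const_right atTop ‖s‖ tendsto_id)).const_mul
    (‖Complex.exp (d * s)‖ * Real.exp (-d.re * ‖s‖))
  rw [mul_zero] at h2
  refine squeeze_zero_norm' ?_ h2
  filter_upwards [eventually_ge_atTop 0] with x hx
  have e1 : ‖Complex.exp (d * (s + x))‖ = ‖Complex.exp (d * s)‖ * Real.exp (d.re * x) := by
    rw [mul_add, Complex.exp_add, norm_mul, Complex.norm_exp (d * x)]; simp
  have e2 : Real.exp (d.re * x) = Real.exp (-d.re * ‖s‖) * Real.exp (-(-d.re) * (x + ‖s‖)) := by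
    rw [← Real.exp_add]; congr 1; ring
  rw [expMono, norm_mul, norm_pow, e1, e2]
  simp only [Function.comp, id]
  have e3 : ‖s + x‖ ≤ x + ‖s‖ := by
    refine (norm_add_le _ _).trans ?_
    rw [Complex.norm_real, Real.norm_of_nonneg hx, add_comm]
  have := pow_le_pow_left₀ (norm_nonneg _) e3 t
  calc _ ≤ ‖Complex.exp (d * s)‖ * (Real.exp (-d.re * ‖s‖) * Real.exp (-(-d.re) * (x + ‖s‖))) *
        (x + ‖s‖) ^ t := by gcongr
    _ = _ := by ring

theorem tendsto_of_mem_EP {ρ : ℝ} (hρ : ρ < 0) {f : ℂ → ℂ} (hf : f ∈ EP ρ) (s : ℂ) :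
    Tendsto (fun x : ℝ => f (s + x)) atTop (𝓝 0) := by
  induction hf using Submodule.span_induction with
  | mem f hf =>
    obtain ⟨d, t, hd, rfl⟩ := hf
    exact tendsto_expMono (hd.trans_lt hρ) t s
  | zero => exact tendsto_const_nhds
  | add x y _ _ hx hy => simpa using hx.add hy
  | smul a x _ hx => simpa using hx.const_mul a

end

/-! ### Matrices of exponential polynomials and spectral idempotents of the head block. -/

section



variable {n : ℕ}

/-! ### Matrices of exponential polynomials -/

theorem hasDerivAt_matrix {f : ℂ → Mat n} {f' : Mat n} {x : ℂ} :
    HasDerivAt f f' x ↔ ∀ i j, HasDerivAt (fun x => f x i j) (f' i j) x := by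
  refine (hasDerivAt_pi (φ := f) (φ' := f')).trans (forall_congr' fun i => ?_)
  exact hasDerivAt_pi

theorem tendsto_matrix {α : Type*} {l : Filter α} {f : α → Mat n} {A : Mat n} :
    Tendsto f l (𝓝 A) ↔ ∀ i j, Tendsto (fun x => f x i j) l (𝓝 (A i j)) := by
  refine (tendsto_pi_nhds (f := f) (g := A)).trans (forall_congr' fun i => ?_)
  exact tendsto_pi_nhds

/-- Matrix valued functions with entries in `EP ρ`. -/
def mEP (n : ℕ) (ρ : ℝ) : Submodule ℂ (ℂ → Mat n) where
  carrier := {f | ∀ i j, (fun w => f w i j) ∈ EP ρ}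
  add_mem' := fun hf hg i j => Submodule.add_mem _ (hf i j) (hg i j)
  zero_mem' := fun _ _ => Submodule.zero_mem _
  smul_mem' := fun c _ hf i j => Submodule.smul_mem _ c (hf i j)

theorem mEP_mono {ρ ρ' : ℝ} (h : ρ ≤ ρ') : mEP n ρ ≤ mEP n ρ' :=
  fun _ hf i j => EP_mono h (hf i j)

theorem mul_mem_mEP {ρ ρ' : ℝ} {f g : ℂ → Mat n} (hf : f ∈ mEP n ρ) (hg : g ∈ mEP n ρ') :
    (fun w => f w * g w) ∈ mEP n (ρ + ρ') := by
  intro i j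
  have : (fun w => (f w * g w) i j) = ∑ l, (fun w => f w i l) * (fun w => g w l j) := by
    funext w; simp [Matrix.mul_apply]
  rw [this]
  exact Submodule.sum_mem _ fun l _ => mul_mem_EP (hf i l) (hg l j)

theorem lie_mem_mEP {ρ ρ' : ℝ} {f g : ℂ → Mat n} (hf : f ∈ mEP n ρ) (hg : g ∈ mEP n ρ') :
    (fun w => ⁅f w, g w⁆) ∈ mEP n (ρ + ρ') := by
  simp only [Ring.lie_def]
  refine Submodule.sub_mem _ (mul_mem_mEP hf hg) ?_
  rw [add_comm]
  exact mul_mem_mEP hg hf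

theorem const_mem_mEP {ρ : ℝ} (h : 0 ≤ ρ) (A : Mat n) : (fun _ => A) ∈ mEP n ρ :=
  fun i j => const_mem_EP h (A i j)

theorem smul_mem_mEP {ρ ρ' : ℝ} {f : ℂ → ℂ} {g : ℂ → Mat n} (hf : f ∈ EP ρ) (hg : g ∈ mEP n ρ') :
    (fun w => f w • g w) ∈ mEP n (ρ + ρ') := fun i j => mul_mem_EP hf (hg i j)

theorem sum_mem_mEP {ι : Type*} {ρ : ℝ} {s : Finset ι} {f : ι → ℂ → Mat n}
    (h : ∀ i ∈ s, f i ∈ mEP n ρ) : (fun w => ∑ i ∈ s, f i w) ∈ mEP n ρ := by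
  have := Submodule.sum_mem _ h
  rwa [show (∑ i ∈ s, f i) = fun w => ∑ i ∈ s, f i w by funext w; simp] at this

theorem delta_mem_mEP {ρ : ℝ} {f : ℂ → Mat n} (k : ℕ) (hf : f ∈ mEP n ρ) :
    (fun w => delta k (f w)) ∈ mEP n ρ := by
  intro i j
  simp only [delta_apply]
  split_ifs
  · exact hf i j
  · exact Submodule.zero_mem _

theorem deltaDiff_mem_mEP {ρ : ℝ} {f : ℂ → Mat n} (k : ℕ) (hf : f ∈ mEP n ρ) :
    (fun w => deltaDiff k (f w)) ∈ mEP n ρ :=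
  Submodule.sub_mem _ (delta_mem_mEP (k + 1) hf) (delta_mem_mEP k hf)

theorem tendsto_of_mem_mEP {ρ : ℝ} (hρ : ρ < 0) {f : ℂ → Mat n} (hf : f ∈ mEP n ρ) (s : ℂ) :
    Tendsto (fun x : ℝ => f (s + x)) atTop (𝓝 0) :=
  tendsto_matrix.2 fun i j => tendsto_of_mem_EP hρ (hf i j) s

/-- Entrywise formal primitives. -/
def IsMatPrimitive (f F : ℂ → Mat n) : Prop :=
  ∀ i j, IsFormalPrimitive (fun w => f w i j) (fun w => F w i j)

theorem IsMatPrimitive.unique {f F G : ℂ → Mat n} (hF : IsMatPrimitive f F)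
    (hG : IsMatPrimitive f G) : F = G := by
  funext w; ext i j
  exact congrFun ((hF i j).unique (hG i j)) w

theorem IsMatPrimitive.mul_left {f F : ℂ → Mat n} (hF : IsMatPrimitive f F) (P : Mat n) :
    IsMatPrimitive (fun w => P * f w) (fun w => P * F w) := by
  intro i j
  have h := IsFormalPrimitive.sum fun l (_ : l ∈ Finset.univ) => (hF l j).const_smul (P i l)
  convert h using 1 <;> (funext w; simp [Matrix.mul_apply])

theorem IsMatPrimitive.mul_right {f F : ℂ → Mat n} (hF : IsMatPrimitive f F) (P : Mat n) :
    IsMatPrimitive (fun w => f w * P) (fun w => F w * P) := by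
  intro i j
  have h := IsFormalPrimitive.sum fun l (_ : l ∈ Finset.univ) => (hF i l).const_smul (P l j)
  convert h using 1 <;> (funext w; simp [Matrix.mul_apply, mul_comm])

theorem IsMatPrimitive.mem {ρ : ℝ} {f F : ℂ → Mat n} (hF : IsMatPrimitive f F)
    (hf : f ∈ mEP n ρ) : F ∈ mEP n ρ := fun i j => (hF i j).mem (hf i j)

theorem IsMatPrimitive.hasDerivAt {f F : ℂ → Mat n} (hF : IsMatPrimitive f F) (w : ℂ) :
    HasDerivAt F (f w) w := hasDerivAt_matrix.2 fun i j => (hF i j).hasDerivAt w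

theorem exists_isMatPrimitive {ρ : ℝ} {f : ℂ → Mat n} (hf : f ∈ mEP n ρ) :
    ∃ F, IsMatPrimitive f F := by
  choose F _ h using fun i j => exists_primitive_of_mem (hf i j)
  exact ⟨fun w => Matrix.of fun i j => F i j w, h⟩

/-! ### Spectral idempotents -/

/-- A decomposition of `π` into idempotents commuting with `A`, on each of which `A - lam` is
nilpotent, with `lam` in the set `S`. -/
structure SpecDec {m : Type*} [Fintype m] [DecidableEq m] (S : Set ℂ) (π A : Matrix m m ℂ) where
  /-- the eigenvalues -/
  Λ : Finset ℂ
  /-- the idempotents -/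
  P : ℂ → Matrix m m ℂ
  mem : ∀ l ∈ Λ, l ∈ S
  sum : ∑ l ∈ Λ, P l = π
  idem : ∀ l ∈ Λ, P l * P l = P l
  comm : ∀ l ∈ Λ, Commute (P l) A
  nil : ∀ l ∈ Λ, ∃ N : ℕ, (A - l • 1) ^ N * P l = 0

-- The powers of X - l in the characteristic polynomial are pairwise coprime. A Bézout relation
-- between the complementary products gives polynomials in B summing to 1, and Cayley–Hamilton makes
-- them orthogonal and gives nilpotency on each piece.
open Polynomial in
theorem exists_specDec {m : Type*} [Fintype m] [DecidableEq m] (B : Matrix m m ℂ) :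
    Nonempty (SpecDec (spectrum ℂ B) 1 B) := by
  classical
  set χ := B.charpoly with hχ
  set Λ := χ.roots.toFinset with hΛ
  have hmonic : χ.Monic := B.charpoly_monic
  have hprod : ∏ l ∈ Λ, (X - C l) ^ rootMultiplicity l χ = χ := by
    rw [hΛ, ← prod_multiset_root_eq_finset_root]
    exact ((IsAlgClosed.splits χ).eq_prod_roots_of_monic hmonic).symm
  have hCH : aeval B χ = 0 := B.aeval_self_charpoly
  have hmem : ∀ l ∈ Λ, l ∈ spectrum ℂ B := fun l hl => by
    rw [Matrix.mem_spectrum_iff_isRoot_charpoly]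
    exact isRoot_of_mem_roots (Multiset.mem_toFinset.1 hl)
  rcases Λ.eq_empty_or_nonempty with he | hne
  · refine ⟨⟨∅, fun _ => 0, by simp, ?_, by simp, by simp, by simp⟩⟩
    rw [he, Finset.prod_empty] at hprod
    rw [← hprod, map_one] at hCH
    rw [hCH, Finset.sum_empty]
  · set s : ℂ → ℂ[X] := fun l => (X - C l) ^ rootMultiplicity l χ with hs
    have hcop : Pairwise (Function.onFun IsCoprime fun i : Λ => s i) := by
      intro a b hab
      exact (pairwise_coprime_X_sub_C (K := ℂ) (s := fun i : ℂ => i) Function.injective_id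
        (fun h => hab (Subtype.ext h))).pow
    obtain ⟨μ, hμ⟩ := (exists_sum_eq_one_iff_pairwise_coprime hne).2 hcop
    set e : ℂ → ℂ[X] := fun l => μ l * ∏ j ∈ Λ \ {l}, s j with he
    have hsplit : ∀ l ∈ Λ, s l * ∏ j ∈ Λ \ {l}, s j = χ := fun l hl => by
      rw [← hprod, Finset.sdiff_singleton_eq_erase, Finset.mul_prod_erase _ _ hl]
    -- Each e l already contains every factor except the one at l, and e l' supplies that one, so
    -- the product is divisible by the characteristic polynomial.
    have hort : ∀ l ∈ Λ, ∀ l' ∈ Λ, l ≠ l' → aeval B (e l) * aeval B (e l') = 0 := by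
      intro l hl l' hl' hll
      have hd : χ ∣ e l * e l' := by
        rw [← hsplit l hl, mul_comm (s l)]
        refine mul_dvd_mul (Dvd.intro_left _ rfl) (Dvd.dvd.mul_left ?_ _)
        exact Finset.dvd_prod_of_mem s (by simp [hl, hll])
      obtain ⟨q, hq⟩ := hd
      rw [← map_mul, hq, map_mul, hCH, zero_mul]
    have hsum : ∑ l ∈ Λ, aeval B (e l) = 1 := by rw [← map_sum, hμ, map_one]
    refine ⟨⟨Λ, fun l => aeval B (e l), hmem, hsum, fun l hl => ?_, fun l hl => ?_,
      fun l hl => ⟨rootMultiplicity l χ, ?_⟩⟩⟩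
    · have h1 : aeval B (e l) * ∑ l' ∈ Λ, aeval B (e l') = aeval B (e l) := by
        rw [hsum, mul_one]
      rw [Finset.mul_sum, Finset.sum_eq_single l (fun l' hl' h => hort l hl l' hl' h.symm)
        (fun h => absurd hl h)] at h1
      exact h1
    · have := Commute.map (Commute.all (e l) X) (aeval B)
      rwa [aeval_X] at this
    · have h1 : (B - l • 1) ^ rootMultiplicity l χ = aeval B (s l) := by
        simp [hs, Algebra.algebraMap_eq_smul_one]
      rw [h1, ← map_mul, he]
      simp only
      rw [mul_left_comm, hsplit l hl, map_mul, hCH, mul_zero]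

/-- The upper left `K × K` block. -/
def headBlock {K : ℕ} (h : K ≤ n) (A : Mat n) : Mat K :=
  A.submatrix (Fin.castLE h) (Fin.castLE h)

/-- The inclusion of the first `K` coordinates. -/
def headIncl {K : ℕ} (h : K ≤ n) : Matrix (Fin n) (Fin K) ℂ :=
  (1 : Mat n).submatrix id (Fin.castLE h)

theorem headIncl_transpose_mul {K : ℕ} (h : K ≤ n) : (headIncl h).transpose * headIncl h = 1 := by
  ext i j
  rw [Matrix.mul_apply, Finset.sum_eq_single (Fin.castLE h j)]
  · simp [headIncl, Matrix.one_apply, Fin.ext_iff, eq_comm]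
  · intro b _ hb
    simp [headIncl, Matrix.one_apply, hb]
  · simp

theorem headIncl_mul_transpose {K : ℕ} (h : K ≤ n) :
    headIncl h * (headIncl h).transpose = headProj n K := by
  ext i j
  simp only [headIncl, Matrix.mul_apply, Matrix.submatrix_apply, id, Matrix.transpose_apply,
    Matrix.one_apply, headProj, Matrix.diagonal_apply, mul_ite, mul_one, mul_zero]
  by_cases hi : i.val < K
  · rw [Finset.sum_eq_single ⟨i.val, hi⟩]
    · simp [hi, Fin.ext_iff, eq_comm]
    · intro b _ hb
      have : ¬ i = Fin.castLE h b := fun h' => hb (by ext; simp [h'])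
      simp [this]
    · simp
  · rw [Finset.sum_eq_zero]
    · simp [hi]
    · intro b _
      have : ¬ i = Fin.castLE h b := fun h' => hi (by rw [h']; exact b.2)
      simp [this]

theorem headBlock_eq {K : ℕ} (h : K ≤ n) (A : Mat n) :
    headBlock h A = (headIncl h).transpose * A * headIncl h := by
  ext i j
  simp [headBlock, headIncl, Matrix.mul_apply, Matrix.one_apply]

theorem mul_headIncl {K : ℕ} (h : K ≤ n) {A : Mat n} (hA : A ∈ deltaAlg n K) :
    A * headIncl h = headIncl h * headBlock h A := by
  rw [headBlock_eq, ← Matrix.mul_assoc, ← Matrix.mul_assoc, headIncl_mul_transpose,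
    (headProj_commute hA).eq, Matrix.mul_assoc, ← headIncl_mul_transpose h, Matrix.mul_assoc,
    headIncl_transpose_mul, Matrix.mul_one]

theorem headIncl_transpose_mul_of_mem {K : ℕ} (h : K ≤ n) {A : Mat n} (hA : A ∈ deltaAlg n K) :
    (headIncl h).transpose * A = headBlock h A * (headIncl h).transpose := by
  rw [headBlock_eq, Matrix.mul_assoc, headIncl_mul_transpose, Matrix.mul_assoc,
    ← (headProj_commute hA).eq, ← headIncl_mul_transpose h, ← Matrix.mul_assoc, ← Matrix.mul_assoc,
    headIncl_transpose_mul, Matrix.one_mul]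

theorem headBlock_mul_left {K : ℕ} (h : K ≤ n) {A : Mat n} (hA : A ∈ deltaAlg n K) (Y : Mat n) :
    headBlock h (A * Y) = headBlock h A * headBlock h Y := by
  rw [headBlock_eq h (A * Y), ← Matrix.mul_assoc, headIncl_transpose_mul_of_mem h hA,
    headBlock_eq h Y]
  simp only [Matrix.mul_assoc]

theorem headBlock_mul_right {K : ℕ} (h : K ≤ n) {A : Mat n} (hA : A ∈ deltaAlg n K) (Y : Mat n) :
    headBlock h (Y * A) = headBlock h Y * headBlock h A := by
  rw [headBlock_eq h (Y * A), Matrix.mul_assoc, Matrix.mul_assoc, mul_headIncl h hA,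
    headBlock_eq h Y]
  simp only [Matrix.mul_assoc]

theorem headBlock_delta {K l : ℕ} (h : K ≤ n) (hl : K ≤ l) (A : Mat n) :
    headBlock h (delta l A) = headBlock h A := by
  ext i j
  simp only [headBlock, Matrix.submatrix_apply, delta_apply, Fin.val_castLE]
  rw [if_pos (Or.inl ⟨i.2.trans_le hl, j.2.trans_le hl⟩)]

/-- The decomposition of the block is transported by the inclusion of the first K coordinates. Only
eigenvalues of the block occur: the remaining diagonal entries of A are not restricted by the
boundary condition and must stay out of all growth estimates. -/
theorem exists_specDec_head {K : ℕ} (h : K ≤ n) {A : Mat n} (hA : A ∈ deltaAlg n K) :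
    Nonempty (SpecDec (spectrum ℂ (headBlock h A)) (headProj n K) A) := by
  obtain ⟨D⟩ := exists_specDec (headBlock h A)
  have hJ := headIncl_transpose_mul h
  set J := headIncl h with hJdef
  refine ⟨⟨D.Λ, fun l => J * D.P l * J.transpose, D.mem, ?_, fun l hl => ?_, fun l hl => ?_,
    fun l hl => ?_⟩⟩
  · rw [← Matrix.sum_mul, ← Matrix.mul_sum, D.sum, Matrix.mul_one, headIncl_mul_transpose]
  · calc J * D.P l * J.transpose * (J * D.P l * J.transpose)
        = J * D.P l * (J.transpose * J) * D.P l * J.transpose := by simp only [Matrix.mul_assoc]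
      _ = J * (D.P l * D.P l) * J.transpose := by rw [hJ]; simp only [Matrix.mul_assoc, Matrix.one_mul]
      _ = _ := by rw [D.idem l hl]
  · change _ = _
    rw [Matrix.mul_assoc, headIncl_transpose_mul_of_mem h hA, ← Matrix.mul_assoc, ← Matrix.mul_assoc,
      ← Matrix.mul_assoc, mul_headIncl h hA, Matrix.mul_assoc J, (D.comm l hl).eq, ← hJdef]
    simp only [Matrix.mul_assoc]
  · obtain ⟨N, hN⟩ := D.nil l hl
    refine ⟨N, ?_⟩
    have key : ∀ k : ℕ, (A - l • 1) ^ k * J = J * (headBlock h A - l • 1) ^ k := by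
      intro k
      induction k with
      | zero => simp
      | succ k ih =>
        have h1 : (A - l • 1) * J = J * (headBlock h A - l • 1) := by
          rw [Matrix.sub_mul, Matrix.mul_sub, hJdef, mul_headIncl h hA]; simp
        rw [pow_succ, pow_succ, Matrix.mul_assoc, h1, ← Matrix.mul_assoc, ih, Matrix.mul_assoc]
    rw [← Matrix.mul_assoc, ← Matrix.mul_assoc, key, Matrix.mul_assoc J, hN]
    simp

theorem exp_smul_one (c : ℂ) : NormedSpace.exp (c • (1 : Mat n)) = Complex.exp c • 1 := by
  rw [← Algebra.algebraMap_eq_smul_one]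
  refine (NormedSpace.algebraMap_exp_comm (𝕂 := ℂ) (𝔸 := Mat n) c).symm.trans ?_
  rw [Algebra.algebraMap_eq_smul_one, Complex.exp_eq_exp_ℂ]

theorem exp_mul_of_nilpotent {M P : Mat n} {N : ℕ} (h : M ^ N * P = 0) (w : ℂ) :
    NormedSpace.exp (w • M) * P =
      ∑ i ∈ Finset.range N, (w ^ i * (i.factorial : ℂ)⁻¹) • (M ^ i * P) := by
  have h1 := (NormedSpace.exp_series_hasSum_exp' (𝕂 := ℂ) (w • M)).mul_right P
  have h2 : HasSum (fun i : ℕ => ((i.factorial : ℂ)⁻¹ • (w • M) ^ i) * P)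
      (∑ i ∈ Finset.range N, ((i.factorial : ℂ)⁻¹ • (w • M) ^ i) * P) := by
    refine hasSum_sum_of_ne_finset_zero fun i hi => ?_
    obtain ⟨j, rfl⟩ := Nat.exists_eq_add_of_le (not_lt.1 fun h' => hi (Finset.mem_range.2 h'))
    rw [smul_pow, add_comm N j, pow_add M, smul_mul_assoc, smul_mul_assoc, Matrix.mul_assoc, h]
    simp
  refine (h1.unique h2).trans ?_
  refine Finset.sum_congr rfl fun i _ => ?_
  rw [smul_pow, smul_mul_assoc, smul_mul_assoc, smul_smul, mul_comm]

/-- On a generalised eigenspace z^A is z^l times a polynomial in ln z, because the exponential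
series of the nilpotent part terminates. -/
theorem exp_mul_mem_mEP {A P : Mat n} {l : ℂ} {N : ℕ} (h : (A - l • 1) ^ N * P = 0) :
    (fun w : ℂ => NormedSpace.exp (w • A) * P) ∈ mEP n l.re := by
  have key : (fun w : ℂ => NormedSpace.exp (w • A) * P) = fun w => ∑ i ∈ Finset.range N,
      (expMono l i w) • (((i.factorial : ℂ)⁻¹) • ((A - l • 1) ^ i * P)) := by
    funext w
    have e1 : w • A = (w * l) • (1 : Mat n) + w • (A - l • 1) := by
      rw [smul_sub, smul_smul]; abel
    rw [e1, Matrix.exp_add_of_commute _ _ (by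
      exact ((Commute.one_left (A - l • 1)).smul_left (w * l)).smul_right w), exp_smul_one,
      Matrix.mul_assoc, exp_mul_of_nilpotent h, smul_mul_assoc, Matrix.one_mul, Finset.smul_sum]
    refine Finset.sum_congr rfl fun i _ => ?_
    rw [expMono, smul_smul, smul_smul, mul_comm w l]
    congr 1; ring
  rw [key]
  refine sum_mem_mEP fun i _ => ?_
  have := smul_mem_mEP (expMono_mem (le_refl l.re) i)
    (const_mem_mEP (le_refl 0) (((i.factorial : ℂ)⁻¹) • ((A - l • 1) ^ i * P)))
  rwa [add_zero] at this

theorem SpecDec.exp_mul_mem {S : Set ℂ} {π A : Mat n} (D : SpecDec S π A) {l : ℂ} (hl : l ∈ D.Λ) :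
    (fun w : ℂ => NormedSpace.exp (w • A) * D.P l) ∈ mEP n l.re := by
  obtain ⟨N, hN⟩ := D.nil l hl
  exact exp_mul_mem_mEP hN

theorem SpecDec.exp_neg_mul_mem {S : Set ℂ} {π A : Mat n} (D : SpecDec S π A) {l : ℂ}
    (hl : l ∈ D.Λ) : (fun w : ℂ => NormedSpace.exp (-(w • A)) * D.P l) ∈ mEP n (-l.re) := by
  obtain ⟨N, hN⟩ := D.nil l hl
  have h : (-A - (-l) • 1) ^ N * D.P l = 0 := by
    have : -A - (-l) • (1 : Mat n) = -(A - l • 1) := by rw [neg_smul]; abel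
    rw [this, neg_pow, Matrix.mul_assoc, hN, Matrix.mul_zero]
  have := exp_mul_mem_mEP h
  simpa using this

theorem SpecDec.commute_exp {S : Set ℂ} {π A : Mat n} (D : SpecDec S π A) {l : ℂ}
    (hl : l ∈ D.Λ) (w : ℂ) : Commute (D.P l) (NormedSpace.exp (w • A)) :=
  ((D.comm l hl).smul_right w).exp_right

theorem SpecDec.commute_exp_neg {S : Set ℂ} {π A : Mat n} (D : SpecDec S π A) {l : ℂ}
    (hl : l ∈ D.Λ) (w : ℂ) : Commute (D.P l) (NormedSpace.exp (-(w • A))) :=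
  ((D.comm l hl).smul_right w).neg_right.exp_right

theorem SpecDec.exists_spread {S : Set ℂ} {π A : Mat n} (D : SpecDec S π A)
    (hS : ∀ x ∈ S, ∀ y ∈ S, |(x - y).re| < 1) :
    ∃ σ : ℝ, 0 ≤ σ ∧ σ < 1 ∧ ∀ l ∈ D.Λ, ∀ l' ∈ D.Λ, l.re - l'.re ≤ σ := by
  rcases (D.Λ ×ˢ D.Λ).eq_empty_or_nonempty with he | hne
  · refine ⟨0, le_rfl, one_pos, fun l hl l' hl' => ?_⟩
    have : (l, l') ∈ D.Λ ×ˢ D.Λ := Finset.mem_product.2 ⟨hl, hl'⟩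
    simp [he] at this
  · obtain ⟨p, hp, hmax⟩ := Finset.exists_max_image _ (fun p : ℂ × ℂ => p.1.re - p.2.re) hne
    obtain ⟨h1, h2⟩ := Finset.mem_product.1 hp
    refine ⟨p.1.re - p.2.re, ?_, ?_, fun l hl l' hl' =>
      hmax (l, l') (Finset.mem_product.2 ⟨hl, hl'⟩)⟩
    · simpa using hmax (p.1, p.1) (Finset.mem_product.2 ⟨h1, h1⟩)
    · exact (abs_lt.1 (hS _ (D.mem _ h1) _ (D.mem _ h2))).2

/-- Conjugation of head matrices by `z ^ A` raises the exponents by at most the spread. -/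
theorem SpecDec.adPow_mem {S : Set ℂ} {K : ℕ} {A : Mat n} (D : SpecDec S (headProj n K) A) {σ : ℝ}
    (hσ : ∀ l ∈ D.Λ, ∀ l' ∈ D.Λ, l.re - l'.re ≤ σ) {ρ : ℝ} {f : ℂ → Mat n}
    (hf : f ∈ mEP n ρ) (hh : ∀ w, IsHead K (f w)) :
    (fun w => adPow w A (f w)) ∈ mEP n (σ + ρ) := by
  have key : (fun w => adPow w A (f w)) = fun w => ∑ l ∈ D.Λ, ∑ l' ∈ D.Λ,
      (NormedSpace.exp (w • A) * D.P l) * f w * (NormedSpace.exp (-(w • A)) * D.P l') := by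
    funext w
    rw [adPow]
    conv_lhs => rw [← hh w, ← D.sum]
    simp only [Finset.sum_mul, Finset.mul_sum]
    rw [Finset.sum_comm]
    refine Finset.sum_congr rfl fun l hl => Finset.sum_congr rfl fun l' hl' => ?_
    rw [← (D.commute_exp_neg hl' w).eq]
    simp only [Matrix.mul_assoc]
  rw [key]
  refine sum_mem_mEP fun l hl => sum_mem_mEP fun l' hl' => ?_
  refine mEP_mono ?_ (mul_mem_mEP (mul_mem_mEP (D.exp_mul_mem hl) hf) (D.exp_neg_mul_mem hl'))
  linarith [hσ l hl l' hl']

/-- The gauge transform `z ^ {ad A} ∫ z ^ {- ad A} f` does not raise the exponents. -/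
theorem SpecDec.adPow_primitive_mem {S : Set ℂ} {K : ℕ} {A : Mat n}
    (D : SpecDec S (headProj n K) A) {ρ : ℝ} {f F : ℂ → Mat n} (hf : f ∈ mEP n ρ)
    (hF : IsMatPrimitive (fun w => adPow (-w) A (f w)) F) (hFh : ∀ w, IsHead K (F w)) :
    (fun w => adPow w A (F w)) ∈ mEP n ρ := by
  have key : (fun w => adPow w A (F w)) = fun w => ∑ l ∈ D.Λ, ∑ l' ∈ D.Λ,
      (NormedSpace.exp (w • A) * D.P l) * (D.P l * F w * D.P l') *
        (NormedSpace.exp (-(w • A)) * D.P l') := by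
    funext w
    rw [adPow]
    conv_lhs => rw [← hFh w, ← D.sum]
    simp only [Finset.sum_mul, Finset.mul_sum]
    rw [Finset.sum_comm]
    refine Finset.sum_congr rfl fun l hl => Finset.sum_congr rfl fun l' hl' => ?_
    rw [← (D.commute_exp_neg hl' w).eq]
    calc _ = NormedSpace.exp (w • A) * D.P l * F w * D.P l' * NormedSpace.exp (-(w • A)) := by
          simp only [Matrix.mul_assoc]
      _ = NormedSpace.exp (w • A) * (D.P l * D.P l) * F w * (D.P l' * D.P l') *
          NormedSpace.exp (-(w • A)) := by rw [D.idem l hl, D.idem l' hl']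
      _ = _ := by simp only [Matrix.mul_assoc]
  rw [key]
  refine sum_mem_mEP fun l hl => sum_mem_mEP fun l' hl' => ?_
  -- Between the eigenspaces of l and l' the conjugation shifts exponents by exactly l' - l in real
  -- part. Integration keeps them, and conjugating back undoes the shift; estimating without the
  -- idempotents would lose the spread twice.
  have h1 : (fun w => D.P l * adPow (-w) A (f w) * D.P l') ∈ mEP n (-l.re + ρ + l'.re) := by
    have : (fun w => D.P l * adPow (-w) A (f w) * D.P l') = fun w =>
        (NormedSpace.exp (-(w • A)) * D.P l) * f w * (NormedSpace.exp (w • A) * D.P l') := by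
      funext w
      rw [adPow, ← (D.commute_exp hl' w).eq, ← (D.commute_exp_neg hl w).eq]
      rw [neg_smul, neg_neg]
      have := (D.commute_exp hl' w).eq
      calc _ = D.P l * NormedSpace.exp (-(w • A)) * f w * (NormedSpace.exp (w • A) * D.P l') := by
            simp only [Matrix.mul_assoc]
        _ = _ := by rw [← this]
    rw [this]
    exact mul_mem_mEP (mul_mem_mEP (D.exp_neg_mul_mem hl) hf) (D.exp_mul_mem hl')
  have h2 := ((hF.mul_left (D.P l)).mul_right (D.P l')).mem h1
  refine mEP_mono ?_ (mul_mem_mEP (mul_mem_mEP (D.exp_mul_mem hl) h2) (D.exp_neg_mul_mem hl'))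
  linarith

end

/-! ### Growth of conjugation by z^A on head matrices, uniformly in A; openness of the gap
condition. -/

section



variable {n : ℕ}

/-! ### Growth of `z ^ A` on the head block -/

theorem norm_exp_mul_headProj_le (K : ℕ) (X : Mat n) :
    ‖NormedSpace.exp X * headProj n K‖ ≤ Real.exp ‖X‖ := by
  rcases isEmpty_or_nonempty (Fin n) with h | h
  · rw [Subsingleton.elim (NormedSpace.exp X * headProj n K) 0, norm_zero]
    exact (Real.exp_pos _).le
  · have h1 : ‖NormedSpace.exp X‖ ≤ Real.exp ‖X‖ := by
      have hs := NormedSpace.exp_series_hasSum_exp' (𝕂 := ℂ) X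
      have hr := NormedSpace.exp_series_hasSum_exp' (𝕂 := ℝ) ‖X‖
      rw [← Real.exp_eq_exp_ℝ] at hr
      refine hs.norm_le_of_bounded hr fun k => ?_
      rw [norm_smul, smul_eq_mul, norm_inv, Complex.norm_natCast]
      gcongr
      exact norm_pow_le X k
    calc _ ≤ ‖NormedSpace.exp X‖ * ‖headProj n K‖ := norm_mul_le _ _
      _ ≤ Real.exp ‖X‖ * 1 := by gcongr; exact norm_headProj_le K
      _ = _ := mul_one _

/-- The growth of conjugation by `z ^ A` on matrices supported in the upper left block. -/
def headGrowth (K : ℕ) (A : Mat n) (w : ℂ) : ℝ :=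
  ‖NormedSpace.exp (w • A) * headProj n K‖ * ‖NormedSpace.exp (-(w • A)) * headProj n K‖

theorem headGrowth_nonneg (K : ℕ) (A : Mat n) (w : ℂ) : 0 ≤ headGrowth K A w := by
  unfold headGrowth; positivity

theorem headGrowth_neg (K : ℕ) (A : Mat n) (w : ℂ) : headGrowth K A (-w) = headGrowth K A w := by
  simp only [headGrowth, neg_smul, neg_neg, mul_comm]

theorem headGrowth_le (K : ℕ) (A : Mat n) (w : ℂ) :
    headGrowth K A w ≤ Real.exp (2 * (‖w‖ * ‖A‖)) := by
  have h1 := norm_exp_mul_headProj_le K (w • A)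
  have h2 := norm_exp_mul_headProj_le K (-(w • A))
  rw [norm_neg] at h2
  rw [norm_smul] at h1 h2
  rw [headGrowth, two_mul, Real.exp_add]
  gcongr

theorem exp_add_mul_headProj {K : ℕ} {A : Mat n} (hA : A ∈ deltaAlg n K) (w w' : ℂ) :
    NormedSpace.exp ((w + w') • A) * headProj n K =
      (NormedSpace.exp (w • A) * headProj n K) * (NormedSpace.exp (w' • A) * headProj n K) := by
  have h := (headProj_commute (exp_mem_deltaAlg (smul_mem_deltaAlg hA w'))).eq
  rw [exp_add_smul]
  calc _ = NormedSpace.exp (w • A) * (NormedSpace.exp (w' • A) * (headProj n K * headProj n K)) := by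
        rw [headProj_mul_self, Matrix.mul_assoc]
    _ = NormedSpace.exp (w • A) * ((headProj n K * NormedSpace.exp (w' • A)) * headProj n K) := by
        rw [h]; simp only [Matrix.mul_assoc]
    _ = _ := by simp only [Matrix.mul_assoc]

/-- Submultiplicativity lets one good bound at a single real argument control all larger arguments,
and such a single bound is stable under perturbation of A. -/
theorem headGrowth_add {K : ℕ} {A : Mat n} (hA : A ∈ deltaAlg n K) (w w' : ℂ) :
    headGrowth K A (w + w') ≤ headGrowth K A w * headGrowth K A w' := by
  have e1 := exp_add_mul_headProj hA w w'
  have e2 := exp_add_mul_headProj hA (-w) (-w')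
  rw [← neg_add, neg_smul, neg_smul, neg_smul] at e2
  rw [headGrowth, e1, e2]
  calc _ ≤ (‖NormedSpace.exp (w • A) * headProj n K‖ * ‖NormedSpace.exp (w' • A) * headProj n K‖) *
      (‖NormedSpace.exp (-(w • A)) * headProj n K‖ *
        ‖NormedSpace.exp (-(w' • A)) * headProj n K‖) := by
        gcongr <;> exact norm_mul_le _ _
    _ = _ := by rw [headGrowth, headGrowth]; ring

theorem headGrowth_nat_mul {K : ℕ} {A : Mat n} (hA : A ∈ deltaAlg n K) (w : ℂ) (q : ℕ) :
    headGrowth K A (q * w) ≤ headGrowth K A w ^ q := by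
  induction q with
  | zero =>
    have := headGrowth_le K A 0
    simpa using this
  | succ q ih =>
    rw [Nat.cast_succ, add_mul, one_mul, pow_succ]
    refine (headGrowth_add hA _ _).trans ?_
    gcongr
    exact headGrowth_nonneg K A w

/-- Conjugation by `z ^ A` on the upper left block grows at most like `|z| ^ σ`. -/
def HeadBound (K : ℕ) (A : Mat n) (T C σ : ℝ) : Prop :=
  ∀ w : ℂ, |w.im| ≤ T → headGrowth K A w ≤ C * Real.exp (σ * |w.re|)

/-- The real parts of the eigenvalues of the upper left block differ by less than `1`. -/
def BlockGap {K : ℕ} (h : K ≤ n) (A : Mat n) : Prop :=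
  ∀ x ∈ spectrum ℂ (headBlock h A), ∀ y ∈ spectrum ℂ (headBlock h A), |(x - y).re| < 1

/-- The factor z^A contributes z^l with logarithms and z^{-A} contributes z^{-l'}. The logarithms
are absorbed by any exponent strictly above the spread; half of the excess σ' - σ is spent on each
factor. -/
theorem tendsto_headGrowth {S : Set ℂ} {K : ℕ} {A : Mat n} (D : SpecDec S (headProj n K) A) {σ : ℝ}
    (hσ : ∀ l ∈ D.Λ, ∀ l' ∈ D.Λ, l.re - l'.re ≤ σ) {σ' : ℝ} (hσ' : σ < σ') :
    Tendsto (fun t : ℝ => Real.exp (-(σ' * t)) * headGrowth K A t) atTop (𝓝 0) := by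
  have hpair : ∀ l ∈ D.Λ, ∀ l' ∈ D.Λ, Tendsto (fun t : ℝ => Real.exp (-(σ' * t)) *
      (‖NormedSpace.exp ((t : ℂ) • A) * D.P l‖ * ‖NormedSpace.exp (-((t : ℂ) • A)) * D.P l'‖))
      atTop (𝓝 0) := by
    intro l hl l' hl'
    set δ : ℝ := (σ' - σ) / 2 with hδ
    have hδ0 : -δ < 0 := by rw [hδ]; linarith
    have key : ∀ (ρ : ℝ) (f : ℂ → Mat n), f ∈ mEP n ρ →
        Tendsto (fun t : ℝ => Real.exp (-(ρ + δ) * t) * ‖f t‖) atTop (𝓝 0) := by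
      intro ρ f hf
      have h1 : (fun w => expMono ((-(ρ + δ) : ℝ) : ℂ) 0 w • f w) ∈ mEP n (-δ) := by
        have := smul_mem_mEP (expMono_mem (d := ((-(ρ + δ) : ℝ) : ℂ)) (ρ := -(ρ + δ)) (by simp) 0) hf
        exact mEP_mono (by linarith) this
      have h2 := (tendsto_of_mem_mEP hδ0 h1 0).norm
      rw [norm_zero] at h2
      refine h2.congr fun t => ?_
      rw [zero_add, norm_smul, expMono, pow_zero, mul_one, Complex.norm_exp]
      congr 2
      rw [← Complex.ofReal_mul, Complex.ofReal_re]
    have h := (key _ _ (D.exp_mul_mem hl)).mul (key _ _ (D.exp_neg_mul_mem hl'))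
    rw [mul_zero] at h
    refine squeeze_zero' (Eventually.of_forall fun t => by positivity) ?_ h
    filter_upwards [eventually_ge_atTop 0] with t ht
    have e : Real.exp (-(σ' * t)) ≤ Real.exp (-(l.re + δ) * t) * Real.exp (-(-l'.re + δ) * t) := by
      rw [← Real.exp_add]
      refine Real.exp_le_exp.2 ?_
      have := hσ l hl l' hl'
      have h3 : l.re - l'.re + 2 * δ ≤ σ' := by rw [hδ]; linarith
      nlinarith
    calc _ ≤ (Real.exp (-(l.re + δ) * t) * Real.exp (-(-l'.re + δ) * t)) *
        (‖NormedSpace.exp ((t : ℂ) • A) * D.P l‖ * ‖NormedSpace.exp (-((t : ℂ) • A)) * D.P l'‖) := by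
          gcongr
      _ = _ := by ring
  have hsum := tendsto_finsetSum D.Λ fun l hl => tendsto_finsetSum D.Λ fun l' hl' =>
    hpair l hl l' hl'
  simp only [Finset.sum_const_zero] at hsum
  refine squeeze_zero (fun t => mul_nonneg (Real.exp_pos _).le (headGrowth_nonneg _ _ _))
    (fun t => ?_) hsum
  simp only [← Finset.mul_sum]
  rw [← Finset.sum_mul, headGrowth]
  have e : ∀ X : Mat n, X * headProj n K = ∑ l ∈ D.Λ, X * D.P l := fun X => by
    rw [← Finset.mul_sum, D.sum]
  rw [e, e]
  gcongr <;> exact norm_sum_le _ _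

/-- The constants have to be uniform for A near A₀, although the Jordan structure may change there.
So the growth is compared with e^{σN} at one large N, where the inequality is strict and hence open
in A, and then iterated by submultiplicativity. -/
theorem exists_headBound {K : ℕ} (h : K ≤ n) {A₀ : Mat n} (hA₀ : A₀ ∈ deltaAlg n K)
    (hgap : BlockGap h A₀) (T : ℝ) :
    ∃ σ C : ℝ, 0 ≤ σ ∧ σ < 1 ∧ 0 < C ∧
      ∀ᶠ A in 𝓝 A₀, A ∈ deltaAlg n K → HeadBound K A T C σ := by
  obtain ⟨D⟩ := exists_specDec_head h hA₀
  obtain ⟨σ₀, h0, h1, hσ₀⟩ := D.exists_spread hgap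
  -- Strictly between the spread and 1: above the spread to absorb logarithms and perturbations,
  -- below 1 to keep integrability.
  set σ : ℝ := (σ₀ + 1) / 2 with hσ
  have hlim := tendsto_headGrowth D hσ₀ (σ' := σ) (by rw [hσ]; linarith)
  obtain ⟨N, hN1, hN0⟩ := ((hlim.eventually (gt_mem_nhds one_pos)).and
    (eventually_gt_atTop 0)).exists
  have hσ0 : 0 ≤ σ := by rw [hσ]; linarith
  have hN2 : headGrowth K A₀ N < Real.exp (σ * N) := by
    rw [Real.exp_neg, inv_mul_lt_iff₀ (Real.exp_pos _), mul_one] at hN1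
    exact hN1
  have hcont : Continuous fun A : Mat n => headGrowth K A N := by
    have hexp : Continuous (fun A : Mat n => NormedSpace.exp A) := NormedSpace.exp_continuous
    unfold headGrowth
    exact ((hexp.comp (continuous_id.const_smul (N : ℂ))).mul continuous_const).norm.mul
      ((hexp.comp (continuous_id.const_smul (N : ℂ)).neg).mul continuous_const).norm
  set m : ℝ := ‖A₀‖ + 1 with hm
  refine ⟨σ, Real.exp (2 * (N * m)) * Real.exp (2 * (T * m)), hσ0, by rw [hσ]; linarith,
    by positivity, ?_⟩
  filter_upwards [hcont.continuousAt.eventually (gt_mem_nhds hN2),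
    continuous_norm.continuousAt.eventually (gt_mem_nhds (lt_add_one ‖A₀‖))] with A hA1 hA2 hA
  have hreal : ∀ t : ℝ, 0 ≤ t →
      headGrowth K A t ≤ Real.exp (2 * (N * m)) * Real.exp (σ * t) := by
    intro t ht
    -- Write t = qN + remainder: q steps cost e^{σN} each, and the remainder, at most N, costs only
    -- a constant.
    set q : ℕ := ⌊t / N⌋₊ with hq
    have hq1 : (q : ℝ) * N ≤ t := by
      have := Nat.floor_le (div_nonneg ht hN0.le)
      rwa [← hq, le_div_iff₀ hN0] at this
    have hq2 : t - q * N ≤ N := by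
      have := (Nat.lt_floor_add_one (t / N)).le
      rw [← hq, div_le_iff₀ hN0] at this
      linarith
    have e : (t : ℂ) = (q : ℂ) * (N : ℂ) + ((t - q * N : ℝ) : ℂ) := by push_cast; ring
    rw [e]
    refine (headGrowth_add hA _ _).trans ?_
    rw [mul_comm]
    refine mul_le_mul ?_ ?_ (headGrowth_nonneg _ _ _) (Real.exp_pos _).le
    · refine (headGrowth_le K A _).trans (Real.exp_le_exp.2 ?_)
      rw [Complex.norm_real, Real.norm_of_nonneg (by linarith)]
      gcongr
    · refine (headGrowth_nat_mul hA _ q).trans ?_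
      calc _ ≤ Real.exp (σ * N) ^ q := by
            gcongr
            exact headGrowth_nonneg _ _ _
        _ = Real.exp (σ * (q * N)) := by rw [← Real.exp_nat_mul]; congr 1; ring
        _ ≤ _ := Real.exp_le_exp.2 (by gcongr)
  intro w hw
  have habs : headGrowth K A (w.re : ℂ) ≤ Real.exp (2 * (N * m)) * Real.exp (σ * |w.re|) := by
    rcases le_total 0 w.re with hr | hr
    · rw [abs_of_nonneg hr]; exact hreal _ hr
    · rw [abs_of_nonpos hr, ← headGrowth_neg, ← Complex.ofReal_neg]
      exact hreal _ (by linarith)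
  have him : headGrowth K A (w.im * Complex.I) ≤ Real.exp (2 * (T * m)) := by
    refine (headGrowth_le K A _).trans (Real.exp_le_exp.2 ?_)
    rw [norm_mul, Complex.norm_I, mul_one, Complex.norm_real, Real.norm_eq_abs]
    gcongr
    exact (abs_nonneg _).trans hw
  conv_lhs => rw [← Complex.re_add_im w]
  refine (headGrowth_add hA _ _).trans ?_
  calc _ ≤ (Real.exp (2 * (N * m)) * Real.exp (σ * |w.re|)) * Real.exp (2 * (T * m)) := by
        gcongr
        exact headGrowth_nonneg _ _ _
    _ = _ := by ring

theorem HeadBound.norm_adPow_le {K : ℕ} {A : Mat n} {T C σ : ℝ} (hb : HeadBound K A T C σ)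
    (hA : A ∈ deltaAlg n K) {Y : Mat n} (hY : IsHead K Y) {w : ℂ} (hw : |w.im| ≤ T) :
    ‖adPow w A Y‖ ≤ C * Real.exp (σ * |w.re|) * ‖Y‖ := by
  have h := (headProj_commute (exp_mem_deltaAlg (Subalgebra.neg_mem _
    (smul_mem_deltaAlg hA w)))).eq
  have e : adPow w A Y = (NormedSpace.exp (w • A) * headProj n K) * Y *
      (NormedSpace.exp (-(w • A)) * headProj n K) := by
    rw [← h, adPow]
    conv_lhs => rw [← hY]
    simp only [Matrix.mul_assoc]
  calc ‖adPow w A Y‖ ≤ ‖NormedSpace.exp (w • A) * headProj n K‖ * ‖Y‖ *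
        ‖NormedSpace.exp (-(w • A)) * headProj n K‖ := by
        rw [e]
        refine (norm_mul_le _ _).trans ?_
        gcongr
        exact norm_mul_le _ _
    _ = headGrowth K A w * ‖Y‖ := by rw [headGrowth]; ring
    _ ≤ _ := by gcongr; exact hb w hw

/-! ### Openness of the gap condition -/

/-- The eigenvalues of blocks near the given one stay in a fixed disc. The pairs in that disc
violating the gap form a compact set on which the two characteristic values never vanish
simultaneously, and compactness makes this persist for nearby matrices. -/
theorem isOpen_blockGap {K : ℕ} (h : K ≤ n) : IsOpen {A : Mat n | BlockGap h A} := by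
  rw [isOpen_iff_mem_nhds]
  intro A₀ hA₀
  -- The factor ‖1‖ is kept because the identity has norm 0 when K = 0.
  set r : ℝ := (‖headBlock h A₀‖ + 1) * ‖(1 : Mat K)‖ with hr
  have hblk : Continuous fun A : Mat n => headBlock h A :=
    continuous_id.matrix_submatrix _ _
  set Q : Set (ℂ × ℂ) := (Metric.closedBall 0 r ×ˢ Metric.closedBall 0 r) ∩
    {p | 1 ≤ |(p.1 - p.2).re|} with hQ
  have hQc : IsCompact Q := by
    refine ((isCompact_closedBall _ _).prod (isCompact_closedBall _ _)).inter_right ?_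
    exact isClosed_le continuous_const (Complex.continuous_re.comp
      (continuous_fst.sub continuous_snd)).abs
  set g : Mat n → ℂ → ℂ := fun A x => (algebraMap ℂ (Mat K) x - headBlock h A).det with hg
  have hgc : Continuous fun p : Mat n × ℂ => g p.1 p.2 := by
    refine Continuous.matrix_det ?_
    refine Continuous.sub ?_ (hblk.comp continuous_fst)
    simp only [Algebra.algebraMap_eq_smul_one]
    exact continuous_snd.smul continuous_const
  have hspec : ∀ A x, x ∈ spectrum ℂ (headBlock h A) ↔ g A x = 0 := by
    intro A x
    rw [spectrum.mem_iff, Matrix.isUnit_iff_isUnit_det, isUnit_iff_ne_zero, not_not]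
  have hev : ∀ᶠ A in 𝓝 A₀, ∀ p ∈ Q, g A p.1 ≠ 0 ∨ g A p.2 ≠ 0 := by
    refine hQc.eventually_forall_of_forall_eventually fun p hp => ?_
    have hne : g A₀ p.1 ≠ 0 ∨ g A₀ p.2 ≠ 0 := by
      by_contra hcon
      push Not at hcon
      have := hA₀ p.1 ((hspec _ _).2 hcon.1) p.2 ((hspec _ _).2 hcon.2)
      exact absurd hp.2 (not_le.2 this)
    have c1 : Continuous fun q : Mat n × (ℂ × ℂ) => g q.1 q.2.1 :=
      hgc.comp (continuous_fst.prodMk (continuous_fst.comp continuous_snd))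
    have c2 : Continuous fun q : Mat n × (ℂ × ℂ) => g q.1 q.2.2 :=
      hgc.comp (continuous_fst.prodMk (continuous_snd.comp continuous_snd))
    rcases hne with hne | hne
    · filter_upwards [c1.continuousAt.eventually_ne (x := (A₀, p)) hne] with q hq using Or.inl hq
    · filter_upwards [c2.continuousAt.eventually_ne (x := (A₀, p)) hne] with q hq using Or.inr hq
  filter_upwards [hev, hblk.norm.continuousAt.eventually
    (gt_mem_nhds (lt_add_one ‖headBlock h A₀‖))] with A hA1 hA2
  intro x hx y hy
  have hnorm : ∀ z ∈ spectrum ℂ (headBlock h A), z ∈ Metric.closedBall (0 : ℂ) r := by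
    intro z hz
    rw [mem_closedBall_zero_iff]
    refine (spectrum.norm_le_norm_mul_of_mem hz).trans ?_
    rw [hr]
    gcongr
  by_contra hcon
  rcases hA1 (x, y) ⟨⟨hnorm x hx, hnorm y hy⟩, not_lt.1 hcon⟩ with h' | h'
  · exact h' ((hspec _ _).1 hx)
  · exact h' ((hspec _ _).1 hy)

theorem headBlock_adPow {K l : ℕ} (h : l ≤ n) (hl : K ≤ l) {X : Mat n} (hX : X ∈ deltaAlg n K)
    (w : ℂ) (Y : Mat n) :
    headBlock h (adPow w X Y) = headBlock h (NormedSpace.exp (w • X)) * headBlock h Y *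
      headBlock h (NormedSpace.exp (-(w • X))) := by
  have h1 := deltaAlg_mono hl (exp_mem_deltaAlg (smul_mem_deltaAlg hX w))
  have h2 := deltaAlg_mono hl (exp_mem_deltaAlg (Subalgebra.neg_mem _ (smul_mem_deltaAlg hX w)))
  rw [adPow, headBlock_mul_right h h2, headBlock_mul_left h h1]

/-- The conjugating exponentials lie in the block algebra of size K ≤ l, on which taking the l × l
block is multiplicative on either side. This carries the gap condition of a larger block through the
lower levels. -/
theorem spectrum_headBlock_adPow {K l : ℕ} (h : l ≤ n) (hl : K ≤ l) {X : Mat n}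
    (hX : X ∈ deltaAlg n K) (w : ℂ) (Y : Mat n) :
    spectrum ℂ (headBlock h (adPow w X Y)) = spectrum ℂ (headBlock h Y) := by
  have h1 := deltaAlg_mono hl (exp_mem_deltaAlg (smul_mem_deltaAlg hX w))
  have h2 := deltaAlg_mono hl (exp_mem_deltaAlg (Subalgebra.neg_mem _ (smul_mem_deltaAlg hX w)))
  have hone : headBlock h (1 : Mat n) = 1 := by
    rw [headBlock_eq, Matrix.mul_one, headIncl_transpose_mul]
  let u : (Mat l)ˣ := ⟨headBlock h (NormedSpace.exp (w • X)),
    headBlock h (NormedSpace.exp (-(w • X))),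
    by rw [← headBlock_mul_left h h1, exp_smul_mul_exp_neg, hone],
    by rw [← headBlock_mul_left h h2, exp_neg_mul_exp_smul, hone]⟩
  rw [headBlock_adPow h hl hX]
  exact spectrum.units_conjugate (u := u)

theorem blockGap_adPow_iff {K l : ℕ} (h : l ≤ n) (hl : K ≤ l) {X : Mat n}
    (hX : X ∈ deltaAlg n K) (w : ℂ) (Y : Mat n) : BlockGap h (adPow w X Y) ↔ BlockGap h Y := by
  rw [BlockGap, BlockGap, spectrum_headBlock_adPow h hl hX]

theorem blockGap_delta_iff {K l : ℕ} (h : K ≤ n) (hl : K ≤ l) (Y : Mat n) :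
    BlockGap h (delta l Y) ↔ BlockGap h Y := by
  rw [BlockGap, BlockGap, headBlock_delta h hl]

end

/-! ### The gauged radial equation: decay estimates along rays and uniqueness. -/

section



variable {n : ℕ}

/-! ### Estimates along horizontal rays -/

theorem tendsto_shift {E : Type*} {l : Filter E} {f : ℂ → E} {s : ℂ}
    (h : Tendsto (fun x : ℝ => f (s + x)) atTop l) (t : ℝ) :
    Tendsto (fun x : ℝ => f (s + t + x)) atTop l := by
  refine (h.comp (tendsto_atTop_add_const_left atTop t tendsto_id)).congr fun x => ?_
  simp [add_assoc]

theorem hasDerivAt_ray {E : Type*} [NormedAddCommGroup E] [NormedSpace ℂ E] {f : ℂ → E} {f' : E}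
    {s : ℂ} {t : ℝ} (h : HasDerivAt f f' (s + t)) :
    HasDerivAt (fun x : ℝ => f (s + x)) f' t := by
  have h1 : HasDerivAt (fun x : ℝ => s + (x : ℂ)) 1 t :=
    (Complex.ofRealCLM.hasDerivAt (x := t)).const_add s
  have h2 := h.scomp t h1
  rwa [one_smul] at h2

/-- A function tending to `0` along a ray with exponentially small derivative is exponentially
small. -/
theorem norm_le_of_deriv_le {E : Type*} [NormedAddCommGroup E] [NormedSpace ℂ E] {f f' : ℂ → E}
    {s : ℂ} {B η : ℝ} (hη : 0 < η)
    (hf : ∀ t : ℝ, 0 ≤ t → HasDerivAt f (f' (s + t)) (s + t))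
    (hb : ∀ t : ℝ, 0 ≤ t → ‖f' (s + t)‖ ≤ B * Real.exp (-η * (s.re + t)))
    (hlim : Tendsto (fun t : ℝ => f (s + t)) atTop (𝓝 0)) :
    ‖f s‖ ≤ B / η * Real.exp (-η * s.re) := by
  have hB0 : 0 ≤ B := by
    have := (norm_nonneg _).trans (hb 0 le_rfl)
    exact nonneg_of_mul_nonneg_left this (Real.exp_pos _)
  -- The increment from the base point is compared with the explicit primitive of the bound; letting
  -- the right end go to infinity turns it into a bound for f s, since f tends to 0.
  set g : ℝ → E := fun t => f (s + t) - f s with hg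
  have hgd : ∀ t : ℝ, 0 ≤ t → HasDerivAt g (f' (s + t)) t := fun t ht =>
    (hasDerivAt_ray (hf t ht)).sub_const _
  have hbd : ∀ b : ℝ, 0 ≤ b → ‖g b‖ ≤ B / η * Real.exp (-η * s.re) := by
    intro b hbb
    have hBd : ∀ x : ℝ, HasDerivAt
        (fun x : ℝ => B / η * (Real.exp (-η * s.re) - Real.exp (-η * (s.re + x))))
        (B * Real.exp (-η * (s.re + x))) x := by
      intro x
      have h := ((((hasDerivAt_id x).const_add s.re).const_mul (-η)).exp.const_sub
        (Real.exp (-η * s.re))).const_mul (B / η)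
      refine h.congr_deriv ?_
      simp only [id]
      field_simp
    have h := image_norm_le_of_norm_deriv_right_le_deriv_boundary (f := g) (a := 0) (b := b)
      (fun x hx => (hgd x hx.1).continuousAt.continuousWithinAt)
      (fun x hx => (hgd x hx.1).hasDerivWithinAt) (by simp [hg]) hBd
      (fun x hx => hb x hx.1) (Set.right_mem_Icc.2 hbb)
    refine h.trans ?_
    have : 0 ≤ B / η := by positivity
    gcongr
    linarith [Real.exp_pos (-η * (s.re + b))]
  have hl : Tendsto (fun t => ‖g t‖) atTop (𝓝 ‖0 - f s‖) := (hlim.sub_const _).norm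
  rw [zero_sub, norm_neg] at hl
  exact le_of_tendsto hl ((eventually_ge_atTop 0).mono hbd)

theorem norm_lie_le (A B : Mat n) : ‖⁅A, B⁆‖ ≤ 2 * ‖A‖ * ‖B‖ := by
  rw [Ring.lie_def]
  calc _ ≤ ‖A * B‖ + ‖B * A‖ := norm_sub_le _ _
    _ ≤ ‖A‖ * ‖B‖ + ‖B‖ * ‖A‖ := add_le_add (norm_mul_le _ _) (norm_mul_le _ _)
    _ = _ := by ring

theorem norm_anti_le (A B : Mat n) : ‖A * B + B * A‖ ≤ 2 * ‖A‖ * ‖B‖ := by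
  calc _ ≤ ‖A * B‖ + ‖B * A‖ := norm_add_le _ _
    _ ≤ ‖A‖ * ‖B‖ + ‖B‖ * ‖A‖ := add_le_add (norm_mul_le _ _) (norm_mul_le _ _)
    _ = _ := by ring

theorem isHead_headProj_mul {K : ℕ} {Y : Mat n} (hY : Y ∈ deltaAlg n K) :
    IsHead K (headProj n K * Y) := by
  rw [IsHead, ← Matrix.mul_assoc, headProj_mul_self, (headProj_commute hY).eq, Matrix.mul_assoc,
    headProj_mul_self]

theorem norm_headProj_mul_le (K : ℕ) (Y : Mat n) : ‖headProj n K * Y‖ ≤ ‖Y‖ := by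
  refine (norm_mul_le _ _).trans ?_
  calc _ ≤ 1 * ‖Y‖ := by gcongr; exact norm_headProj_le K
    _ = _ := one_mul _

theorem adPow_headProj {K : ℕ} {A : Mat n} (hA : A ∈ deltaAlg n K) (w : ℂ) :
    adPow w A (headProj n K) = headProj n K := by
  rw [adPow, ← (headProj_commute (exp_mem_deltaAlg (smul_mem_deltaAlg hA w))).eq,
    Matrix.mul_assoc, exp_smul_mul_exp_neg, Matrix.mul_one]

theorem IsHead.adPow {K : ℕ} {A Y : Mat n} (hY : IsHead K Y) (hA : A ∈ deltaAlg n K) (w : ℂ) :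
    IsHead K (adPow w A Y) := by
  rw [IsHead]
  conv_lhs => rw [← adPow_headProj hA w, ← adPow_mul, ← adPow_mul, hY]

/-- The bounds on conjugation by `z ^ A` on the head block used throughout the estimates. -/
structure ConjBound (K : ℕ) (A : Mat n) (T C σ : ℝ) : Prop where
  mem : A ∈ deltaAlg n K
  bound : HeadBound K A T C σ
  C_pos : 0 < C
  σ_nonneg : 0 ≤ σ
  σ_lt : σ < 1

variable {K : ℕ} {A : Mat n} {T C σ : ℝ}

theorem ConjBound.norm_head (h : ConjBound K A T C σ) {g : Mat n} (hg : IsHead K g) {s : ℂ}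
    (hs : |s.im| ≤ T) (hs0 : 0 ≤ s.re) : ‖adPow s A g‖ ≤ C * Real.exp (σ * s.re) * ‖g‖ := by
  have := h.bound.norm_adPow_le h.mem hg hs
  rwa [abs_of_nonneg hs0] at this

/-- A small head matrix stays small after conjugation. -/
theorem ConjBound.norm_head_small (h : ConjBound K A T C σ) {g : Mat n} (hg : IsHead K g) {s : ℂ}
    (hs : |s.im| ≤ T) (hs0 : 0 ≤ s.re) {γ : ℝ} (hγ : ‖g‖ ≤ γ * Real.exp (-s.re)) :
    ‖adPow s A g‖ ≤ C * γ * Real.exp (-(1 - σ) * s.re) := by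
  calc _ ≤ C * Real.exp (σ * s.re) * ‖g‖ := h.norm_head hg hs hs0
    _ ≤ C * Real.exp (σ * s.re) * (γ * Real.exp (-s.re)) := by
        have := h.C_pos; gcongr
    _ = C * γ * (Real.exp (σ * s.re) * Real.exp (-s.re)) := by ring
    _ = _ := by rw [← Real.exp_add]; congr 2; ring

theorem ConjBound.norm_proj_neg (h : ConjBound K A T C σ) {Y : Mat n} (hY : Y ∈ deltaAlg n K)
    {t : ℝ} (ht : 0 ≤ t) (hT : 0 ≤ T) :
    ‖adPow (-(t : ℂ)) A (headProj n K * Y)‖ ≤ C * Real.exp (σ * t) * ‖Y‖ := by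
  have h1 := h.bound.norm_adPow_le h.mem (isHead_headProj_mul hY) (w := -(t : ℂ)) (by simpa using hT)
  rw [Complex.neg_re, Complex.ofReal_re, abs_neg, abs_of_nonneg ht] at h1
  refine h1.trans ?_
  have := h.C_pos
  gcongr
  exact norm_headProj_mul_le K Y

/-- A commutator with a head matrix sees only the head part of Y. This is what replaces the growth
of z^{ad A} on all matrices, which is uncontrolled, by its growth on head matrices. -/
theorem lie_head_eq {g Y : Mat n} (hg : IsHead K g) (hY : Y ∈ deltaAlg n K) :
    ⁅g, Y⁆ = ⁅g, headProj n K * Y⁆ := by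
  rw [Ring.lie_def, Ring.lie_def, ← Matrix.mul_assoc, hg.right, (headProj_commute hY).eq,
    Matrix.mul_assoc Y, hg.left]

/-- Conjugating at the point `s` a commutator that lives at the later point `s + t`. -/
theorem ConjBound.norm_kernel (h : ConjBound K A T C σ) {g Y : Mat n} (hg : IsHead K g)
    (hY : Y ∈ deltaAlg n K) {s : ℂ} (hs : |s.im| ≤ T) (hs0 : 0 ≤ s.re) {t : ℝ} (ht : 0 ≤ t) {γ : ℝ}
    (hγ : ‖g‖ ≤ γ * Real.exp (-(s.re + t))) :
    ‖adPow s A ⁅g, adPow (-(s + t)) A Y⁆‖ ≤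
      2 * C ^ 2 * γ * ‖Y‖ * Real.exp (-(1 - σ) * (s.re + t)) := by
  have hT : 0 ≤ T := (abs_nonneg _).trans hs
  -- The two conjugations of Y combine to one by z^{-t}. So the factors e^{σ Re s} and e^{σt}
  -- multiply to e^{σ(Re s + t)}, which the decay e^{-(Re s + t)} of g beats.
  have e : adPow s A ⁅g, adPow (-(s + t)) A Y⁆ =
      ⁅adPow s A g, adPow (-(t : ℂ)) A (headProj n K * Y)⁆ := by
    rw [lie_head_eq hg (adPow_mem_deltaAlg h.mem _ hY), adPow_lie, adPow_mul s A (headProj n K),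
      adPow_headProj h.mem, ← adPow_add, adPow_mul, adPow_headProj h.mem]
    congr 3
    ring
  rw [e]
  have hC := h.C_pos
  have hγ0 : 0 ≤ γ := nonneg_of_mul_nonneg_left ((norm_nonneg _).trans hγ) (Real.exp_pos _)
  have b1 : ‖adPow s A g‖ ≤ C * Real.exp (σ * s.re) * (γ * Real.exp (-(s.re + t))) :=
    (h.norm_head hg hs hs0).trans (mul_le_mul_of_nonneg_left hγ (by positivity))
  have b2 := h.norm_proj_neg hY ht hT
  calc _ ≤ 2 * ‖adPow s A g‖ * ‖adPow (-(t : ℂ)) A (headProj n K * Y)‖ := norm_lie_le _ _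
    _ ≤ 2 * (C * Real.exp (σ * s.re) * (γ * Real.exp (-(s.re + t)))) *
        (C * Real.exp (σ * t) * ‖Y‖) :=
        mul_le_mul (mul_le_mul_of_nonneg_left b1 zero_le_two) b2 (norm_nonneg _) (by positivity)
    _ = 2 * C ^ 2 * γ * ‖Y‖ * (Real.exp (σ * s.re) * Real.exp (-(s.re + t)) * Real.exp (σ * t)) := by
        ring
    _ = _ := by rw [← Real.exp_add, ← Real.exp_add]; congr 2; ring

/-! ### The equation in the gauge `Θ = z ^ {ad A} Φ` -/

/-- Right hand side of the equation for `Θ = z ^ {ad A} Φ`, where `g` is the perturbation. -/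
def gaugeRHS (K : ℕ) (A g : Mat n) (s : ℂ) (θ : Mat n) : Mat n :=
  ⁅θ, delta K θ - A⁆ +
    ⁅adPow s A g * deltaDiff K θ + deltaDiff K θ * adPow s A g, θ⁆

/-- Only off-block times off-block contributes, and the two cross terms N g N cancel in the
commutator. -/
theorem delta_anti_lie {g : Mat n} (hg : g ∈ deltaAlg n K) (θ : Mat n) :
    delta K ⁅g * deltaDiff K θ + deltaDiff K θ * g, θ⁆ = ⁅g, deltaDiff K θ * deltaDiff K θ⁆ := by
  rw [Ring.lie_def, Ring.lie_def, ← deltaDiff_mul_of_mem_left hg, ← deltaDiff_mul_of_mem_right hg,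
    ← deltaDiff_add, delta_sub, delta_deltaDiff_mul, delta_mul_deltaDiff, deltaDiff_add,
    deltaDiff_mul_of_mem_left hg, deltaDiff_mul_of_mem_right hg]
  noncomm_ring

theorem delta_gaugeRHS (hA : A ∈ deltaAlg n K) {g : Mat n} (hg : IsHead K g) (s : ℂ) (θ : Mat n) :
    delta K (gaugeRHS K A g s θ) =
      ⁅A, delta K θ - A⁆ + ⁅adPow s A g, deltaDiff K θ * deltaDiff K θ⁆ := by
  have hmem : delta K θ - A ∈ deltaAlg n K := Subalgebra.sub_mem _ (delta_mem K θ) hA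
  rw [gaugeRHS, delta_add, delta_anti_lie (adPow_mem_deltaAlg hA s hg.mem)]
  congr 1
  rw [Ring.lie_def, delta_sub, delta_mul_of_mem_right hmem, delta_mul_of_mem_left hmem,
    Ring.lie_def]
  noncomm_ring

/-- Variation of constants: the linear part of the block equation is ⁅A, ·⁆, which the conjugation
by z^{-A} removes, leaving a source term that involves only g and the off-block part. -/
theorem hasDerivAt_of_gaugeRHS (hA : A ∈ deltaAlg n K) {g : Mat n} (hg : IsHead K g) {s : ℂ}
    {Θ : ℂ → Mat n} (hΘ : HasDerivAt Θ (gaugeRHS K A g s (Θ s)) s) :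
    HasDerivAt (fun s => adPow (-s) A (delta K (Θ s) - A))
      ⁅g, adPow (-s) A (deltaDiff K (Θ s) * deltaDiff K (Θ s))⁆ s := by
  have h1 : HasDerivAt (fun s => delta K (Θ s) - A) (delta K (gaugeRHS K A g s (Θ s))) s :=
    ((deltaL K).hasFDerivAt.comp_hasDerivAt s hΘ).sub_const A
  refine (hasDerivAt_adPow_neg (X := A) h1).congr_deriv ?_
  rw [delta_gaugeRHS hA hg, add_sub_cancel_left, adPow_lie, adPow_neg_adPow]

/-- A solution, in the gauge `Θ`, along the horizontal ray from `s`, with its asymptotics. -/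
structure GaugeSol (K : ℕ) (A : Mat n) (G Θ : ℂ → Mat n) (X : Mat n) (M : ℝ) (s : ℂ) : Prop where
  deriv : ∀ t : ℝ, 0 ≤ t → HasDerivAt Θ (gaugeRHS K A (G (s + t)) (s + t) (Θ (s + t))) (s + t)
  bound : ∀ t : ℝ, 0 ≤ t → ‖Θ (s + t)‖ ≤ M
  lim : Tendsto (fun t : ℝ => Θ (s + t)) atTop (𝓝 X)
  limD : Tendsto (fun t : ℝ => adPow (-(s + t)) A (delta K (Θ (s + t)) - A)) atTop (𝓝 0)

theorem GaugeSol.shift {G Θ : ℂ → Mat n} {X : Mat n} {M : ℝ} {s : ℂ} (h : GaugeSol K A G Θ X M s)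
    {t : ℝ} (ht : 0 ≤ t) : GaugeSol K A G Θ X M (s + t) where
  deriv x hx := by
    have := h.deriv (t + x) (add_nonneg ht hx)
    rwa [Complex.ofReal_add, ← add_assoc] at this
  bound x hx := by
    have := h.bound (t + x) (add_nonneg ht hx)
    rwa [Complex.ofReal_add, ← add_assoc] at this
  lim := tendsto_shift h.lim t
  limD := tendsto_shift (f := fun s => adPow (-s) A (delta K (Θ s) - A)) h.limD t

/-- The perturbation `G` is a head matrix of size `O(1/z)` for `Re s ≥ R`. -/
structure SmallHead (K : ℕ) (G : ℂ → Mat n) (γ R : ℝ) : Prop where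
  head : ∀ s, IsHead K (G s)
  bound : ∀ s : ℂ, R ≤ s.re → ‖G s‖ ≤ γ * Real.exp (-s.re)
  R_nonneg : 0 ≤ R

theorem SmallHead.nonneg {G : ℂ → Mat n} {γ R : ℝ} (h : SmallHead K G γ R) : 0 ≤ γ := by
  have := (norm_nonneg _).trans (h.bound R (by simp))
  exact nonneg_of_mul_nonneg_left this (Real.exp_pos _)

theorem GaugeSol.M_nonneg {G Θ : ℂ → Mat n} {X : Mat n} {M : ℝ} {s : ℂ}
    (h : GaugeSol K A G Θ X M s) : 0 ≤ M := (norm_nonneg _).trans (h.bound 0 le_rfl)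

theorem norm_sq_deltaDiff_le {θ : Mat n} {M : ℝ} (h : ‖θ‖ ≤ M) :
    ‖deltaDiff K θ * deltaDiff K θ‖ ≤ M ^ 2 := by
  have h1 := (norm_deltaDiff_le K θ).trans h
  calc _ ≤ ‖deltaDiff K θ‖ * ‖deltaDiff K θ‖ := norm_mul_le _ _
    _ ≤ M * M := by gcongr; exact (norm_nonneg _).trans h
    _ = _ := by ring

theorem GaugeSol.norm_delta_sub_le (hc : ConjBound K A T C σ) {G Θ : ℂ → Mat n} {γ R : ℝ}
    (hG : SmallHead K G γ R) {X : Mat n} {M : ℝ} {s : ℂ} (h : GaugeSol K A G Θ X M s)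
    (hs : |s.im| ≤ T) (hR : R ≤ s.re) :
    ‖delta K (Θ s) - A‖ ≤ 2 * C ^ 2 * γ * M ^ 2 / (1 - σ) * Real.exp (-(1 - σ) * s.re) := by
  have hη : 0 < 1 - σ := sub_pos.2 hc.σ_lt
  have hs0 : 0 ≤ s.re := hG.R_nonneg.trans hR
  have hγ := hG.nonneg
  have hM := h.M_nonneg
  have hC := hc.C_pos
  -- The outer conjugation is frozen at the base point s, so it passes through the derivative as a
  -- constant linear map, and at r = s the two conjugations cancel.
  have key := norm_le_of_deriv_le (s := s)
    (f := fun r => adPow s A (adPow (-r) A (delta K (Θ r) - A)))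
    (f' := fun r => adPow s A ⁅G r, adPow (-r) A (deltaDiff K (Θ r) * deltaDiff K (Θ r))⁆)
    (B := 2 * C ^ 2 * γ * M ^ 2) hη
    (fun t ht => (adPowL s A).hasFDerivAt.comp_hasDerivAt _
      (hasDerivAt_of_gaugeRHS hc.mem (hG.head _) (h.deriv t ht)))
    (fun t ht => by
      refine (hc.norm_kernel (hG.head _) (deltaDiff_mul_deltaDiff_mem K _ _) hs hs0 ht
        (γ := γ) ?_).trans ?_
      · have := hG.bound (s + t) (by simp; linarith)
        simpa using this
      · have := norm_sq_deltaDiff_le (K := K) (h.bound t ht)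
        gcongr)
    (by
      have := ((adPowL s A).continuous.tendsto 0).comp h.limD
      rwa [map_zero] at this)
  simpa only [adPow_adPow_neg] using key

theorem lie_sub_lie (a b c d : Mat n) : ⁅a, b⁆ - ⁅c, d⁆ = ⁅a - c, b⁆ + ⁅c, b - d⁆ := by
  simp only [Ring.lie_def]; noncomm_ring

theorem lie_sub_lie_left (g a b : Mat n) : ⁅g, a⁆ - ⁅g, b⁆ = ⁅g, a - b⁆ := by
  simp only [Ring.lie_def]; noncomm_ring

/-- If the difference is at most B along the ray, its block part is first bounded through the
integrated block equation by a decaying multiple of B. Inserting this into the full equation and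
integrating once more bounds the difference itself by a decaying multiple of B. -/
theorem GaugeSol.norm_diff_le (hc : ConjBound K A T C σ) {G Θ₁ Θ₂ : ℂ → Mat n} {γ R : ℝ}
    (hG : SmallHead K G γ R) {X : Mat n} {M : ℝ} {s : ℂ} (h₁ : GaugeSol K A G Θ₁ X M s)
    (h₂ : GaugeSol K A G Θ₂ X M s) (hs : |s.im| ≤ T) (hR : R ≤ s.re) {B : ℝ}
    (hB : ∀ t : ℝ, 0 ≤ t → ‖Θ₁ (s + t) - Θ₂ (s + t)‖ ≤ B) :
    ‖Θ₁ s - Θ₂ s‖ ≤ (12 * C ^ 2 * γ * M ^ 2 / (1 - σ) + 8 * C * γ * M) / (1 - σ) *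
      Real.exp (-(1 - σ) * s.re) * B := by
  have hη : 0 < 1 - σ := sub_pos.2 hc.σ_lt
  have hγ := hG.nonneg
  have hM := h₁.M_nonneg
  have hC := hc.C_pos
  have hB0 : 0 ≤ B := (norm_nonneg _).trans (hB 0 le_rfl)
  have hN : ∀ t : ℝ, 0 ≤ t → ‖deltaDiff K (Θ₁ (s + t)) - deltaDiff K (Θ₂ (s + t))‖ ≤ B :=
    fun t ht => by
      rw [← deltaDiff_sub]; exact (norm_deltaDiff_le _ _).trans (hB t ht)
  have hN1 : ∀ t : ℝ, 0 ≤ t → ‖deltaDiff K (Θ₁ (s + t))‖ ≤ M := fun t ht =>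
    (norm_deltaDiff_le _ _).trans (h₁.bound t ht)
  have hN2 : ∀ t : ℝ, 0 ≤ t → ‖deltaDiff K (Θ₂ (s + t))‖ ≤ M := fun t ht =>
    (norm_deltaDiff_le _ _).trans (h₂.bound t ht)
  -- difference of the diagonal blocks
  have hD : ∀ t : ℝ, 0 ≤ t → ‖delta K (Θ₁ (s + t)) - delta K (Θ₂ (s + t))‖ ≤
      4 * C ^ 2 * γ * M * B / (1 - σ) * Real.exp (-(1 - σ) * (s.re + t)) := by
    intro x hx
    have g₁ := h₁.shift hx
    have g₂ := h₂.shift hx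
    have hx0 : 0 ≤ (s + x).re := by simp; linarith [hG.R_nonneg]
    have key := norm_le_of_deriv_le (s := s + x)
      (f := fun r => adPow (s + x) A (adPow (-r) A (delta K (Θ₁ r) - A)
        - adPow (-r) A (delta K (Θ₂ r) - A)))
      (f' := fun r => adPow (s + x) A (⁅G r, adPow (-r) A (deltaDiff K (Θ₁ r) * deltaDiff K (Θ₁ r))⁆
        - ⁅G r, adPow (-r) A (deltaDiff K (Θ₂ r) * deltaDiff K (Θ₂ r))⁆))
      (B := 4 * C ^ 2 * γ * M * B) hη
      (fun t ht => (adPowL (s + x) A).hasFDerivAt.comp_hasDerivAt _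
        ((hasDerivAt_of_gaugeRHS hc.mem (hG.head _) (g₁.deriv t ht)).sub
          (hasDerivAt_of_gaugeRHS hc.mem (hG.head _) (g₂.deriv t ht))))
      (fun t ht => by
        rw [lie_sub_lie_left, ← adPow_sub_right]
        refine (hc.norm_kernel (hG.head _) (Subalgebra.sub_mem _ (deltaDiff_mul_deltaDiff_mem K _ _)
          (deltaDiff_mul_deltaDiff_mem K _ _)) (by simpa using hs) hx0 ht (γ := γ) ?_).trans ?_
        · have := hG.bound (s + x + t) (by simp; linarith)
          simpa using this
        · have e1 : (s + x + t : ℂ) = s + ((x + t : ℝ) : ℂ) := by push_cast; ring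
          rw [e1]
          have hxt : 0 ≤ x + t := add_nonneg hx ht
          set N₁ := deltaDiff K (Θ₁ (s + ((x + t : ℝ) : ℂ)))
          set N₂ := deltaDiff K (Θ₂ (s + ((x + t : ℝ) : ℂ)))
          have e2 : N₁ * N₁ - N₂ * N₂ = N₁ * (N₁ - N₂) + (N₁ - N₂) * N₂ := by noncomm_ring
          have e3 : ‖N₁ * N₁ - N₂ * N₂‖ ≤ 2 * M * B := by
            rw [e2]
            calc _ ≤ ‖N₁‖ * ‖N₁ - N₂‖ + ‖N₁ - N₂‖ * ‖N₂‖ :=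
                  (norm_add_le _ _).trans (add_le_add (norm_mul_le _ _) (norm_mul_le _ _))
              _ ≤ M * B + B * M := by
                  gcongr
                  exacts [hN1 _ hxt, hN _ hxt, hN _ hxt, hN2 _ hxt]
              _ = _ := by ring
          calc _ ≤ 2 * C ^ 2 * γ * (2 * M * B) * Real.exp (-(1 - σ) * ((s + x).re + t)) := by gcongr
            _ = _ := by ring)
      (by
        have := ((adPowL (s + x) A).continuous.tendsto (0 - 0)).comp (g₁.limD.sub g₂.limD)
        rwa [sub_zero, map_zero] at this)
    rw [adPow_sub_right, adPow_adPow_neg, adPow_adPow_neg, sub_sub_sub_cancel_right] at key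
    simpa using key
  have hG' : ∀ t : ℝ, 0 ≤ t → ‖adPow (s + t) A (G (s + t))‖ ≤
      C * γ * Real.exp (-(1 - σ) * (s.re + t)) := by
    intro t ht
    have := hc.norm_head_small (hG.head (s + t)) (s := s + t) (by simpa using hs)
      (by simp; linarith [hG.R_nonneg]) (hG.bound (s + t) (by simp; linarith))
    simpa using this
  have key := norm_le_of_deriv_le (s := s) (f := fun r => Θ₁ r - Θ₂ r)
    (f' := fun r => gaugeRHS K A (G r) r (Θ₁ r) - gaugeRHS K A (G r) r (Θ₂ r))
    (B := (12 * C ^ 2 * γ * M ^ 2 / (1 - σ) + 8 * C * γ * M) * B) hη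
    (fun t ht => (h₁.deriv t ht).sub (h₂.deriv t ht))
    (fun t ht => by
      have a1 := (h₁.shift ht).norm_delta_sub_le hc hG (by simpa using hs) (by simp; linarith)
      have a2 := hD t ht
      have a3 := hG' t ht
      have a4 := hB t ht
      have a5 := hN t ht
      have a6 := hN2 t ht
      have a7 := h₁.bound t ht
      have a8 := h₂.bound t ht
      simp only [Complex.add_re, Complex.ofReal_re] at a1
      set E := Real.exp (-(1 - σ) * (s.re + t)) with hE
      have hE0 : 0 < E := Real.exp_pos _
      set θ₁ := Θ₁ (s + t)
      set θ₂ := Θ₂ (s + t)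
      set g := adPow (s + t) A (G (s + t))
      have e : gaugeRHS K A (G (s + t)) (s + t) θ₁ - gaugeRHS K A (G (s + t)) (s + t) θ₂ =
          (⁅θ₁ - θ₂, delta K θ₁ - A⁆ + ⁅θ₂, delta K θ₁ - delta K θ₂⁆) +
          (⁅g * (deltaDiff K θ₁ - deltaDiff K θ₂) + (deltaDiff K θ₁ - deltaDiff K θ₂) * g, θ₁⁆ +
            ⁅g * deltaDiff K θ₂ + deltaDiff K θ₂ * g, θ₁ - θ₂⁆) := by
        simp only [gaugeRHS, Ring.lie_def]
        noncomm_ring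
      rw [e]
      have b1 : ‖⁅θ₁ - θ₂, delta K θ₁ - A⁆‖ ≤
          2 * B * (2 * C ^ 2 * γ * M ^ 2 / (1 - σ) * E) :=
        (norm_lie_le _ _).trans (by gcongr)
      have b2 : ‖⁅θ₂, delta K θ₁ - delta K θ₂⁆‖ ≤
          2 * M * (4 * C ^ 2 * γ * M * B / (1 - σ) * E) :=
        (norm_lie_le _ _).trans (by gcongr)
      have b3 : ‖⁅g * (deltaDiff K θ₁ - deltaDiff K θ₂) +
          (deltaDiff K θ₁ - deltaDiff K θ₂) * g, θ₁⁆‖ ≤ 2 * (2 * (C * γ * E) * B) * M :=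
        (norm_lie_le _ _).trans (by
          gcongr
          exact (norm_anti_le _ _).trans (by gcongr))
      have b4 : ‖⁅g * deltaDiff K θ₂ + deltaDiff K θ₂ * g, θ₁ - θ₂⁆‖ ≤
          2 * (2 * (C * γ * E) * M) * B :=
        (norm_lie_le _ _).trans (by
          gcongr
          exact (norm_anti_le _ _).trans (by gcongr))
      calc _ ≤ (2 * B * (2 * C ^ 2 * γ * M ^ 2 / (1 - σ) * E) +
            2 * M * (4 * C ^ 2 * γ * M * B / (1 - σ) * E)) +
            (2 * (2 * (C * γ * E) * B) * M + 2 * (2 * (C * γ * E) * M) * B) :=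
            (norm_add_le _ _).trans (add_le_add ((norm_add_le _ _).trans (add_le_add b1 b2))
              ((norm_add_le _ _).trans (add_le_add b3 b4)))
        _ = _ := by ring)
    (by
      have := h₁.lim.sub h₂.lim
      rw [sub_self] at this
      exact this)
  refine key.trans (le_of_eq ?_)
  ring

/-- A contraction argument: starting from the trivial bound 2M, each application of the previous
estimate at all points of the ray halves the bound. -/
theorem GaugeSol.eq_of_large (hc : ConjBound K A T C σ) {G Θ₁ Θ₂ : ℂ → Mat n} {γ R : ℝ}
    (hG : SmallHead K G γ R) {X : Mat n} {M : ℝ} {s : ℂ} (h₁ : GaugeSol K A G Θ₁ X M s)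
    (h₂ : GaugeSol K A G Θ₂ X M s) (hs : |s.im| ≤ T) (hR : R ≤ s.re)
    (hlarge : (12 * C ^ 2 * γ * M ^ 2 / (1 - σ) + 8 * C * γ * M) / (1 - σ) *
      Real.exp (-(1 - σ) * s.re) ≤ 1 / 2) : Θ₁ s = Θ₂ s := by
  have hη : 0 < 1 - σ := sub_pos.2 hc.σ_lt
  have hγ := hG.nonneg
  have hM := h₁.M_nonneg
  have hC := hc.C_pos
  have key : ∀ k : ℕ, ∀ t : ℝ, 0 ≤ t → ‖Θ₁ (s + t) - Θ₂ (s + t)‖ ≤ 2 * M * (1 / 2) ^ k := by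
    intro k
    induction k with
    | zero =>
      intro t ht
      have := (_root_.norm_sub_le _ _).trans (add_le_add (h₁.bound t ht) (h₂.bound t ht))
      linarith
    | succ k ih =>
      intro t ht
      have h := (h₁.shift ht).norm_diff_le hc hG (h₂.shift ht) (by simpa using hs)
        (by simp; linarith) (B := 2 * M * (1 / 2) ^ k) (fun x hx => by
          have := ih (t + x) (add_nonneg ht hx)
          rwa [Complex.ofReal_add, ← add_assoc] at this)
      refine h.trans ?_
      have e : 2 * M * (1 / 2 : ℝ) ^ (k + 1) = 1 / 2 * (2 * M * (1 / 2) ^ k) := by ring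
      rw [e]
      refine mul_le_mul_of_nonneg_right (le_trans ?_ hlarge) (by positivity)
      refine mul_le_mul_of_nonneg_left (Real.exp_le_exp.2 ?_) (by positivity)
      rw [Complex.add_re, Complex.ofReal_re]
      nlinarith
  have hlim : Tendsto (fun k : ℕ => 2 * M * (1 / 2 : ℝ) ^ k) atTop (𝓝 (2 * M * 0)) :=
    (tendsto_pow_atTop_nhds_zero_of_lt_one (by norm_num) (by norm_num)).const_mul _
  rw [mul_zero] at hlim
  have h0 : ‖Θ₁ s - Θ₂ s‖ ≤ 0 := by
    refine ge_of_tendsto' hlim fun k => ?_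
    simpa using key k 0 le_rfl
  exact sub_eq_zero.1 (norm_le_zero_iff.1 h0)

end

/-! ### Course-of-values recursion, and the coefficient recursion in the gauge. -/

section



variable {n : ℕ}

/-! ### Recursions and Cauchy products -/

/-- Sequences can be defined by course-of-values recursion. -/
theorem exists_seq_of_step {α : Type*} (a : α) (step : ℕ → (ℕ → α) → α)
    (hstep : ∀ m f f', (∀ i ≤ m, f i = f' i) → step m f = step m f') :
    ∃ f : ℕ → α, f 0 = a ∧ ∀ m, f (m + 1) = step m f := by
  -- The m-th stage stores the whole sequence built so far; its value at i is frozen from stage i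
  -- on.
  let H : ℕ → ℕ → α := fun m => Nat.rec (fun _ => a)
    (fun m h => Function.update h (m + 1) (step m h)) m
  have hH : ∀ m, H (m + 1) = Function.update (H m) (m + 1) (step m (H m)) := fun _ => rfl
  have hst : ∀ i k, H (i + k) i = H i i := by
    intro i k
    induction k with
    | zero => rfl
    | succ k ih => rw [← add_assoc, hH, Function.update_of_ne (by omega), ih]
  refine ⟨fun k => H k k, rfl, fun m => ?_⟩
  simp only
  rw [hH, Function.update_self]
  refine hstep m _ _ fun i hi => ?_
  obtain ⟨k, rfl⟩ := Nat.exists_eq_add_of_le hi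
  exact hst i k

theorem sum_Icc_one_shift {M : Type*} [AddCommMonoid M] (m : ℕ) (f : ℕ → ℕ → M) :
    ∑ p ∈ Finset.Icc 1 (m + 1), f p (m + 1 - p) =
      ∑ x ∈ Finset.HasAntidiagonal.antidiagonal m, f (x.1 + 1) x.2 := by
  rw [Finset.Nat.sum_antidiagonal_eq_sum_range_succ (fun i j => f (i + 1) j), Finset.range_eq_Ico,
    ← Finset.Ico_add_one_right_eq_Icc, Finset.sum_Ico_eq_sum_range, Finset.range_eq_Ico]
  refine Finset.sum_congr (by simp) fun i _ => ?_
  rw [add_comm 1 i, Nat.add_sub_add_right]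

theorem sum_antidiagonal_filter_shift {M : Type*} [AddCommMonoid M] (m : ℕ) (f : ℕ → ℕ → M) :
    ∑ q ∈ Finset.HasAntidiagonal.antidiagonal (m + 1) with q.1 < m + 1, f q.1 q.2 =
      ∑ q ∈ Finset.HasAntidiagonal.antidiagonal m, f q.1 (q.2 + 1) := by
  rw [Finset.sum_filter, Finset.Nat.sum_antidiagonal_eq_sum_range_succ
    (fun i j => if i < m + 1 then f i j else 0), Finset.sum_range_succ, if_neg (lt_irrefl _),
    add_zero, Finset.Nat.sum_antidiagonal_eq_sum_range_succ (fun i j => f i (j + 1))]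
  refine Finset.sum_congr rfl fun i hi => ?_
  have := Finset.mem_range.1 hi
  rw [if_pos this, Nat.sub_add_comm (by omega)]

theorem sum_range_antidiagonal_le {a b : ℕ → ℝ} (ha : ∀ i, 0 ≤ a i) (hb : ∀ i, 0 ≤ b i) (N : ℕ) :
    ∑ k ∈ Finset.range N, ∑ q ∈ Finset.HasAntidiagonal.antidiagonal k, a q.1 * b q.2 ≤
      (∑ i ∈ Finset.range N, a i) * ∑ j ∈ Finset.range N, b j := by
  simp only [Finset.Nat.sum_antidiagonal_eq_sum_range_succ (fun i j => a i * b j)]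
  rw [Finset.sum_range_diag_flip N (fun i j => a i * b j), Finset.sum_mul_sum]
  refine Finset.sum_le_sum fun i _ => ?_
  refine Finset.sum_le_sum_of_subset_of_nonneg (Finset.range_subset_range.2 (Nat.sub_le _ _))
    fun j _ _ => mul_nonneg (ha i) (hb j)

/-! ### The recursion for the coefficients, in the gauge `Θ` -/

/-- The recursion for the diagonal blocks; here `g p` is the coefficient of order `p + 1` of the
perturbation. -/
def blockRec (K : ℕ) (g θ : ℕ → Mat n) (m : ℕ) : Mat n :=
  ∑ x ∈ Finset.HasAntidiagonal.antidiagonal m, ∑ q ∈ Finset.HasAntidiagonal.antidiagonal x.2,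
    ⁅g x.1, deltaDiff K (θ q.1) * deltaDiff K (θ q.2)⁆

/-- The recursion for the full matrix. -/
def fullRec (K : ℕ) (g θ : ℕ → Mat n) (m : ℕ) : Mat n :=
  ∑ q ∈ Finset.HasAntidiagonal.antidiagonal m, ⁅θ q.1, delta K (θ (q.2 + 1))⁆ +
    ∑ x ∈ Finset.HasAntidiagonal.antidiagonal m, ∑ q ∈ Finset.HasAntidiagonal.antidiagonal x.2,
      ⁅g x.1 * deltaDiff K (θ q.1) + deltaDiff K (θ q.1) * g x.1, θ q.2⁆

variable {K : ℕ}

theorem sum_antidiagonal_assoc {M : Type*} [AddCommMonoid M] (m : ℕ) (f : ℕ → ℕ → ℕ → M) :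
    ∑ x ∈ Finset.HasAntidiagonal.antidiagonal m, ∑ q ∈ Finset.HasAntidiagonal.antidiagonal x.2,
      f x.1 q.1 q.2 =
    ∑ y ∈ Finset.HasAntidiagonal.antidiagonal m, ∑ q ∈ Finset.HasAntidiagonal.antidiagonal y.1,
      f q.1 q.2 y.2 := by
  rw [Finset.sum_sigma', Finset.sum_sigma']
  refine Finset.sum_nbij' (fun z => ⟨(z.1.1 + z.2.1, z.2.2), (z.1.1, z.2.1)⟩)
    (fun z => ⟨(z.2.1, z.2.2 + z.1.2), (z.2.2, z.1.2)⟩) ?_ ?_ ?_ ?_ ?_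
  all_goals
    rintro ⟨⟨a, b⟩, ⟨c, d⟩⟩ h
    simp only [Finset.mem_sigma, Finset.HasAntidiagonal.mem_antidiagonal] at h ⊢
  · exact ⟨by omega, trivial⟩
  · exact ⟨by omega, trivial⟩
  · obtain ⟨_, rfl⟩ := h; rfl
  · obtain ⟨_, rfl⟩ := h; rfl

/-- Regrouped as an iterated Cauchy product, so that the sum over m can be evaluated product by
product. -/
theorem fullRec_eq (g θ : ℕ → Mat n) (m : ℕ) :
    fullRec K g θ m =
      ∑ q ∈ Finset.HasAntidiagonal.antidiagonal m, ⁅θ q.1, delta K (θ (q.2 + 1))⁆ +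
      ∑ y ∈ Finset.HasAntidiagonal.antidiagonal m,
        ⁅∑ q ∈ Finset.HasAntidiagonal.antidiagonal y.1,
          (g q.1 * deltaDiff K (θ q.2) + deltaDiff K (θ q.2) * g q.1), θ y.2⁆ := by
  rw [fullRec, sum_antidiagonal_assoc m
    fun i j k => ⁅g i * deltaDiff K (θ j) + deltaDiff K (θ j) * g i, θ k⁆]
  congr 1
  refine Finset.sum_congr rfl fun y _ => ?_
  simp only [Ring.lie_def, Finset.sum_mul, Finset.mul_sum, Finset.sum_sub_distrib]

theorem blockRec_congr {g θ θ' : ℕ → Mat n} {m : ℕ} (h : ∀ i ≤ m, θ i = θ' i) :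
    blockRec K g θ m = blockRec K g θ' m := by
  refine Finset.sum_congr rfl fun x hx => Finset.sum_congr rfl fun q hq => ?_
  rw [Finset.HasAntidiagonal.mem_antidiagonal] at hx hq
  rw [h q.1 (by omega), h q.2 (by omega)]

theorem fullRec_congr {g θ θ' : ℕ → Mat n} {m : ℕ} (h : ∀ i ≤ m, θ i = θ' i)
    (h' : delta K (θ (m + 1)) = delta K (θ' (m + 1))) : fullRec K g θ m = fullRec K g θ' m := by
  rw [fullRec, fullRec]
  refine congrArg₂ (· + ·) ?_ ?_
  · refine Finset.sum_congr rfl fun q hq => ?_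
    rw [Finset.HasAntidiagonal.mem_antidiagonal] at hq
    rw [h q.1 (by omega)]
    rcases Nat.lt_or_ge q.2 m with hlt | hge
    · rw [h (q.2 + 1) (by omega)]
    · rw [show q.2 = m by omega, h']
  · refine Finset.sum_congr rfl fun x hx => Finset.sum_congr rfl fun q hq => ?_
    rw [Finset.HasAntidiagonal.mem_antidiagonal] at hx hq
    rw [h q.1 (by omega), h q.2 (by omega)]

theorem blockRec_adPow {A : Mat n} (hA : A ∈ deltaAlg n K) (w : ℂ) (g θ : ℕ → Mat n) (m : ℕ) :
    adPow w A (blockRec K g θ m) =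
      blockRec K (fun i => adPow w A (g i)) (fun i => adPow w A (θ i)) m := by
  simp only [blockRec, adPow_sum, adPow_lie, adPow_mul, deltaDiff_adPow hA]

theorem fullRec_adPow {A : Mat n} (hA : A ∈ deltaAlg n K) (w : ℂ) (g θ : ℕ → Mat n) (m : ℕ) :
    adPow w A (fullRec K g θ m) =
      fullRec K (fun i => adPow w A (g i)) (fun i => adPow w A (θ i)) m := by
  simp only [fullRec, adPow_sum, adPow_lie, adPow_mul, adPow_add_right, deltaDiff_adPow hA,
    delta_adPow hA]

theorem delta_lie_of_mem {B : Mat n} (hB : B ∈ deltaAlg n K) (Y : Mat n) :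
    delta K ⁅Y, B⁆ = ⁅delta K Y, B⁆ := by
  rw [Ring.lie_def, Ring.lie_def, delta_sub, delta_mul_of_mem_left hB, delta_mul_of_mem_right hB]

theorem isHead_lie {g Y : Mat n} (hg : IsHead K g) (hY : Y ∈ deltaAlg n K) : IsHead K ⁅g, Y⁆ := by
  have h := (headProj_commute hY).eq
  rw [IsHead, Ring.lie_def, mul_sub, sub_mul, ← Matrix.mul_assoc, hg.left, Matrix.mul_assoc g, ← h,
    ← Matrix.mul_assoc g, hg.right, ← Matrix.mul_assoc _ Y g, h, Matrix.mul_assoc Y, hg.left,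
    Matrix.mul_assoc Y, hg.right]

theorem isHead_sum {ι : Type*} {s : Finset ι} {f : ι → Mat n} (h : ∀ i ∈ s, IsHead K (f i)) :
    IsHead K (∑ i ∈ s, f i) := by
  rw [IsHead, Finset.mul_sum, Finset.sum_mul]
  exact Finset.sum_congr rfl h

theorem isHead_blockRec {g : ℕ → Mat n} (hg : ∀ i, IsHead K (g i)) (θ : ℕ → Mat n) (m : ℕ) :
    IsHead K (blockRec K g θ m) :=
  isHead_sum fun _ _ => isHead_sum fun _ _ =>
    isHead_lie (hg _) (deltaDiff_mul_deltaDiff_mem K _ _)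

/-- The sum of ⁅δθ_i, δθ_j⁆ over i + j = m + 1 vanishes by antisymmetry, so omitting j = 0 leaves
the term ⁅δθ_0, δθ_{m+1}⁆. In the second sum the cross terms cancel after exchanging the indices.
This makes the block and the full recursion compatible. -/
theorem delta_fullRec {g : ℕ → Mat n} (hg : ∀ i, IsHead K (g i)) (θ : ℕ → Mat n) (m : ℕ) :
    delta K (fullRec K g θ m) =
      ⁅delta K (θ 0), delta K (θ (m + 1))⁆ + blockRec K g θ m := by
  rw [fullRec, delta_add]
  congr 1
  · rw [delta_sum]
    simp only [delta_lie_of_mem (delta_mem K _)]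
    have h1 := Finset.Nat.sum_antidiagonal_succ' (n := m)
      (f := fun q : ℕ × ℕ => ⁅delta K (θ q.1), delta K (θ q.2)⁆)
    have h2 := Finset.Nat.sum_antidiagonal_swap (n := m + 1)
      (f := fun q : ℕ × ℕ => ⁅delta K (θ q.1), delta K (θ q.2)⁆)
    have h3 : ∑ q ∈ Finset.HasAntidiagonal.antidiagonal (m + 1),
        ⁅delta K (θ q.1), delta K (θ q.2)⁆ = 0 := by
      have h4 : ∀ q : ℕ × ℕ, ⁅delta K (θ q.swap.1), delta K (θ q.swap.2)⁆ =
          -⁅delta K (θ q.1), delta K (θ q.2)⁆ := fun q => by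
        simp only [Ring.lie_def, Prod.fst_swap, Prod.snd_swap, neg_sub]
      rw [Finset.sum_congr rfl fun q _ => h4 q, Finset.sum_neg_distrib] at h2
      have h5 := h2.symm
      rw [eq_neg_iff_add_eq_zero, ← two_smul ℂ] at h5
      exact (smul_eq_zero.1 h5).resolve_left two_ne_zero
    rw [h3] at h1
    have h5 : ⁅delta K (θ 0), delta K (θ (m + 1))⁆ = -⁅delta K (θ (m + 1)), delta K (θ 0)⁆ := by
      simp only [Ring.lie_def, neg_sub]
    rw [h5]
    refine eq_neg_of_add_eq_zero_right ?_
    exact h1.symm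
  · rw [blockRec, delta_sum]
    refine Finset.sum_congr rfl fun x _ => ?_
    rw [delta_sum]
    have e : ∀ i j, delta K ⁅g x.1 * deltaDiff K (θ i) + deltaDiff K (θ i) * g x.1, θ j⁆ =
        (g x.1 * (deltaDiff K (θ i) * deltaDiff K (θ j))
          - deltaDiff K (θ j) * deltaDiff K (θ i) * g x.1) +
        (deltaDiff K (θ i) * g x.1 * deltaDiff K (θ j)
          - deltaDiff K (θ j) * g x.1 * deltaDiff K (θ i)) := fun i j => by
      rw [Ring.lie_def, ← deltaDiff_mul_of_mem_left (hg x.1).mem,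
        ← deltaDiff_mul_of_mem_right (hg x.1).mem, ← deltaDiff_add, delta_sub,
        delta_deltaDiff_mul, delta_mul_deltaDiff, deltaDiff_add,
        deltaDiff_mul_of_mem_left (hg x.1).mem, deltaDiff_mul_of_mem_right (hg x.1).mem]
      noncomm_ring
    have s1 := Finset.Nat.sum_antidiagonal_swap (n := x.2)
      (f := fun q : ℕ × ℕ => deltaDiff K (θ q.1) * deltaDiff K (θ q.2) * g x.1)
    have s2 := Finset.Nat.sum_antidiagonal_swap (n := x.2)
      (f := fun q : ℕ × ℕ => deltaDiff K (θ q.1) * g x.1 * deltaDiff K (θ q.2))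
    simp only [Prod.fst_swap, Prod.snd_swap] at s1 s2
    simp only [e]
    simp only [Ring.lie_def, Finset.sum_add_distrib, Finset.sum_sub_distrib]
    rw [s1, s2, sub_self, add_zero]

/-! ### The coefficients of the perturbation -/

/-- The coefficient of order `p + 1` of the perturbation `-U (z + U)⁻¹`. -/
def pertCoeff (U : Mat n) (p : ℕ) (s : ℂ) : Mat n :=
  ((-1) ^ (p + 1) * Complex.exp (-(((p : ℂ) + 1) * s))) • U ^ (p + 1)

theorem isHead_mul {X Y : Mat n} (hX : IsHead K X) (hY : IsHead K Y) : IsHead K (X * Y) := by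
  rw [IsHead, ← Matrix.mul_assoc, hX.left, Matrix.mul_assoc, hY.right]

theorem isHead_smul {X : Mat n} (hX : IsHead K X) (c : ℂ) : IsHead K (c • X) := by
  rw [IsHead, Matrix.mul_smul, Matrix.smul_mul, hX]

theorem isHead_pow {U : Mat n} (hU : IsHead K U) (p : ℕ) : IsHead K (U ^ (p + 1)) := by
  induction p with
  | zero => simpa using hU
  | succ p ih => rw [pow_succ]; exact isHead_mul ih hU

theorem isHead_pertCoeff {U : Mat n} (hU : IsHead K U) (p : ℕ) (s : ℂ) :
    IsHead K (pertCoeff U p s) := isHead_smul (isHead_pow hU p) _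

theorem pertCoeff_mem {U : Mat n} (p : ℕ) : pertCoeff U p ∈ mEP n (-((p : ℝ) + 1)) := by
  have h : (fun s : ℂ => Complex.exp (-(((p : ℂ) + 1) * s))) ∈ EP (-((p : ℝ) + 1)) := by
    have := expMono_mem (ρ := -((p : ℝ) + 1)) (d := -((p : ℂ) + 1)) (by simp) 0
    convert this using 1
    funext s
    simp [expMono]
    ring_nf
  have h2 := smul_mem_mEP h (const_mem_mEP le_rfl ((-1 : ℂ) ^ (p + 1) • U ^ (p + 1)))
  rw [add_zero] at h2
  convert h2 using 1
  funext s
  rw [pertCoeff, smul_smul, mul_comm]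

theorem isHead_UMat (v : Fin K → ℂ) : IsHead K (UMat n v) :=
  isHead_diagonal fun i hi => by rw [if_neg hi]

theorem lie_smul_smul (a b : ℂ) (X Y : Mat n) : ⁅a • X, b • Y⁆ = (a * b) • ⁅X, Y⁆ := by
  simp only [Ring.lie_def, smul_mul_smul_comm, smul_sub, mul_comm b a]

theorem exp_scalar_eq {m p i j : ℕ} (h : p + (i + j) = m) (s : ℂ) :
    Complex.exp (-(((m : ℂ) + 1) * s)) * (Complex.exp (i * s) * Complex.exp (j * s)) *
      (-1) ^ (p + 1) = (-1) ^ (p + 1) * Complex.exp (-(((p : ℂ) + 1) * s)) := by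
  rw [mul_comm, ← Complex.exp_add, ← Complex.exp_add, ← h]
  congr 2
  push_cast
  ring

/-- After writing φ_i = z^i ψ_i all remaining powers of z combine into those carried by the
coefficients of -U(z+U)⁻¹; the shift p ↦ p + 1 accounts for the sum starting at 1. -/
theorem exp_smul_bCoeff (v : Fin K → ℂ) (ψ : ℕ → ℂ → Mat n) (m : ℕ) (s : ℂ) :
    Complex.exp (-(((m : ℂ) + 1) * s)) • bCoeff v (fun i s => Complex.exp (i * s) • ψ i s) m s =
      blockRec K (fun p => pertCoeff (UMat n v) p s) (fun i => ψ i s) m := by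
  rw [bCoeff, sum_Icc_one_shift m fun p k => ∑ q ∈ Finset.HasAntidiagonal.antidiagonal k,
    (-1 : ℂ) ^ p • ⁅UMat n v ^ p, deltaDiff K (Complex.exp (q.1 * s) • ψ q.1 s) *
      deltaDiff K (Complex.exp (q.2 * s) • ψ q.2 s)⁆, blockRec, Finset.smul_sum]
  refine Finset.sum_congr rfl fun x hx => ?_
  rw [Finset.smul_sum]
  refine Finset.sum_congr rfl fun q hq => ?_
  rw [Finset.HasAntidiagonal.mem_antidiagonal] at hx hq
  rw [deltaDiff_smul, deltaDiff_smul, smul_mul_smul_comm, pertCoeff,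
    ← one_smul ℂ (UMat n v ^ (x.1 + 1)), lie_smul_smul, smul_smul, smul_smul, one_smul,
    ← one_smul ℂ (deltaDiff K (ψ q.1 s) * deltaDiff K (ψ q.2 s)), lie_smul_smul, one_smul]
  congr 1
  rw [one_mul, mul_one, mul_right_comm]
  exact exp_scalar_eq (by omega) s

theorem exp_smul_aCoeff (v : Fin K → ℂ) (X : Mat n) (ψ : ℕ → ℂ → Mat n) (m : ℕ) (s : ℂ) :
    Complex.exp (-(((m : ℂ) + 1) * s)) • aCoeff v X (fun i s => Complex.exp (i * s) • ψ i s) m s =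
      adPow s (delta K X)
        (fullRec K (fun p => pertCoeff (UMat n v) p s) (fun i => ψ i s) m) := by
  rw [aCoeff, sum_Icc_one_shift m fun p k => ∑ q ∈ Finset.HasAntidiagonal.antidiagonal k,
    (-1 : ℂ) ^ p • adPow s (delta K X) ⁅UMat n v ^ p * deltaDiff K (Complex.exp (q.1 * s) • ψ q.1 s)
      + deltaDiff K (Complex.exp (q.1 * s) • ψ q.1 s) * UMat n v ^ p,
      Complex.exp (q.2 * s) • ψ q.2 s⁆, sum_antidiagonal_filter_shift m fun i j =>
    adPow s (delta K X) ⁅Complex.exp (i * s) • ψ i s, delta K (Complex.exp (j * s) • ψ j s)⁆,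
    fullRec, smul_add, adPow_add_right, Finset.smul_sum, Finset.smul_sum, adPow_sum, adPow_sum]
  congr 1
  · refine Finset.sum_congr rfl fun q hq => ?_
    rw [Finset.HasAntidiagonal.mem_antidiagonal] at hq
    rw [delta_smul, lie_smul_smul, adPow_smul_right, smul_smul, ← Complex.exp_add,
      ← Complex.exp_add, ← hq]
    have : -((((q.1 + q.2 : ℕ) : ℂ) + 1) * s) + (q.1 * s + ((q.2 + 1 : ℕ) : ℂ) * s) = 0 := by
      push_cast; ring
    rw [this, Complex.exp_zero, one_smul]
  · refine Finset.sum_congr rfl fun x hx => ?_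
    rw [Finset.smul_sum, adPow_sum]
    refine Finset.sum_congr rfl fun q hq => ?_
    rw [Finset.HasAntidiagonal.mem_antidiagonal] at hx hq
    rw [deltaDiff_smul, mul_smul_comm, smul_mul_assoc, ← smul_add, lie_smul_smul, pertCoeff,
      smul_mul_assoc, mul_smul_comm, ← smul_add, ← one_smul ℂ (ψ q.2 s), lie_smul_smul, one_smul,
      adPow_smul_right, adPow_smul_right, smul_smul, smul_smul]
    congr 1
    rw [mul_one, mul_right_comm]
    exact exp_scalar_eq (by omega) s

end

/-! ### Existence and uniqueness of the formal coefficients. -/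

section



variable {n : ℕ}

/-! ### Existence of the coefficients -/

/-- Course-of-values recursion with an invariant. -/
theorem exists_seq_of_exists {α : Type*} (a : α) (Inv : ℕ → α → Prop) (Q : ℕ → (ℕ → α) → α → Prop)
    (h0 : Inv 0 a)
    (hQ : ∀ m f, f 0 = a → (∀ i ≤ m, Inv i (f i)) → ∃ y, Inv (m + 1) y ∧ Q m f y)
    (hc : ∀ m f f' y, (∀ i ≤ m, f i = f' i) → Q m f y → Q m f' y) :
    ∃ f : ℕ → α, f 0 = a ∧ ∀ m, Inv m (f m) ∧ Q m f (f (m + 1)) := by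
  classical
  obtain ⟨f, hf0, hf⟩ := exists_seq_of_step a
    (fun m f => if h : ∃ y, Inv (m + 1) y ∧ Q m f y then h.choose else a)
    (fun m f f' h => by
      -- Equality of predicates is needed, not only solvability of both, so that the chosen witness
      -- is the same.
      have : Q m f = Q m f' := funext fun y =>
        propext ⟨hc m f f' y h, hc m f' f y fun i hi => (h i hi).symm⟩
      simp only [this])
  have step : ∀ m, (∀ i ≤ m, Inv i (f i)) → Inv (m + 1) (f (m + 1)) ∧ Q m f (f (m + 1)) := by
    intro m hm
    have h := hQ m f hf0 hm
    rw [hf m, dif_pos h]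
    exact h.choose_spec
  have hinv : ∀ m, ∀ i ≤ m, Inv i (f i) := by
    intro m
    induction m with
    | zero => intro i hi; rw [Nat.le_zero.1 hi, hf0]; exact h0
    | succ m ih =>
      intro i hi
      rcases Nat.lt_or_ge m i with h | h
      · rw [show i = m + 1 by omega]; exact (step m ih).1
      · exact ih i h
  exact ⟨f, hf0, fun m => ⟨hinv m m le_rfl, (step m (hinv m)).2⟩⟩

variable {K : ℕ}

/-- Conjugation of head matrices by `z ^ (-A)` raises the exponents by at most the spread. -/
theorem SpecDec.adPow_neg_mem {S : Set ℂ} {A : Mat n} (D : SpecDec S (headProj n K) A) {σ : ℝ}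
    (hσ : ∀ l ∈ D.Λ, ∀ l' ∈ D.Λ, l.re - l'.re ≤ σ) {ρ : ℝ} {f : ℂ → Mat n}
    (hf : f ∈ mEP n ρ) (hh : ∀ w, IsHead K (f w)) :
    (fun w => adPow (-w) A (f w)) ∈ mEP n (σ + ρ) := by
  have key : (fun w => adPow (-w) A (f w)) = fun w => ∑ l ∈ D.Λ, ∑ l' ∈ D.Λ,
      (NormedSpace.exp (-(w • A)) * D.P l) * f w * (NormedSpace.exp (w • A) * D.P l') := by
    funext w
    rw [adPow, neg_smul, neg_neg]
    conv_lhs => rw [← hh w, ← D.sum]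
    simp only [Finset.sum_mul, Finset.mul_sum]
    rw [Finset.sum_comm]
    refine Finset.sum_congr rfl fun l hl => Finset.sum_congr rfl fun l' hl' => ?_
    rw [← (D.commute_exp hl' w).eq]
    simp only [Matrix.mul_assoc]
  rw [key]
  refine sum_mem_mEP fun l hl => sum_mem_mEP fun l' hl' => ?_
  refine mEP_mono ?_ (mul_mem_mEP (mul_mem_mEP (D.exp_neg_mul_mem hl) hf) (D.exp_mul_mem hl'))
  linarith [hσ l' hl' l hl]

theorem blockRec_mem {η : ℝ} {g θ : ℕ → ℂ → Mat n} {m : ℕ}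
    (hg : ∀ p : ℕ, g p ∈ mEP n (-(((p : ℝ) + 1) * η))) (hθ : ∀ i ≤ m, θ i ∈ mEP n (-((i : ℝ) * η))) :
    (fun s => blockRec K (fun p => g p s) (fun i => θ i s) m) ∈
      mEP n (-((((m + 1 : ℕ) : ℝ)) * η)) := by
  refine sum_mem_mEP fun x hx => sum_mem_mEP fun q hq => ?_
  rw [Finset.HasAntidiagonal.mem_antidiagonal] at hx hq
  refine mEP_mono (le_of_eq ?_) (lie_mem_mEP (hg x.1) (mul_mem_mEP
    (deltaDiff_mem_mEP K (hθ q.1 (by omega))) (deltaDiff_mem_mEP K (hθ q.2 (by omega)))))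
  rw [← hx, ← hq]
  push_cast
  ring

theorem fullRec_mem {η : ℝ} {g θ : ℕ → ℂ → Mat n} {m : ℕ}
    (hg : ∀ p : ℕ, g p ∈ mEP n (-(((p : ℝ) + 1) * η)))
    (hθ : ∀ i ≤ m + 1, θ i ∈ mEP n (-((i : ℝ) * η))) :
    (fun s => fullRec K (fun p => g p s) (fun i => θ i s) m) ∈
      mEP n (-((((m + 1 : ℕ) : ℝ)) * η)) := by
  refine Submodule.add_mem _ (sum_mem_mEP fun q hq => ?_)
    (sum_mem_mEP fun x hx => sum_mem_mEP fun q hq => ?_)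
  · rw [Finset.HasAntidiagonal.mem_antidiagonal] at hq
    refine mEP_mono (le_of_eq ?_) (lie_mem_mEP (hθ q.1 (by omega))
      (delta_mem_mEP K (hθ (q.2 + 1) (by omega))))
    rw [← hq]
    push_cast
    ring
  · rw [Finset.HasAntidiagonal.mem_antidiagonal] at hx hq
    have h1 := deltaDiff_mem_mEP K (hθ q.1 (by omega))
    have h2 := mul_mem_mEP h1 (hg x.1)
    rw [add_comm] at h2
    refine mEP_mono (le_of_eq ?_) (lie_mem_mEP (Submodule.add_mem _ (mul_mem_mEP (hg x.1) h1) h2)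
      (hθ q.2 (by omega)))
    rw [← hx, ← hq]
    push_cast
    ring

/-- The coefficients in the gauge `Θ`: `θ` is the full series and `F` the primitives for its
diagonal blocks. -/
structure GaugeCoeff (K : ℕ) (U X : Mat n) (θ F : ℕ → ℂ → Mat n) : Prop where
  zero : ∀ s, θ 0 s = X
  prim_block : ∀ m, IsMatPrimitive (fun s => blockRec K (fun p => pertCoeff U p s)
    (fun i => adPow (-s) (delta K X) (θ i s)) m) (F m)
  prim : ∀ m, IsMatPrimitive (fun s => fullRec K (fun p => adPow s (delta K X) (pertCoeff U p s))
    (fun i => θ i s) m) (θ (m + 1))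
  delta_succ : ∀ m s, delta K (θ (m + 1) s) = adPow s (delta K X) (F m s)
  head : ∀ m s, IsHead K (F m s)
  lim_block : ∀ m s, Tendsto (fun x : ℝ => F m (s + x)) atTop (𝓝 0)
  lim : ∀ m s, Tendsto (fun x : ℝ => θ (m + 1) (s + x)) atTop (𝓝 0)

theorem eq_zero_of_deriv_of_lim {f : ℂ → Mat n} (hf : ∀ s, HasDerivAt f 0 s)
    (hlim : Tendsto (fun x : ℝ => f (0 + x)) atTop (𝓝 0)) (s : ℂ) : f s = 0 := by
  have h : ∀ x y, f x = f y := is_const_of_deriv_eq_zero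
    (fun s => (hf s).differentiableAt) fun s => (hf s).deriv
  have h2 : (fun x : ℝ => f (0 + x)) = fun _ => f s := funext fun x => h _ _
  rw [h2] at hlim
  exact tendsto_nhds_unique tendsto_const_nhds hlim

theorem hasDerivAt_delta (K : ℕ) {f : ℂ → Mat n} {f' : Mat n} {s : ℂ} (hf : HasDerivAt f f' s) :
    HasDerivAt (fun s => delta K (f s)) (delta K f') s :=
  (deltaL K).hasFDerivAt.comp_hasDerivAt s hf

/-- The recursion asks for two things at once: the blocks of θ_{m+1} are prescribed by one primitive
and the whole of θ_{m+1} by another. Both are exponential polynomials with exponents of negative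
real part and their blocks have the same derivative, so they agree at infinity and hence everywhere.
The gap condition enters through the negative exponents: it excludes constants of integration. -/
theorem exists_gaugeCoeff (h : K ≤ n) {U X : Mat n} (hU : IsHead K U)
    (hgap : BlockGap h (delta K X)) : ∃ θ F, GaugeCoeff K U X θ F := by
  have hA := delta_mem K X
  set A := delta K X with hAdef
  obtain ⟨D⟩ := exists_specDec_head h hA
  obtain ⟨σ, hσ0, hσ1, hσ⟩ := D.exists_spread hgap
  set η := 1 - σ with hη
  have hη0 : 0 < η := sub_pos.2 hσ1
  have hg : ∀ p : ℕ, (fun s => adPow s A (pertCoeff U p s)) ∈ mEP n (-(((p : ℝ) + 1) * η)) := by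
    intro p
    -- Conjugation costs σ once, while the target allows a loss of (p + 1)σ.
    refine mEP_mono ?_ (D.adPow_mem hσ (pertCoeff_mem (U := U) p) (isHead_pertCoeff hU p))
    have : (0 : ℝ) ≤ p := p.cast_nonneg
    nlinarith
  have hgh : ∀ s p, IsHead K (adPow s A (pertCoeff U p s)) := fun s p =>
    (isHead_pertCoeff hU p s).adPow hA s
  -- The requirement on y is stated through `Function.update`, so that it depends only on the terms
  -- of f up to index m; for the final sequence the update is trivial.
  refine Exists.elim (exists_seq_of_exists (fun _ : ℂ => X)
    (fun m y => y ∈ mEP n (-((m : ℝ) * η)))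
    (fun m f y => (∃ F, IsMatPrimitive (fun s => blockRec K (fun p => pertCoeff U p s)
        (fun i => adPow (-s) A (f i s)) m) F ∧ (∀ s, IsHead K (F s)) ∧
        F ∈ mEP n (-(((m + 1 : ℕ) : ℝ) * η)) ∧ ∀ s, delta K (y s) = adPow s A (F s)) ∧
      IsMatPrimitive (fun s => fullRec K (fun p => adPow s A (pertCoeff U p s))
        (fun i => Function.update f (m + 1) y i s) m) y)
    (const_mem_mEP (by simp) X) ?_ ?_) ?_
  · intro m f hf0 hf
    have hB : (fun s => blockRec K (fun p => adPow s A (pertCoeff U p s)) (fun i => f i s) m) ∈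
        mEP n (-(((m + 1 : ℕ) : ℝ) * η)) := blockRec_mem hg hf
    have hBneg : ∀ s, adPow (-s) A
        (blockRec K (fun p => adPow s A (pertCoeff U p s)) (fun i => f i s) m) =
        blockRec K (fun p => pertCoeff U p s) (fun i => adPow (-s) A (f i s)) m := fun s => by
      rw [blockRec_adPow hA]; simp only [adPow_neg_adPow]
    -- The same decay without the outer conjugation. It is needed separately because the primitive F
    -- itself, and not only its conjugate, must tend to 0.
    have hB' : (fun s => blockRec K (fun p => pertCoeff U p s)
        (fun i => adPow (-s) A (f i s)) m) ∈ mEP n (-(((m + 1 : ℕ) : ℝ) * η)) := by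
      refine sum_mem_mEP fun x hx => sum_mem_mEP fun q hq => ?_
      rw [Finset.HasAntidiagonal.mem_antidiagonal] at hx hq
      have e : (fun s => ⁅pertCoeff U x.1 s, deltaDiff K (adPow (-s) A (f q.1 s)) *
          deltaDiff K (adPow (-s) A (f q.2 s))⁆) = fun s => ⁅pertCoeff U x.1 s,
            adPow (-s) A (headProj n K * (deltaDiff K (f q.1 s) * deltaDiff K (f q.2 s)))⁆ := by
        funext s
        rw [deltaDiff_adPow hA, deltaDiff_adPow hA, ← adPow_mul,
          lie_head_eq (isHead_pertCoeff hU _ s) (adPow_mem_deltaAlg hA _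
            (deltaDiff_mul_deltaDiff_mem K _ _)), adPow_mul _ _ (headProj n K),
          adPow_headProj hA]
      rw [e]
      have hN := mul_mem_mEP (const_mem_mEP le_rfl (headProj n K)) (mul_mem_mEP
        (deltaDiff_mem_mEP K (hf q.1 (by omega))) (deltaDiff_mem_mEP K (hf q.2 (by omega))))
      refine mEP_mono ?_ (lie_mem_mEP (pertCoeff_mem (U := U) x.1) (D.adPow_neg_mem hσ hN
        fun s => isHead_headProj_mul (deltaDiff_mul_deltaDiff_mem K _ _)))
      rw [← hx, ← hq]
      have : (0 : ℝ) ≤ x.1 := x.1.cast_nonneg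
      push_cast
      nlinarith
    obtain ⟨F, hF⟩ := exists_isMatPrimitive hB'
    have hFmem := hF.mem hB'
    have hFh : ∀ s, IsHead K (F s) := by
      have h1 := (hF.mul_left (headProj n K)).mul_right (headProj n K)
      have h2 : (fun s => headProj n K * blockRec K (fun p => pertCoeff U p s)
          (fun i => adPow (-s) A (f i s)) m * headProj n K) = fun s =>
          blockRec K (fun p => pertCoeff U p s) (fun i => adPow (-s) A (f i s)) m := by
        funext s
        exact isHead_blockRec (fun i => isHead_pertCoeff hU i s) _ m
      rw [h2] at h1
      exact fun s => congrFun (h1.unique hF) s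
    have hd := D.adPow_primitive_mem hB (F := F) (by simpa only [hBneg] using hF) hFh
    set d : ℂ → Mat n := fun s => adPow s A (F s) with hddef
    have hdδ : ∀ s, delta K (d s) = d s := fun s => adPow_mem_deltaAlg hA s (hFh s).mem
    have hf' : ∀ i ≤ m + 1, Function.update f (m + 1) d i ∈ mEP n (-((i : ℝ) * η)) := by
      intro i hi
      rcases eq_or_ne i (m + 1) with rfl | hne
      · rw [Function.update_self]; exact hd
      · rw [Function.update_of_ne hne]; exact hf i (by omega)
    have hfull := fullRec_mem (K := K) hg hf'
    obtain ⟨y, hy⟩ := exists_isMatPrimitive hfull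
    have hymem := hy.mem hfull
    have hneg : -(((m + 1 : ℕ) : ℝ) * η) < 0 := neg_neg_of_pos (mul_pos (by positivity) hη0)
    -- The full primitive y was built with the block d inserted at index m + 1. Its block has the
    -- derivative of d by `delta_fullRec`, and both decay along a ray.
    have hyd : ∀ s, delta K (y s) = d s := by
      intro s
      refine sub_eq_zero.1 (eq_zero_of_deriv_of_lim (f := fun s => delta K (y s) - d s)
        (fun s => ?_) (tendsto_of_mem_mEP hneg
          (Submodule.sub_mem _ (delta_mem_mEP K hymem) hd) 0) s)
      have h1 := hasDerivAt_delta K (hy.hasDerivAt s)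
      have h2 := hasDerivAt_adPow (X := A) (hF.hasDerivAt s)
      refine (h1.sub h2).congr_deriv (sub_eq_zero.2 ?_)
      rw [delta_fullRec (hgh s), Function.update_self,
        Function.update_of_ne (Nat.succ_ne_zero m).symm, hf0, hdδ, ← hBneg, adPow_adPow_neg,
        blockRec_congr (θ' := fun i => f i s) fun i hi => by
          rw [Function.update_of_ne (by omega : i ≠ m + 1)]]
    refine ⟨y, hymem, ⟨F, hF, hFh, hFmem, hyd⟩, ?_⟩
    -- Only the block of the entry at index m + 1 enters the recursion, so d may now be replaced by
    -- y.
    have e : (fun s => fullRec K (fun p => adPow s A (pertCoeff U p s))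
        (fun i => Function.update f (m + 1) y i s) m) = fun s =>
        fullRec K (fun p => adPow s A (pertCoeff U p s))
          (fun i => Function.update f (m + 1) d i s) m := by
      funext s
      refine fullRec_congr (fun i hi => ?_) ?_
      · rw [Function.update_of_ne (by omega : i ≠ m + 1),
          Function.update_of_ne (by omega : i ≠ m + 1)]
      · rw [Function.update_self, Function.update_self, hyd, hdδ]
    rw [e]
    exact hy
  · rintro m f f' y hff' ⟨⟨F, hF, hF'⟩, hy⟩
    refine ⟨⟨F, ?_, hF'⟩, ?_⟩
    · have e : (fun s => blockRec K (fun p => pertCoeff U p s)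
          (fun i => adPow (-s) A (f' i s)) m) = fun s => blockRec K (fun p => pertCoeff U p s)
          (fun i => adPow (-s) A (f i s)) m := by
        funext s
        exact blockRec_congr fun i hi => by rw [hff' i hi]
      rw [e]
      exact hF
    · have e : (fun s => fullRec K (fun p => adPow s A (pertCoeff U p s))
          (fun i => Function.update f' (m + 1) y i s) m) = fun s =>
          fullRec K (fun p => adPow s A (pertCoeff U p s))
            (fun i => Function.update f (m + 1) y i s) m := by
        funext s
        refine fullRec_congr (fun i hi => ?_) ?_
        · rw [Function.update_of_ne (by omega : i ≠ m + 1),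
            Function.update_of_ne (by omega : i ≠ m + 1), hff' i hi]
        · rw [Function.update_self, Function.update_self]
      rw [e]
      exact hy
  · rintro θ ⟨h0, hθ⟩
    choose F hF using fun m => (hθ m).2.1
    have hneg : ∀ m : ℕ, -(((m + 1 : ℕ) : ℝ) * η) < 0 := fun m =>
      neg_neg_of_pos (mul_pos (by positivity) hη0)
    refine ⟨θ, F, fun s => by rw [h0], fun m => (hF m).1, fun m => ?_, fun m => (hF m).2.2.2,
      fun m => (hF m).2.1, fun m s => tendsto_of_mem_mEP (hneg m) (hF m).2.2.1 s,
      fun m s => tendsto_of_mem_mEP (hneg m) (hθ (m + 1)).1 s⟩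
    have := (hθ m).2.2
    rwa [Function.update_eq_self] at this

/-- The coefficients of the formal series, from those in the gauge `Θ`. -/
theorem GaugeCoeff.isSeriesCoeff {v : Fin K → ℂ} {X : Mat n} {θ F : ℕ → ℂ → Mat n}
    (h : GaugeCoeff K (UMat n v) X θ F) :
    IsSeriesCoeff v X (fun i s => Complex.exp (i * s) • adPow (-s) (delta K X) (θ i s)) where
  zero s := by simp [h.zero]
  delta_succ m a b := by
    refine ⟨fun s => F m s a b, ?_, fun s => ?_⟩
    · have e : (fun s => Complex.exp (-(((m : ℂ) + 1) * s)) * bCoeff v (fun i s =>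
          Complex.exp (i * s) • adPow (-s) (delta K X) (θ i s)) m s a b) = fun s =>
          blockRec K (fun p => pertCoeff (UMat n v) p s)
            (fun i => adPow (-s) (delta K X) (θ i s)) m a b := by
        funext s
        exact congrFun (congrFun (exp_smul_bCoeff v
          (fun i s => adPow (-s) (delta K X) (θ i s)) m s) a) b
      rw [e]
      exact h.prim_block m a b
    · simp only [delta_smul, delta_adPow (delta_mem K X), h.delta_succ, adPow_neg_adPow]
      rw [Matrix.smul_apply]
      push_cast
      rfl
  succ m a b := by
    refine ⟨fun s => θ (m + 1) s a b, ?_, fun s => ?_⟩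
    · have e : (fun s => Complex.exp (-(((m : ℂ) + 1) * s)) * aCoeff v X (fun i s =>
          Complex.exp (i * s) • adPow (-s) (delta K X) (θ i s)) m s a b) = fun s =>
          fullRec K (fun p => adPow s (delta K X) (pertCoeff (UMat n v) p s))
            (fun i => θ i s) m a b := by
        funext s
        have h1 := exp_smul_aCoeff v X (fun i s => adPow (-s) (delta K X) (θ i s)) m s
        rw [fullRec_adPow (delta_mem K X)] at h1
        simp only [adPow_adPow_neg] at h1
        exact congrFun (congrFun h1 a) b
      rw [e]
      exact h.prim m a b
    · simp only [adPow_smul_right, adPow_adPow_neg]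
      rw [Matrix.smul_apply]
      push_cast
      rfl

/-! ### Uniqueness of the coefficients -/

theorem bCoeff_congr (v : Fin K → ℂ) {φ φ' : ℕ → ℂ → Mat n} {m : ℕ} (h : ∀ i ≤ m, φ i = φ' i)
    (s : ℂ) : bCoeff v φ m s = bCoeff v φ' m s := by
  refine Finset.sum_congr rfl fun p hp => Finset.sum_congr rfl fun q hq => ?_
  rw [Finset.HasAntidiagonal.mem_antidiagonal] at hq
  rw [Finset.mem_Icc] at hp
  rw [h q.1 (by omega), h q.2 (by omega)]

theorem aCoeff_congr (v : Fin K → ℂ) (X : Mat n) {φ φ' : ℕ → ℂ → Mat n} {m : ℕ}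
    (h : ∀ i ≤ m, φ i = φ' i) {s : ℂ} (h' : delta K (φ (m + 1) s) = delta K (φ' (m + 1) s)) :
    aCoeff v X φ m s = aCoeff v X φ' m s := by
  refine congrArg₂ (· + ·) (Finset.sum_congr rfl fun q hq => ?_)
    (Finset.sum_congr rfl fun p hp => Finset.sum_congr rfl fun q hq => ?_)
  · rw [Finset.mem_filter, Finset.HasAntidiagonal.mem_antidiagonal] at hq
    rw [h q.1 (by omega)]
    rcases Nat.lt_or_ge m q.2 with hlt | hge
    · rw [show q.2 = m + 1 by omega, h']
    · rw [h q.2 hge]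
  · rw [Finset.HasAntidiagonal.mem_antidiagonal] at hq
    rw [Finset.mem_Icc] at hp
    rw [h q.1 (by omega), h q.2 (by omega)]

/-- Induction with uniqueness of formal primitives. The block of the new coefficient has to be
compared first, since it occurs in the equation for the full coefficient. -/
theorem IsSeriesCoeff.unique {v : Fin K → ℂ} {X : Mat n} {φ φ' : ℕ → ℂ → Mat n}
    (h : IsSeriesCoeff v X φ) (h' : IsSeriesCoeff v X φ') : φ = φ' := by
  have key : ∀ m, ∀ i ≤ m, φ i = φ' i := by
    intro m
    induction m with
    | zero =>
      intro i hi
      rw [Nat.le_zero.1 hi]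
      funext s
      rw [h.zero, h'.zero]
    | succ m ih =>
      intro i hi
      rcases Nat.lt_or_ge m i with hlt | hge
      swap
      · exact ih i hge
      rw [show i = m + 1 by omega]
      have hd : ∀ s, delta K (φ (m + 1) s) = delta K (φ' (m + 1) s) := by
        intro s
        ext a b
        obtain ⟨F, hF, e⟩ := h.delta_succ m a b
        obtain ⟨F', hF', e'⟩ := h'.delta_succ m a b
        simp only [bCoeff_congr v ih] at hF
        rw [e, e', hF.unique hF']
      funext s
      have ha : adPow s (delta K X) (φ (m + 1) s) = adPow s (delta K X) (φ' (m + 1) s) := by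
        ext a b
        obtain ⟨F, hF, e⟩ := h.succ m a b
        obtain ⟨F', hF', e'⟩ := h'.succ m a b
        simp only [aCoeff_congr v X ih (hd _)] at hF
        rw [e, e', hF.unique hF']
      rw [← adPow_neg_adPow s (delta K X) (φ (m + 1) s), ha, adPow_neg_adPow]
  funext m
  exact key m m le_rfl

end

/-! ### Majorants, norm bounds for the coefficients, and Cauchy products. -/

section



variable {n : ℕ}

/-! ### Majorants -/

/-- The convolution `γ * x * x`. -/
def tripleConv (γ x : ℕ → ℝ) (m : ℕ) : ℝ :=
  ∑ p ∈ Finset.HasAntidiagonal.antidiagonal m,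
    γ p.1 * ∑ q ∈ Finset.HasAntidiagonal.antidiagonal p.2, x q.1 * x q.2

theorem tripleConv_congr {γ x x' : ℕ → ℝ} {m : ℕ} (h : ∀ i ≤ m, x i = x' i) :
    tripleConv γ x m = tripleConv γ x' m := by
  refine Finset.sum_congr rfl fun p hp => ?_
  congr 1
  refine Finset.sum_congr rfl fun q hq => ?_
  rw [Finset.HasAntidiagonal.mem_antidiagonal] at hp hq
  rw [h q.1 (by omega), h q.2 (by omega)]

theorem tripleConv_nonneg {γ x : ℕ → ℝ} (hγ : ∀ i, 0 ≤ γ i) {m : ℕ} (hx : ∀ i ≤ m, 0 ≤ x i) :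
    0 ≤ tripleConv γ x m := by
  refine Finset.sum_nonneg fun p hp => mul_nonneg (hγ _) (Finset.sum_nonneg fun q hq => ?_)
  rw [Finset.HasAntidiagonal.mem_antidiagonal] at hp hq
  exact mul_nonneg (hx _ (by omega)) (hx _ (by omega))

theorem sum_range_tripleConv_le {γ x : ℕ → ℝ} (hγ : ∀ i, 0 ≤ γ i) (hx : ∀ i, 0 ≤ x i) (N : ℕ) :
    ∑ m ∈ Finset.range N, tripleConv γ x m ≤
      (∑ i ∈ Finset.range N, γ i) * (∑ i ∈ Finset.range N, x i) ^ 2 := by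
  have h1 := sum_range_antidiagonal_le (a := γ)
    (b := fun k => ∑ q ∈ Finset.HasAntidiagonal.antidiagonal k, x q.1 * x q.2) hγ
    (fun k => Finset.sum_nonneg fun q _ => mul_nonneg (hx _) (hx _)) N
  refine h1.trans ?_
  rw [pow_two]
  exact mul_le_mul_of_nonneg_left (sum_range_antidiagonal_le hx hx N)
    (Finset.sum_nonneg fun i _ => hγ i)

/-- If the partial sum up to N is at most x₀ + 1, the recursion bounds the next one by x₀ plus ε
times a cubic expression in x₀ + 1, which is at most x₀ + 1 by the smallness assumption. So
nonnegative partial sums stay bounded without any explicit formula for x. -/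
theorem exists_majorant {x₀ a b ε Γ : ℝ} {γ : ℕ → ℝ} (hx₀ : 0 ≤ x₀) (ha : 0 ≤ a) (hb : 0 ≤ b)
    (hε : 0 ≤ ε) (hγ : ∀ i, 0 ≤ γ i) (hΓ : ∀ N, ∑ i ∈ Finset.range N, γ i ≤ Γ)
    (hsmall : ε * (2 * a * Γ * (x₀ + 1) ^ 3 + b * Γ * (x₀ + 1) ^ 2) ≤ 1) :
    ∃ x : ℕ → ℝ, x 0 = x₀ ∧
      (∀ m, x (m + 1) = ε * (∑ q ∈ Finset.HasAntidiagonal.antidiagonal m,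
        2 * x q.1 * (a * tripleConv γ x q.2) + b * tripleConv γ x m)) ∧
      (∀ m, 0 ≤ x m) ∧ (∀ N, ∑ m ∈ Finset.range N, x m ≤ x₀ + 1) ∧ Summable x ∧
      Summable (tripleConv γ x) := by
  obtain ⟨x, h0, hx⟩ := exists_seq_of_step x₀
    (fun m x => ε * (∑ q ∈ Finset.HasAntidiagonal.antidiagonal m,
        2 * x q.1 * (a * tripleConv γ x q.2) + b * tripleConv γ x m))
    (fun m f f' h => by
      rw [tripleConv_congr h]
      congr 2
      refine Finset.sum_congr rfl fun q hq => ?_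
      rw [Finset.HasAntidiagonal.mem_antidiagonal] at hq
      rw [h q.1 (by omega), tripleConv_congr fun i hi => h i (by omega)])
  have hpos' : ∀ m, ∀ i ≤ m, 0 ≤ x i := by
    intro m
    induction m with
    | zero => intro i hi; rw [Nat.le_zero.1 hi, h0]; exact hx₀
    | succ m ih =>
      intro i hi
      rcases Nat.lt_or_ge m i with h | h
      · rw [show i = m + 1 by omega, hx]
        refine mul_nonneg hε (add_nonneg (Finset.sum_nonneg fun q hq => ?_)
          (mul_nonneg hb (tripleConv_nonneg hγ ih)))
        rw [Finset.HasAntidiagonal.mem_antidiagonal] at hq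
        exact mul_nonneg (mul_nonneg zero_le_two (ih _ (by omega)))
          (mul_nonneg ha (tripleConv_nonneg hγ fun i hi => ih i (by omega)))
      · exact ih i h
  have hpos : ∀ m, 0 ≤ x m := fun m => hpos' m m le_rfl
  have hΓ0 : 0 ≤ Γ := by simpa using hΓ 0
  have htpos : ∀ m, 0 ≤ tripleConv γ x m := fun m => tripleConv_nonneg hγ fun i _ => hpos i
  have htr : ∀ N, ∑ m ∈ Finset.range N, x m ≤ x₀ + 1 →
      ∑ m ∈ Finset.range N, tripleConv γ x m ≤ Γ * (x₀ + 1) ^ 2 := fun N hN => by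
    refine (sum_range_tripleConv_le hγ hpos N).trans ?_
    have := Finset.sum_nonneg fun i (_ : i ∈ Finset.range N) => hpos i
    have := hΓ N
    gcongr
  have hsum : ∀ N, ∑ m ∈ Finset.range N, x m ≤ x₀ + 1 := by
    intro N
    induction N with
    | zero => simp; linarith
    | succ N ih =>
      rw [Finset.sum_range_succ', h0]
      simp only [hx]
      rw [← Finset.mul_sum, Finset.sum_add_distrib, ← Finset.mul_sum]
      have e1 := sum_range_antidiagonal_le (a := fun i => 2 * x i)
        (b := fun i => a * tripleConv γ x i) (fun i => mul_nonneg zero_le_two (hpos i))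
        (fun i => mul_nonneg ha (htpos i)) N
      rw [← Finset.mul_sum, ← Finset.mul_sum] at e1
      have e2 := htr N ih
      have e3 : 2 * (∑ i ∈ Finset.range N, x i) * (a * ∑ i ∈ Finset.range N, tripleConv γ x i) ≤
          2 * (x₀ + 1) * (a * (Γ * (x₀ + 1) ^ 2)) := by
        have := Finset.sum_nonneg fun i (_ : i ∈ Finset.range N) => htpos i
        gcongr
      have e4 : b * ∑ i ∈ Finset.range N, tripleConv γ x i ≤ b * (Γ * (x₀ + 1) ^ 2) := by gcongr
      have e5 := mul_le_mul_of_nonneg_left (add_le_add (e1.trans e3) e4) hε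
      linarith
  refine ⟨x, h0, hx, hpos, hsum, summable_of_sum_range_le hpos hsum,
    summable_of_sum_range_le htpos fun N => htr N (hsum N)⟩

variable {K : ℕ} {T C σ : ℝ}

theorem norm_pertCoeff_le {U : Mat n} {u R : ℝ} (hu : ‖U‖ ≤ u) (hR : u * Real.exp (-R) ≤ 1 / 2)
    {s : ℂ} (hs : R ≤ s.re) (p : ℕ) :
    ‖pertCoeff U p s‖ ≤ u * (1 / 2) ^ p * Real.exp (-s.re) := by
  have hu0 : 0 ≤ u := (norm_nonneg _).trans hu
  have h1 : ‖U ^ (p + 1)‖ ≤ u ^ (p + 1) :=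
    (norm_pow_le' U (Nat.succ_pos p)).trans (pow_le_pow_left₀ (norm_nonneg _) hu _)
  have h2 : ‖(-1 : ℂ) ^ (p + 1) * Complex.exp (-(((p : ℂ) + 1) * s))‖ =
      Real.exp (-s.re) ^ (p + 1) := by
    rw [norm_mul, norm_pow, norm_neg, norm_one, one_pow, one_mul, Complex.norm_exp,
      ← Real.exp_nat_mul]
    congr 1
    simp
  rw [pertCoeff, norm_smul, h2]
  calc _ ≤ Real.exp (-s.re) ^ (p + 1) * u ^ (p + 1) := by gcongr
    _ = (u * Real.exp (-s.re)) ^ p * (u * Real.exp (-s.re)) := by ring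
    _ ≤ (1 / 2) ^ p * (u * Real.exp (-s.re)) := by
        have : u * Real.exp (-s.re) ≤ 1 / 2 :=
          (mul_le_mul_of_nonneg_left (Real.exp_le_exp.2 (neg_le_neg hs)) hu0).trans hR
        gcongr
    _ = _ := by ring

/-- Bound for the primitives of the diagonal blocks in terms of bounds on the coefficients. -/
theorem GaugeCoeff.norm_block_le {U X : Mat n} {θ F : ℕ → ℂ → Mat n} (h : GaugeCoeff K U X θ F)
    (hc : ConjBound K (delta K X) T C σ) (hU : IsHead K U) {R : ℝ} {γ x : ℕ → ℝ}
    (hγ : ∀ p (s : ℂ), R ≤ s.re → ‖pertCoeff U p s‖ ≤ γ p * Real.exp (-s.re)) {m : ℕ}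
    (hx : ∀ i ≤ m, ∀ s : ℂ, R ≤ s.re → |s.im| ≤ T → ‖θ i s‖ ≤ x i) {s₀ : ℂ} {τ : ℝ} (hτ : 0 ≤ τ)
    (h0 : 0 ≤ s₀.re) (hr : R ≤ s₀.re + τ) (hT : |s₀.im| ≤ T) :
    ‖adPow s₀ (delta K X) (F m (s₀ + τ))‖ ≤
      2 * C ^ 2 / (1 - σ) * tripleConv γ x m * Real.exp (-(1 - σ) * (s₀.re + τ)) := by
  have hη : 0 < 1 - σ := sub_pos.2 hc.σ_lt
  have hA := hc.mem
  set A := delta K X with hAdef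
  have key := norm_le_of_deriv_le (s := s₀ + τ) (f := fun w => adPow s₀ A (F m w))
    (f' := fun w => adPow s₀ A (blockRec K (fun p => pertCoeff U p w)
      (fun i => adPow (-w) A (θ i w)) m)) (B := 2 * C ^ 2 * tripleConv γ x m) hη
    (fun t _ => (adPowL s₀ A).hasFDerivAt.comp_hasDerivAt _ ((h.prim_block m).hasDerivAt _))
    (fun t ht => by
      rw [blockRec, adPow_sum, tripleConv, Finset.mul_sum, Finset.sum_mul]
      refine norm_sum_le_of_le _ fun p hp => ?_
      rw [adPow_sum, mul_comm (γ p.1), Finset.sum_mul, Finset.mul_sum, Finset.sum_mul]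
      refine norm_sum_le_of_le _ fun q hq => ?_
      rw [Finset.HasAntidiagonal.mem_antidiagonal] at hp hq
      have e1 : (s₀ + τ + t : ℂ) = s₀ + ((τ + t : ℝ) : ℂ) := by push_cast; ring
      have hre : R ≤ (s₀ + ((τ + t : ℝ) : ℂ)).re := by simp; linarith
      have him : |(s₀ + ((τ + t : ℝ) : ℂ)).im| ≤ T := by simpa using hT
      rw [e1, deltaDiff_adPow hA, deltaDiff_adPow hA, ← adPow_mul]
      have hk := hc.norm_kernel (isHead_pertCoeff hU p.1 (s₀ + ((τ + t : ℝ) : ℂ)))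
        (deltaDiff_mul_deltaDiff_mem K (θ q.1 (s₀ + ((τ + t : ℝ) : ℂ)))
          (θ q.2 (s₀ + ((τ + t : ℝ) : ℂ)))) hT h0 (add_nonneg hτ ht) (γ := γ p.1)
        (by simpa using hγ p.1 _ hre)
      refine hk.trans ?_
      have hγ0 : 0 ≤ γ p.1 :=
        nonneg_of_mul_nonneg_left ((norm_nonneg _).trans (hγ p.1 _ hre)) (Real.exp_pos _)
      have b1 := (norm_deltaDiff_le K _).trans (hx q.1 (by omega) _ hre him)
      have b2 := (norm_deltaDiff_le K _).trans (hx q.2 (by omega) _ hre him)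
      have b3 : ‖deltaDiff K (θ q.1 (s₀ + ((τ + t : ℝ) : ℂ))) *
          deltaDiff K (θ q.2 (s₀ + ((τ + t : ℝ) : ℂ)))‖ ≤ x q.1 * x q.2 :=
        (norm_mul_le _ _).trans (mul_le_mul b1 b2 (norm_nonneg _) ((norm_nonneg _).trans b1))
      calc _ ≤ 2 * C ^ 2 * γ p.1 * (x q.1 * x q.2) *
            Real.exp (-(1 - σ) * (s₀.re + (τ + t))) := by gcongr
        _ = _ := by
            simp only [Complex.add_re, Complex.ofReal_re]
            rw [← add_assoc]; ring)
    (by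
      have := ((adPowL s₀ A).continuous.tendsto 0).comp (h.lim_block m (s₀ + τ))
      rwa [map_zero] at this)
  refine key.trans (le_of_eq ?_)
  simp only [Complex.add_re, Complex.ofReal_re]
  ring

theorem GaugeCoeff.norm_delta_le {U X : Mat n} {θ F : ℕ → ℂ → Mat n} (h : GaugeCoeff K U X θ F)
    (hc : ConjBound K (delta K X) T C σ) (hU : IsHead K U) {R : ℝ} (hR0 : 0 ≤ R) {γ x : ℕ → ℝ}
    (hγ : ∀ p (s : ℂ), R ≤ s.re → ‖pertCoeff U p s‖ ≤ γ p * Real.exp (-s.re)) {m : ℕ}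
    (hx : ∀ i ≤ m, ∀ s : ℂ, R ≤ s.re → |s.im| ≤ T → ‖θ i s‖ ≤ x i) {s : ℂ} (hs : R ≤ s.re)
    (hT : |s.im| ≤ T) :
    ‖delta K (θ (m + 1) s)‖ ≤
      2 * C ^ 2 / (1 - σ) * tripleConv γ x m * Real.exp (-(1 - σ) * s.re) := by
  have := h.norm_block_le hc hU hγ hx (s₀ := s) le_rfl (hR0.trans hs) (by simpa using hs) hT
  simpa [h.delta_succ] using this

theorem GaugeCoeff.norm_fullRec_le {U X : Mat n} {θ F : ℕ → ℂ → Mat n} (h : GaugeCoeff K U X θ F)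
    (hc : ConjBound K (delta K X) T C σ) (hU : IsHead K U) {R : ℝ} (hR0 : 0 ≤ R) {γ x : ℕ → ℝ}
    (hγ : ∀ p (s : ℂ), R ≤ s.re → ‖pertCoeff U p s‖ ≤ γ p * Real.exp (-s.re)) {m : ℕ}
    (hx : ∀ i ≤ m, ∀ s : ℂ, R ≤ s.re → |s.im| ≤ T → ‖θ i s‖ ≤ x i) {s : ℂ} (hs : R ≤ s.re)
    (hT : |s.im| ≤ T) :
    ‖fullRec K (fun p => adPow s (delta K X) (pertCoeff U p s)) (fun i => θ i s) m‖ ≤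
      (∑ q ∈ Finset.HasAntidiagonal.antidiagonal m,
        2 * x q.1 * (2 * C ^ 2 / (1 - σ) * tripleConv γ x q.2) + 4 * C * tripleConv γ x m) *
        Real.exp (-(1 - σ) * s.re) := by
  have hC := hc.C_pos
  have hη : 0 < 1 - σ := sub_pos.2 hc.σ_lt
  have hx0 : ∀ i ≤ m, 0 ≤ x i := fun i hi => (norm_nonneg _).trans (hx i hi s hs hT)
  rw [fullRec, add_mul]
  refine (norm_add_le _ _).trans (add_le_add ?_ ?_)
  · rw [Finset.sum_mul]
    refine norm_sum_le_of_le _ fun q hq => ?_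
    rw [Finset.HasAntidiagonal.mem_antidiagonal] at hq
    have b1 := hx q.1 (by omega) s hs hT
    have b2 := h.norm_delta_le hc hU hR0 hγ (m := q.2) (fun i hi => hx i (by omega)) hs hT
    have := hx0 q.1 (by omega)
    calc _ ≤ 2 * ‖θ q.1 s‖ * ‖delta K (θ (q.2 + 1) s)‖ := norm_lie_le _ _
      _ ≤ 2 * x q.1 * (2 * C ^ 2 / (1 - σ) * tripleConv γ x q.2 * Real.exp (-(1 - σ) * s.re)) := by
          gcongr
      _ = _ := by ring
  · rw [tripleConv, Finset.mul_sum, Finset.sum_mul]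
    refine norm_sum_le_of_le _ fun p hp => ?_
    rw [mul_comm (γ p.1), Finset.sum_mul, Finset.mul_sum, Finset.sum_mul]
    refine norm_sum_le_of_le _ fun q hq => ?_
    rw [Finset.HasAntidiagonal.mem_antidiagonal] at hp hq
    have b1 := hx q.1 (by omega) s hs hT
    have b1' := (norm_deltaDiff_le K _).trans b1
    have b2 := hx q.2 (by omega) s hs hT
    have b3 := hc.norm_head_small (isHead_pertCoeff hU p.1 s) hT (hR0.trans hs) (hγ p.1 s hs)
    have := hx0 q.1 (by omega)
    have := hx0 q.2 (by omega)
    have hγ0 : 0 ≤ γ p.1 :=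
      nonneg_of_mul_nonneg_left ((norm_nonneg _).trans (hγ p.1 _ hs)) (Real.exp_pos _)
    set g := adPow s (delta K X) (pertCoeff U p.1 s)
    calc _ ≤ 2 * ‖g * deltaDiff K (θ q.1 s) + deltaDiff K (θ q.1 s) * g‖ * ‖θ q.2 s‖ :=
          norm_lie_le _ _
      _ ≤ 2 * (2 * ‖g‖ * ‖deltaDiff K (θ q.1 s)‖) * ‖θ q.2 s‖ := by
          gcongr; exact norm_anti_le _ _
      _ ≤ 2 * (2 * (C * γ p.1 * Real.exp (-(1 - σ) * s.re)) * x q.1) * x q.2 := by gcongr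
      _ = _ := by ring

/-- Each θ_{m+1} tends to 0 along rays and its derivative is bounded by earlier terms of the
majorant times e^{-(1-σ) Re s}. Integrating yields the factor e^{-(1-σ)R}/(1-σ), the small parameter
of the majorant recursion. -/
theorem GaugeCoeff.norm_le {U X : Mat n} {θ F : ℕ → ℂ → Mat n} (h : GaugeCoeff K U X θ F)
    (hc : ConjBound K (delta K X) T C σ) (hU : IsHead K U) {R : ℝ} (hR0 : 0 ≤ R) {γ x : ℕ → ℝ}
    (hγ : ∀ p (s : ℂ), R ≤ s.re → ‖pertCoeff U p s‖ ≤ γ p * Real.exp (-s.re)) (hx0 : ‖X‖ ≤ x 0)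
    (hx : ∀ m, x (m + 1) = Real.exp (-(1 - σ) * R) / (1 - σ) *
      (∑ q ∈ Finset.HasAntidiagonal.antidiagonal m,
        2 * x q.1 * (2 * C ^ 2 / (1 - σ) * tripleConv γ x q.2) + 4 * C * tripleConv γ x m))
    (hxp : ∀ m, 0 ≤ x (m + 1))
    (m : ℕ) : ∀ i ≤ m, ∀ s : ℂ, R ≤ s.re → |s.im| ≤ T → ‖θ i s‖ ≤ x i := by
  have hη : 0 < 1 - σ := sub_pos.2 hc.σ_lt
  induction m with
  | zero =>
    intro i hi s _ _
    rw [Nat.le_zero.1 hi, h.zero]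
    exact hx0
  | succ m ih =>
    intro i hi s hs hT
    rcases Nat.lt_or_ge m i with hlt | hge
    swap
    · exact ih i hge s hs hT
    rw [show i = m + 1 by omega]
    have key := norm_le_of_deriv_le (s := s) (f := θ (m + 1))
      (f' := fun s => fullRec K (fun p => adPow s (delta K X) (pertCoeff U p s))
        (fun i => θ i s) m) hη
      (fun t _ => (h.prim m).hasDerivAt _)
      (fun t ht => by
        have := h.norm_fullRec_le hc hU hR0 hγ ih (s := s + t) (by simp; linarith)
          (by simpa using hT)
        simpa using this)
      (h.lim m s)
    refine key.trans ?_
    have hx' := hx m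
    set B := ∑ q ∈ Finset.HasAntidiagonal.antidiagonal m,
        2 * x q.1 * (2 * C ^ 2 / (1 - σ) * tripleConv γ x q.2) + 4 * C * tripleConv γ x m
    have hB : 0 ≤ B := by
      have h1 := hxp m
      rw [hx'] at h1
      exact nonneg_of_mul_nonneg_right h1 (by positivity)
    calc _ ≤ B / (1 - σ) * Real.exp (-(1 - σ) * R) := by
          have : -(1 - σ) * s.re ≤ -(1 - σ) * R := by nlinarith
          gcongr
      _ = _ := by rw [hx']; ring

/-! ### The sum of the series -/

theorem hasSum_antidiagonal_mul {f g : ℕ → Mat n} (hf : Summable fun i => ‖f i‖)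
    (hg : Summable fun i => ‖g i‖) :
    HasSum (fun m => ∑ q ∈ Finset.HasAntidiagonal.antidiagonal m, f q.1 * g q.2)
      ((∑' i, f i) * ∑' i, g i) := by
  have h := tsum_mul_tsum_eq_tsum_sum_antidiagonal_of_summable_norm hf hg
  have h2 := (summable_norm_sum_mul_antidiagonal_of_summable_norm hf hg).of_norm.hasSum
  exact (congrArg (HasSum fun m => ∑ q ∈ Finset.HasAntidiagonal.antidiagonal m, f q.1 * g q.2)
    h).mpr h2

theorem hasSum_antidiagonal_mul_swap {f g : ℕ → Mat n} (hf : Summable fun i => ‖f i‖)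
    (hg : Summable fun i => ‖g i‖) :
    HasSum (fun m => ∑ q ∈ Finset.HasAntidiagonal.antidiagonal m, g q.2 * f q.1)
      ((∑' i, g i) * ∑' i, f i) := by
  have h := hasSum_antidiagonal_mul hg hf
  have e : (fun m => ∑ q ∈ Finset.HasAntidiagonal.antidiagonal m, g q.2 * f q.1) =
      fun m => ∑ q ∈ Finset.HasAntidiagonal.antidiagonal m, g q.1 * f q.2 := funext fun m =>
    Finset.Nat.sum_antidiagonal_swap (n := m) (f := fun q : ℕ × ℕ => g q.1 * f q.2)
  rw [e]
  exact h

theorem hasSum_antidiagonal_lie {f g : ℕ → Mat n} (hf : Summable fun i => ‖f i‖)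
    (hg : Summable fun i => ‖g i‖) :
    HasSum (fun m => ∑ q ∈ Finset.HasAntidiagonal.antidiagonal m, ⁅f q.1, g q.2⁆)
      ⁅∑' i, f i, ∑' i, g i⁆ := by
  have h := (hasSum_antidiagonal_mul hf hg).sub (hasSum_antidiagonal_mul_swap hf hg)
  simp only [Ring.lie_def, Finset.sum_sub_distrib]
  exact h

theorem summable_norm_antidiagonal_anti {f g : ℕ → Mat n} (hf : Summable fun i => ‖f i‖)
    (hg : Summable fun i => ‖g i‖) :
    Summable fun m => ‖∑ q ∈ Finset.HasAntidiagonal.antidiagonal m,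
      (f q.1 * g q.2 + g q.2 * f q.1)‖ := by
  refine Summable.of_nonneg_of_le (fun _ => norm_nonneg _) (fun m => ?_)
    ((summable_norm_sum_mul_antidiagonal_of_summable_norm hf hg).add
      (summable_norm_sum_mul_antidiagonal_of_summable_norm hg hf))
  rw [Finset.sum_add_distrib]
  refine (norm_add_le _ _).trans (add_le_add le_rfl (le_of_eq ?_))
  congr 1
  exact Finset.Nat.sum_antidiagonal_swap (n := m) (f := fun q : ℕ × ℕ => g q.1 * f q.2)

/-- The sum of the recursion is the differential equation. -/
theorem hasSum_fullRec {A g : Mat n} {s : ℂ} {γ θ : ℕ → Mat n}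
    (hγ : Summable fun p => ‖γ p‖) (hγg : HasSum γ g)
    (hθ : Summable fun i => ‖θ i‖) (h0 : delta K (θ 0) = A) :
    HasSum (fullRec K (fun p => adPow s A (γ p)) θ) (gaugeRHS K A g s (∑' i, θ i)) := by
  have hd : Summable fun i => ‖delta K (θ i)‖ :=
    Summable.of_nonneg_of_le (fun _ => norm_nonneg _) (fun i => Shrinking.norm_delta_le K _) hθ
  have hN : Summable fun i => ‖deltaDiff K (θ i)‖ :=
    Summable.of_nonneg_of_le (fun _ => norm_nonneg _) (fun i => norm_deltaDiff_le K _) hθ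
  have hg : Summable fun p => ‖adPow s A (γ p)‖ := by
    refine Summable.of_nonneg_of_le (fun _ => norm_nonneg _)
      (fun p => (adPowL s A).le_opNorm (γ p)) (hγ.mul_left _)
  have e1 : ∑' i, delta K (θ (i + 1)) = delta K (∑' i, θ i) - A := by
    have h1 : delta K (∑' i, θ i) = ∑' i, delta K (θ i) := (deltaL K).map_tsum hθ.of_norm
    have h2 : ∑' i, delta K (θ i) = delta K (θ 0) + ∑' i, delta K (θ (i + 1)) :=
      hd.of_norm.tsum_eq_zero_add
    rw [h1, h2, h0, add_sub_cancel_left]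
  have e2 : ∑' i, deltaDiff K (θ i) = deltaDiff K (∑' i, θ i) :=
    ((deltaDiffL K).map_tsum hθ.of_norm).symm
  have e3 : ∑' p, adPow s A (γ p) = adPow s A g :=
    ((adPowL s A).hasSum hγg).tsum_eq
  have h1 := hasSum_antidiagonal_lie hθ ((summable_nat_add_iff 1).2 hd)
  have h2 := hasSum_antidiagonal_lie (summable_norm_antidiagonal_anti hg hN) hθ
  have h3 := ((hasSum_antidiagonal_mul hg hN).add (hasSum_antidiagonal_mul_swap hg hN)).tsum_eq
  simp only [← Finset.sum_add_distrib] at h3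
  rw [h3, e2, e3] at h2
  rw [e1] at h1
  have e4 : fullRec K (fun p => adPow s A (γ p)) θ = fun m => _ := funext fun m => fullRec_eq _ θ m
  rw [e4]
  exact h1.add h2

end

/-! ### The sum of the series solves the gauged equation. -/

section



variable {n : ℕ} {K : ℕ} {T C σ : ℝ}

/-- The majorant is uniform on a half-strip, so the series may be differentiated term by term, and
the recursion sums to the differential equation. Dominated convergence with the same majorant gives
both limits. -/
theorem GaugeCoeff.gaugeSol {U X : Mat n} {θ F : ℕ → ℂ → Mat n} (h : GaugeCoeff K U X θ F)
    (hc : ConjBound K (delta K X) T C σ) (hU : IsHead K U) {u R : ℝ} (hR0 : 0 ≤ R) (hu : ‖U‖ ≤ u)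
    (hR : u * Real.exp (-R) ≤ 1 / 2)
    (hsmall : Real.exp (-(1 - σ) * R) / (1 - σ) * (2 * (2 * C ^ 2 / (1 - σ)) * (2 * u) *
      (‖X‖ + 1) ^ 3 + 4 * C * (2 * u) * (‖X‖ + 1) ^ 2) ≤ 1)
    {G : ℂ → Mat n} (hG : ∀ s : ℂ, R ≤ s.re → HasSum (fun p => pertCoeff U p s) (G s))
    {s : ℂ} (hs : R < s.re) (hT : |s.im| < T) :
    GaugeSol K (delta K X) G (fun s => ∑' m, θ m s) X (‖X‖ + 1) s ∧
      Summable fun m => ‖θ m s‖ := by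
  have hη : 0 < 1 - σ := sub_pos.2 hc.σ_lt
  have hC := hc.C_pos
  have hA := hc.mem
  have hu0 : 0 ≤ u := (norm_nonneg _).trans hu
  set γ : ℕ → ℝ := fun p => u * (1 / 2) ^ p with hγdef
  have hγ0 : ∀ p, 0 ≤ γ p := fun p => by positivity
  have hγs : HasSum γ (2 * u) := by
    have := hasSum_geometric_two.mul_left u
    rwa [mul_comm u 2] at this
  have hγ : ∀ p (s : ℂ), R ≤ s.re → ‖pertCoeff U p s‖ ≤ γ p * Real.exp (-s.re) :=
    fun p s hs => norm_pertCoeff_le hu hR hs p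
  obtain ⟨x, hx0, hx, hxp, hxs, hxsum, hts⟩ := exists_majorant (norm_nonneg X)
    (a := 2 * C ^ 2 / (1 - σ)) (b := 4 * C) (ε := Real.exp (-(1 - σ) * R) / (1 - σ)) (Γ := 2 * u)
    (by positivity) (by positivity) (by positivity) hγ0
    (fun N => sum_le_hasSum _ (fun i _ => hγ0 i) hγs) hsmall
  have hb : ∀ i, ∀ s : ℂ, R ≤ s.re → |s.im| ≤ T → ‖θ i s‖ ≤ x i := fun i =>
    h.norm_le hc hU hR0 hγ hx0.ge hx (fun m => hxp _) i i le_rfl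
  have hθs : ∀ s : ℂ, R ≤ s.re → |s.im| ≤ T → Summable fun m => ‖θ m s‖ := fun s hs hT =>
    Summable.of_nonneg_of_le (fun _ => norm_nonneg _) (fun m => hb m s hs hT) hxsum
  have hexp1 : ∀ s : ℂ, R ≤ s.re → Real.exp (-(1 - σ) * s.re) ≤ 1 := fun s hs =>
    Real.exp_le_one_iff.2 (by nlinarith)
  -- the differential equation
  set d : ℕ → ℝ := fun m => ∑ q ∈ Finset.HasAntidiagonal.antidiagonal m,
        2 * x q.1 * (2 * C ^ 2 / (1 - σ) * tripleConv γ x q.2) + 4 * C * tripleConv γ x m with hd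
  have hd0 : ∀ m, 0 ≤ d m := fun m => by
    have ht : ∀ m, 0 ≤ tripleConv γ x m := fun m => tripleConv_nonneg hγ0 fun i _ => hxp i
    refine add_nonneg (Finset.sum_nonneg fun q _ => ?_) (mul_nonneg (by positivity) (ht m))
    exact mul_nonneg (mul_nonneg zero_le_two (hxp _)) (mul_nonneg (by positivity) (ht _))
  -- The bounds for the derivatives are the shifted majorant divided by its positive small
  -- parameter.
  have hdsum : Summable d := by
    have h1 : Summable fun m => x (m + 1) := (summable_nat_add_iff 1).2 hxsum
    simp only [hx] at h1
    exact (summable_mul_left_iff (by positivity)).1 h1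
  set θ' : ℕ → ℂ → Mat n := fun m => Nat.casesOn m (fun _ => 0) fun m s =>
    fullRec K (fun p => adPow s (delta K X) (pertCoeff U p s)) (fun i => θ i s) m with hθ'
  have hderiv : ∀ m s, HasDerivAt (θ m) (θ' m s) s := by
    intro m s
    cases m with
    | zero =>
      have e : θ 0 = fun _ => X := funext h.zero
      rw [e]
      exact hasDerivAt_const s X
    | succ m => exact (h.prim m).hasDerivAt s
  -- Term-by-term differentiation needs an open connected set, whence the strict inequalities.
  set S : Set ℂ := {s | R < s.re ∧ |s.im| < T} with hS
  have hSo : IsOpen S := (isOpen_lt continuous_const Complex.continuous_re).inter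
    (isOpen_lt Complex.continuous_im.abs continuous_const)
  have hSc : Convex ℝ S := by
    have h1 : Convex ℝ {s : ℂ | R < s.re} := convex_halfSpace_re_gt R
    have h2 : Convex ℝ ({s : ℂ | s.im < T} ∩ {s : ℂ | -T < s.im}) :=
      (convex_halfSpace_im_lt T).inter (convex_halfSpace_im_gt (-T))
    convert h1.inter h2 using 1
    ext s
    simp only [hS, Set.mem_ofPred_eq, abs_lt, Set.mem_inter_iff]
    tauto
  have hsS : ∀ t : ℝ, 0 ≤ t → s + t ∈ S := fun t ht => ⟨by simp; linarith, by simpa using hT⟩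
  have hode : ∀ s ∈ S, HasDerivAt (fun s => ∑' m, θ m s)
      (gaugeRHS K (delta K X) (G s) s (∑' m, θ m s)) s := by
    intro s hsS
    have h1 : HasDerivAt (fun s => ∑' m, θ m s) (∑' m, θ' m s) s := by
      refine hasDerivAt_tsum_of_isPreconnected (u := fun m => Nat.casesOn m 0 d) (t := S) ?_ hSo
        hSc.isPreconnected (fun m y _ => hderiv m y) ?_ hsS (hθs s hsS.1.le hsS.2.le).of_norm hsS
      · exact (summable_nat_add_iff 1).1 hdsum
      · intro m y hy
        cases m with
        | zero => exact norm_zero.le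
        | succ m =>
          refine (h.norm_fullRec_le hc hU hR0 hγ (fun i _ => hb i) hy.1.le hy.2.le).trans ?_
          exact mul_le_of_le_one_right (hd0 m) (hexp1 y hy.1.le)
    have hγn : Summable fun p => ‖pertCoeff U p s‖ :=
      Summable.of_nonneg_of_le (fun _ => norm_nonneg _) (fun p => hγ p s hsS.1.le)
        (hγs.summable.mul_right _)
    have h2 := hasSum_fullRec (K := K) (A := delta K X) (s := s) hγn (hG s hsS.1.le)
      (hθs s hsS.1.le hsS.2.le) (by rw [h.zero])
    have h3 : ∑' m, θ' m s = gaugeRHS K (delta K X) (G s) s (∑' m, θ m s) := by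
      have h4 : Summable fun m => θ' m s := (summable_nat_add_iff 1).1 h2.summable
      have h5 : ∑' m, θ' m s = θ' 0 s + ∑' m, θ' (m + 1) s := h4.tsum_eq_zero_add
      rw [h5]
      exact (zero_add _).trans h2.tsum_eq
    rw [← h3]
    exact h1
  refine ⟨⟨fun t ht => hode _ (hsS t ht), fun t ht => ?_, ?_, ?_⟩, hθs s hs.le hT.le⟩
  · have hSt := hsS t ht
    refine (norm_tsum_le_tsum_norm (hθs _ hSt.1.le hSt.2.le)).trans ?_
    refine ((hθs _ hSt.1.le hSt.2.le).tsum_le_tsum (fun m => hb m _ hSt.1.le hSt.2.le) hxsum).trans ?_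
    exact hxsum.tsum_le_of_sum_range_le hxs
  -- All terms except the constant zeroth one tend to 0, so the limit of the sum is X.
  · have h1 := tendsto_tsum_of_dominated_convergence (𝓕 := atTop)
      (f := fun (t : ℝ) m => θ m (s + t)) (g := fun m => Nat.casesOn m X fun _ => 0) hxsum
      (fun m => by
        cases m with
        | zero => simp only [h.zero]; exact tendsto_const_nhds
        | succ m => exact h.lim m s)
      ((eventually_ge_atTop 0).mono fun t ht m => hb m _ (hsS t ht).1.le (hsS t ht).2.le)
    rw [tsum_eq_single 0 (fun m hm => by cases m with | zero => exact absurd rfl hm | succ m => rfl)]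
      at h1
    exact h1
  -- For the block limit the primitives F must be bounded without a growing conjugation. The block
  -- estimate is used with base point i Im s, where the real part is 0 and conjugating back costs
  -- only the constant C.
  · have hs0 : |(⟨0, s.im⟩ : ℂ).im| ≤ T := hT.le
    have hF : ∀ m (t : ℝ), 0 ≤ t →
        ‖F m (s + t)‖ ≤ C * (2 * C ^ 2 / (1 - σ) * tripleConv γ x m) := by
      intro m t ht
      have hSt := hsS t ht
      have h1 := h.norm_block_le hc hU hγ (fun i (_ : i ≤ m) => hb i) (s₀ := ⟨0, s.im⟩)
        (τ := s.re + t) (by linarith) le_rfl (by linarith) hs0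
      have e : ((⟨0, s.im⟩ : ℂ) + ((s.re + t : ℝ) : ℂ)) = s + t := by
        apply Complex.ext <;> simp
      rw [e] at h1
      have h2 := hc.bound.norm_adPow_le hc.mem ((h.head m (s + t)).adPow hA ⟨0, s.im⟩)
        (w := -⟨0, s.im⟩) (by simpa using hT.le)
      rw [adPow_neg_adPow] at h2
      refine h2.trans ?_
      have h3 : Real.exp (σ * |(-(⟨0, s.im⟩ : ℂ)).re|) = 1 := by simp
      rw [h3, mul_one]
      refine mul_le_mul_of_nonneg_left (h1.trans ?_) hC.le
      have ht := tripleConv_nonneg hγ0 (m := m) fun i _ => hxp i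
      refine mul_le_of_le_one_right (by positivity) (Real.exp_le_one_iff.2 ?_)
      have : 0 ≤ s.re + t := by linarith
      simp only [zero_add]
      nlinarith
    have h1 := tendsto_tsum_of_dominated_convergence (𝓕 := atTop)
      (f := fun (t : ℝ) m => F m (s + t)) (g := fun _ => 0)
      ((hts.mul_left (2 * C ^ 2 / (1 - σ))).mul_left C) (fun m => h.lim_block m s)
      ((eventually_ge_atTop 0).mono fun t ht m => hF m t ht)
    rw [tsum_zero] at h1
    refine h1.congr' ((eventually_ge_atTop 0).mono fun t ht => ?_)
    have hSt := hsS t ht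
    have hsm := (hθs _ hSt.1.le hSt.2.le).of_norm
    have e1 : delta K (∑' m, θ m (s + t)) = ∑' m, delta K (θ m (s + t)) :=
      (deltaL K).map_tsum hsm
    have hsm1 : Summable fun m => delta K (θ m (s + t)) := (deltaL K).summable hsm
    have e2 : ∑' m, delta K (θ m (s + t)) =
        delta K (θ 0 (s + t)) + ∑' m, delta K (θ (m + 1) (s + t)) := hsm1.tsum_eq_zero_add
    have hsm2 : Summable fun m => delta K (θ (m + 1) (s + t)) := (summable_nat_add_iff 1).2 hsm1
    have e3 : adPow (-(s + t)) (delta K X) (∑' m, delta K (θ (m + 1) (s + t))) =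
        ∑' m, adPow (-(s + t)) (delta K X) (delta K (θ (m + 1) (s + t))) :=
      (adPowL (-(s + t)) (delta K X)).map_tsum hsm2
    simp only
    rw [e1, e2, h.zero, add_sub_cancel_left, e3]
    exact tsum_congr fun m => by rw [h.delta_succ, adPow_neg_adPow]

/-! ### The perturbation -/

/-- The perturbation `-U (z + U)⁻¹`, `z = exp s`. -/
def pert (n : ℕ) (v : Fin K → ℂ) (s : ℂ) : Mat n :=
  Matrix.diagonal fun i => -(UMat n v i i) / (Complex.exp s + UMat n v i i)

theorem UMat_apply_of_not_lt (v : Fin K → ℂ) {i : Fin n} (hi : ¬ i.val < K) : UMat n v i i = 0 := by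
  rw [UMat, Matrix.diagonal_apply_eq, if_neg hi]

theorem UMat_eq_diagonal (v : Fin K → ℂ) : UMat n v = Matrix.diagonal fun i => UMat n v i i := by
  rw [UMat]
  simp only [Matrix.diagonal_apply_eq]

theorem isHead_pert (v : Fin K → ℂ) (s : ℂ) : IsHead K (pert n v s) :=
  isHead_diagonal fun i hi => by rw [UMat_apply_of_not_lt v hi]; simp

theorem norm_entry_le (A : Mat n) (i j : Fin n) : ‖A i j‖ ≤ ‖A‖ := by
  rw [Matrix.linfty_opNorm_def]
  have h1 : ‖A i j‖₊ ≤ ∑ j, ‖A i j‖₊ :=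
    Finset.single_le_sum (f := fun j => ‖A i j‖₊) (fun _ _ => zero_le) (Finset.mem_univ j)
  have h2 : ∑ j, ‖A i j‖₊ ≤ Finset.univ.sup fun i => ∑ j, ‖A i j‖₊ :=
    Finset.le_sup (f := fun i => ∑ j, ‖A i j‖₊) (Finset.mem_univ i)
  exact_mod_cast h1.trans h2

theorem neg_one_pow_mul_exp_mul_pow (d s : ℂ) (p : ℕ) :
    (-1) ^ (p + 1) * Complex.exp (-(((p : ℂ) + 1) * s)) * d ^ (p + 1) =
      (-(d * Complex.exp (-s))) ^ (p + 1) := by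
  rw [neg_pow (d * _), mul_pow, ← Complex.exp_nat_mul]
  push_cast
  rw [show ((p : ℂ) + 1) * -s = -(((p : ℂ) + 1) * s) by ring]
  ring

/-- Entrywise geometric series in -U/z, of ratio at most 1/2 in the stated half-plane. -/
theorem hasSum_pertCoeff {v : Fin K → ℂ} {u R : ℝ} (hu : ‖UMat n v‖ ≤ u)
    (hR : u * Real.exp (-R) ≤ 1 / 2) {s : ℂ} (hs : R ≤ s.re) :
    HasSum (fun p => pertCoeff (UMat n v) p s) (pert n v s) := by
  have hu0 : 0 ≤ u := (norm_nonneg _).trans hu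
  have e : (fun p => pertCoeff (UMat n v) p s) = fun p => Matrix.diagonal fun i =>
      (-(UMat n v i i * Complex.exp (-s))) * (-(UMat n v i i * Complex.exp (-s))) ^ p := by
    funext p
    rw [pertCoeff]
    conv_lhs => rw [UMat_eq_diagonal v]
    rw [Matrix.diagonal_pow, ← Matrix.diagonal_smul]
    congr 1
    funext i
    rw [Pi.smul_apply, Pi.pow_apply, smul_eq_mul, ← pow_succ']
    exact neg_one_pow_mul_exp_mul_pow _ s p
  rw [e]
  refine HasSum.matrix_diagonal (Pi.hasSum.2 fun i => ?_)
  set d := UMat n v i i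
  have hz : ‖d * Complex.exp (-s)‖ ≤ 1 / 2 := by
    rw [norm_mul, Complex.norm_exp, Complex.neg_re]
    refine le_trans ?_ hR
    have : ‖d‖ ≤ u := (norm_entry_le _ i i).trans hu
    gcongr
  have h1 := (hasSum_geometric_of_norm_lt_one (ξ := -(d * Complex.exp (-s)))
    (by rw [norm_neg]; linarith)).mul_left (-(d * Complex.exp (-s)))
  have h2 : (1 : ℂ) - -(d * Complex.exp (-s)) ≠ 0 := by
    intro h0
    have : d * Complex.exp (-s) = -1 := by linear_combination h0
    rw [this] at hz
    norm_num at hz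
  have h3 : Complex.exp s + d = Complex.exp s * (1 - -(d * Complex.exp (-s))) := by
    have : Complex.exp s * Complex.exp (-s) = 1 := by rw [← Complex.exp_add]; simp
    linear_combination (-d) * this
  have h4 : -d / (Complex.exp s + d) =
      -(d * Complex.exp (-s)) * (1 - -(d * Complex.exp (-s)))⁻¹ := by
    rw [h3, Complex.exp_neg, div_eq_mul_inv, mul_inv]
    ring
  rw [← h4] at h1
  exact h1

theorem smallHead_pert {v : Fin K → ℂ} {u R : ℝ} (hu : ‖UMat n v‖ ≤ u) (hR0 : 0 ≤ R)
    (hR : u * Real.exp (-R) ≤ 1 / 2) : SmallHead K (pert n v) (2 * u) R where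
  head := isHead_pert v
  bound s hs := by
    have h1 := hasSum_pertCoeff hu hR hs
    have h2 : HasSum (fun p : ℕ => u * (1 / 2) ^ p * Real.exp (-s.re))
        (2 * u * Real.exp (-s.re)) := by
      have := (hasSum_geometric_two.mul_left u).mul_right (Real.exp (-s.re))
      rwa [mul_comm u 2] at this
    rw [← h1.tsum_eq, ← h2.tsum_eq]
    exact tsum_of_norm_bounded h2.summable.hasSum fun p => norm_pertCoeff_le hu hR hs p
  R_nonneg := hR0

theorem tendsto_mul_exp_neg {η : ℝ} (hη : 0 < η) (c : ℝ) :
    Tendsto (fun R : ℝ => c * Real.exp (-η * R)) atTop (𝓝 0) := by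
  have h := (Real.tendsto_exp_atBot.comp
    (tendsto_id.const_mul_atTop_of_neg (neg_neg_of_pos hη))).const_mul c
  rw [mul_zero] at h
  exact h

/-- The formal series converges, and its sum is a solution with the right asymptotics. -/
theorem exists_series_sum (h : K ≤ n) (v : Fin K → ℂ) {X : Mat n}
    (hgap : BlockGap h (delta K X)) :
    ∃ (φ : ℕ → ℂ → Mat n) (Θ : ℂ → Mat n), IsSeriesCoeff v X φ ∧
      ∀ T C σ : ℝ, ConjBound K (delta K X) T C σ → ∀ᶠ R : ℝ in atTop, ∀ s : ℂ, R < s.re →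
        |s.im| < T → GaugeSol K (delta K X) (pert n v) Θ X (‖X‖ + 1) s ∧
          HasSum (fun m : ℕ => Complex.exp (-((m : ℂ) * s)) • φ m s)
            (adPow (-s) (delta K X) (Θ s)) := by
  obtain ⟨θ, F, hθ⟩ := exists_gaugeCoeff h (isHead_UMat (n := n) v) hgap
  refine ⟨_, fun s => ∑' m, θ m s, hθ.isSeriesCoeff, fun T C σ hc => ?_⟩
  have hη : 0 < 1 - σ := sub_pos.2 hc.σ_lt
  have h1 := tendsto_mul_exp_neg one_pos ‖UMat n v‖
  have h2 := tendsto_mul_exp_neg hη (1 / (1 - σ) * (2 * (2 * C ^ 2 / (1 - σ)) *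
    (2 * ‖UMat n v‖) * (‖X‖ + 1) ^ 3 + 4 * C * (2 * ‖UMat n v‖) * (‖X‖ + 1) ^ 2))
  filter_upwards [eventually_ge_atTop 0, h1.eventually_le_const (by norm_num : (0 : ℝ) < 1 / 2),
    h2.eventually_le_const one_pos] with R hR0 hR1 hR2 s hs hT
  rw [neg_one_mul] at hR1
  obtain ⟨g1, g2⟩ := hθ.gaugeSol hc (isHead_UMat v) hR0 le_rfl hR1
    (by
      refine le_trans (le_of_eq ?_) hR2
      ring) (fun s hs => hasSum_pertCoeff le_rfl hR1 hs) hs hT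
  refine ⟨g1, ?_⟩
  have h3 : HasSum (fun m => adPow (-s) (delta K X) (θ m s))
      (adPow (-s) (delta K X) (∑' m, θ m s)) := (adPowL (-s) (delta K X)).hasSum g2.of_norm.hasSum
  convert h3 using 1
  funext m
  rw [smul_smul, ← Complex.exp_add, neg_add_cancel, Complex.exp_zero, one_smul]

end

/-! ### Projected domains, directional form of the equations, and their splitting near the boundary.
-/

section



variable {n : ℕ} {K : ℕ}

/-! ### Domains -/

@[simp] theorem extend_castSucc (v : Fin K → ℂ) (s : ℂ) (j : Fin K) :
    extend v s j.castSucc = v j := Fin.snoc_castSucc (α := fun _ => ℂ) s v j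

@[simp] theorem extend_last (v : Fin K → ℂ) (s : ℂ) : extend v s (Fin.last K) = s :=
  Fin.snoc_last (α := fun _ => ℂ) s v

theorem sum_extend (v : Fin K → ℂ) (s : ℂ) : ∑ j, extend v s j = ∑ j, v j + s := by
  rw [Fin.sum_univ_castSucc]; simp

/-- Restriction to the first `k` coordinates. -/
def restrictL {k l : ℕ} (h : k ≤ l) : (Fin l → ℂ) →L[ℂ] (Fin k → ℂ) :=
  ContinuousLinearMap.pi fun i => ContinuousLinearMap.proj (Fin.castLE h i)

theorem restrictL_apply {k l : ℕ} (h : k ≤ l) (w : Fin l → ℂ) (i : Fin k) :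
    restrictL h w i = w (Fin.castLE h i) := rfl

theorem restrictL_surjective {k l : ℕ} (h : k ≤ l) : Function.Surjective (restrictL h) := by
  intro v
  refine ⟨fun j => if hj : j.val < k then v ⟨j, hj⟩ else 0, ?_⟩
  ext i
  rw [restrictL_apply, dif_pos (by simp)]
  rfl

theorem restrictL_extend (v : Fin K → ℂ) (s : ℂ) : restrictL K.le_succ (extend v s) = v := by
  ext i
  exact extend_castSucc v s i

/-- `extend` as an affine map. -/
def extendL (K : ℕ) : (Fin K → ℂ) →L[ℂ] (Fin (K + 1) → ℂ) :=
  ContinuousLinearMap.pi fun j => Fin.lastCases 0 (fun i => ContinuousLinearMap.proj i) j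

theorem extendL_add_single (v : Fin K → ℂ) (s : ℂ) :
    extend v s = extendL K v + s • Pi.single (Fin.last K) 1 := by
  ext j
  refine Fin.lastCases ?_ (fun i => ?_) j
  · simp [extendL]
  · simp [extendL, Fin.castSucc_ne_last]

theorem extendL_apply (v : Fin K → ℂ) : extendL K v = extend v 0 := by
  rw [extendL_add_single]; simp

theorem single_last_eq : (Pi.single (Fin.last K) 1 : Fin (K + 1) → ℂ) = extend 0 1 := by
  rw [extendL_add_single]; simp

theorem proj_eq_image {k : ℕ} (h : k ≤ n) (Ω : Set (Fin n → ℂ)) : proj k Ω = restrictL h '' Ω := by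
  ext v
  constructor
  · rintro ⟨w, hw, hv⟩
    exact ⟨w, hw, by ext i; rw [restrictL_apply, hv i (Fin.castLE h i) rfl]⟩
  · rintro ⟨w, hw, rfl⟩
    refine ⟨w, hw, fun i j hij => ?_⟩
    rw [restrictL_apply]
    congr 1
    exact Fin.ext hij

theorem isOpen_proj {k : ℕ} (h : k ≤ n) {Ω : Set (Fin n → ℂ)} (hΩ : IsOpen Ω) :
    IsOpen (proj k Ω) := by
  rw [proj_eq_image h]
  exact (restrictL h).isOpenMap (restrictL_surjective h) _ hΩ

theorem isConnected_proj {k : ℕ} (h : k ≤ n) {Ω : Set (Fin n → ℂ)} (hΩ : IsConnected Ω) :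
    IsConnected (proj k Ω) := by
  rw [proj_eq_image h]
  exact hΩ.image _ (restrictL h).continuous.continuousOn

theorem proj_self (Ω : Set (Fin n → ℂ)) : proj n Ω = Ω := by
  rw [proj_eq_image le_rfl]
  have : ⇑(restrictL (le_refl n)) = id := by
    funext w; ext i; rfl
  rw [this, Set.image_id]

/-! ### The functions `u_m` -/

theorem differentiable_uVal {k : ℕ} (m : ℕ) : Differentiable ℂ fun w : Fin k → ℂ => uVal w m := by
  unfold uVal
  fun_prop

theorem uVal_eq {k : ℕ} (w : Fin k → ℂ) (m : ℕ) :
    uVal w m = ∑ l : Fin k with l.val < m, Complex.exp (∑ j : Fin k with j ≤ l, w j) := by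
  simp only [uVal, Complex.exp_sum]

theorem uVal_restrict {k l m : ℕ} (h : k ≤ l) (hm : m ≤ k) (w : Fin l → ℂ) :
    uVal (restrictL h w) m = uVal w m := by
  rw [uVal, uVal]
  have e : (Finset.univ.filter fun i : Fin l => i.val < m) =
      (Finset.univ.filter fun i : Fin k => i.val < m).map (Fin.castLEEmb h) := by
    ext i
    simp only [Finset.mem_filter, Finset.mem_univ, true_and, Finset.mem_map, Fin.castLEEmb_apply]
    exact ⟨fun hi => ⟨⟨i, hi.trans_le hm⟩, hi, rfl⟩, fun ⟨j, hj, e⟩ => by rw [← e]; exact hj⟩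
  rw [e, Finset.sum_map]
  refine Finset.sum_congr rfl fun i _ => ?_
  have e2 : (Finset.univ.filter fun j : Fin l => j ≤ Fin.castLEEmb h i) =
      (Finset.univ.filter fun j : Fin k => j ≤ i).map (Fin.castLEEmb h) := by
    ext j
    simp only [Finset.mem_filter, Finset.mem_univ, true_and, Finset.mem_map, Fin.castLEEmb_apply]
    constructor
    · intro hj
      have hj' : j.val ≤ i.val := hj
      exact ⟨⟨j, hj'.trans_lt i.2⟩, hj', rfl⟩
    · rintro ⟨a, ha, rfl⟩
      exact ha
  rw [e2, Finset.prod_map]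
  rfl

theorem uVal_extend {m : ℕ} (hm : m ≤ K) (v : Fin K → ℂ) (s : ℂ) :
    uVal (extend v s) m = uVal v m := by
  rw [← uVal_restrict K.le_succ hm, restrictL_extend]

theorem uVal_succ_self (w : Fin (K + 1) → ℂ) :
    uVal w (K + 1) = uVal w K + Complex.exp (∑ j, w j) := by
  rw [uVal_eq, uVal_eq]
  have e : (Finset.univ.filter fun l : Fin (K + 1) => l.val < K + 1) =
      insert (Fin.last K) (Finset.univ.filter fun l : Fin (K + 1) => l.val < K) := by
    ext i
    simp only [Finset.mem_filter, Finset.mem_univ, true_and, Finset.mem_insert, Fin.ext_iff,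
      Fin.val_last]
    omega
  rw [e, Finset.sum_insert (by simp), add_comm]
  congr 3
  ext j
  simp [Fin.le_last]

theorem uVal_extend_succ (v : Fin K → ℂ) (s : ℂ) :
    uVal (extend v s) (K + 1) = uVal v K + Complex.exp (∑ j, v j) * Complex.exp s := by
  rw [uVal_succ_self, uVal_extend le_rfl, sum_extend, Complex.exp_add]

/-- The derivative of `u_m` at `w` in the direction `h`. -/
def uDeriv {k : ℕ} (w h : Fin k → ℂ) (m : ℕ) : ℂ := fderiv ℂ (fun w' => uVal w' m) w h

theorem uDeriv_extend {m : ℕ} (hm : m ≤ K) (v h : Fin K → ℂ) (s t : ℂ) :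
    uDeriv (extend v s) (extend h t) m = uDeriv v h m := by
  have e : (fun w : Fin (K + 1) → ℂ => uVal w m) =
      (fun v : Fin K → ℂ => uVal v m) ∘ restrictL K.le_succ := by
    funext w; exact (uVal_restrict K.le_succ hm w).symm
  rw [uDeriv, e, fderiv_comp _ (differentiable_uVal m _) (restrictL K.le_succ).differentiableAt,
    ContinuousLinearMap.comp_apply, ContinuousLinearMap.fderiv, restrictL_extend, restrictL_extend,
    uDeriv]

theorem uDeriv_extend_succ (v h : Fin K → ℂ) (s t : ℂ) :
    uDeriv (extend v s) (extend h t) (K + 1) =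
      uDeriv v h K + Complex.exp (∑ j, v j) * Complex.exp s * (∑ j, h j + t) := by
  have e : (fun w : Fin (K + 1) → ℂ => uVal w (K + 1)) =
      fun w => uVal w K + Complex.exp (∑ j, w j) := funext uVal_succ_self
  have h1 : HasFDerivAt (fun w : Fin (K + 1) → ℂ => ∑ j, w j)
      (∑ j, (ContinuousLinearMap.proj j : (Fin (K + 1) → ℂ) →L[ℂ] ℂ)) (extend v s) :=
    HasFDerivAt.fun_sum fun j _ => hasFDerivAt_apply j _
  have h2 := ((differentiable_uVal K (extend v s)).hasFDerivAt.add h1.cexp).fderiv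
  rw [uDeriv, e]
  refine (congrArg (fun L : (Fin (K + 1) → ℂ) →L[ℂ] ℂ => L (extend h t)) h2).trans ?_
  rw [add_apply]
  change uDeriv (extend v s) (extend h t) K + _ = _
  rw [uDeriv_extend le_rfl, ← Complex.exp_add, ← sum_extend]
  simp [sum_extend]

theorem injOn_uDiag {Ω : Set (Fin n → ℂ)} (hd : ∀ w ∈ Ω, Function.Injective (uDiag n w)) {k : ℕ}
    (hk : k ≤ n) {w : Fin k → ℂ} (hw : w ∈ proj k Ω) {i j : Fin n} (hi : i.val < k) (hj : j.val < k)
    (hij : i ≠ j) : uDiag n w i - uDiag n w j ≠ 0 := by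
  rw [proj_eq_image hk] at hw
  obtain ⟨w', hw', rfl⟩ := hw
  rw [uDiag, uDiag, uVal_restrict hk (by omega), uVal_restrict hk (by omega)]
  exact sub_ne_zero.2 fun h => hij (hd w' hw' h)

/-! ### The equations in terms of directional derivatives -/

/-- The operator `ad_u⁻¹ ad_{u'} - τ` in the direction `h`, where `τ = ∑ h_j`. -/
def isoOp (n : ℕ) {k : ℕ} (w h : Fin k → ℂ) (Y : Mat n) : Mat n :=
  adInv (uDiag n w) ⁅Matrix.diagonal fun i : Fin n => uDeriv w h (i.val + 1), Y⁆ - (∑ j, h j) • Y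

theorem lie_diagonal_apply (d : Fin n → ℂ) (Y : Mat n) (i j : Fin n) :
    ⁅Matrix.diagonal d, Y⁆ i j = (d i - d j) * Y i j := by
  rw [Ring.lie_def, Matrix.sub_apply, Matrix.diagonal_mul, Matrix.mul_diagonal]
  ring

theorem isoOp_apply {k : ℕ} (w h : Fin k → ℂ) (Y : Mat n) (i j : Fin n) :
    isoOp n w h Y i j = (if i = j then 0 else
      (uDeriv w h (i.val + 1) - uDeriv w h (j.val + 1)) / (uDiag n w i - uDiag n w j)) * Y i j -
        (∑ j, h j) * Y i j := by
  rw [isoOp, Matrix.sub_apply, Matrix.smul_apply, smul_eq_mul, adInv, Matrix.of_apply,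
    lie_diagonal_apply]
  split_ifs <;> ring

/-- `Φ` solves the `(k,n)`-equation on `S`. -/
def IsoSol (n : ℕ) {k : ℕ} (S : Set (Fin k → ℂ)) (Φ : (Fin k → ℂ) → Mat n) : Prop :=
  ∀ w ∈ S, ∃ L : (Fin k → ℂ) →L[ℂ] Mat n, HasFDerivAt Φ L w ∧
    ∀ h, L h = ⁅isoOp n w h (delta k (Φ w)), Φ w⁆

theorem hasFDerivAt_matrix {k : ℕ} {f : (Fin k → ℂ) → Mat n} {L : (Fin k → ℂ) →L[ℂ] Mat n}
    {w : Fin k → ℂ} (hf : HasFDerivAt f L w) (a b : Fin n) :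
    HasFDerivAt (fun w => f w a b) ((Matrix.entryLinearMap ℂ ℂ a b).toContinuousLinearMap ∘L L)
      w :=
  ((Matrix.entryLinearMap ℂ ℂ a b).toContinuousLinearMap (E := Mat n)).hasFDerivAt.comp w hf

theorem hasFDerivAt_of_entries {k : ℕ} {f : (Fin k → ℂ) → Mat n} {w : Fin k → ℂ}
    (hf : ∀ a b, DifferentiableAt ℂ (fun w => f w a b) w) :
    ∃ L : (Fin k → ℂ) →L[ℂ] Mat n, HasFDerivAt f L w ∧
      ∀ h a b, L h a b = fderiv ℂ (fun w => f w a b) w h := by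
  have h1 : HasFDerivAt (E := Fin k → ℂ) (F := Fin n → Fin n → ℂ) f
      (ContinuousLinearMap.pi fun a => ContinuousLinearMap.pi fun b =>
        fderiv ℂ (fun w => f w a b) w) w :=
    hasFDerivAt_pi'' fun a => hasFDerivAt_pi'' fun b => (hf a b).hasFDerivAt
  exact ⟨_, h1, fun h a b => rfl⟩

theorem adInv_smul (u : Fin n → ℂ) (c : ℂ) (A : Mat n) : adInv u (c • A) = c • adInv u A := by
  ext i j
  simp only [adInv, Matrix.of_apply, Matrix.smul_apply, smul_eq_mul]
  split_ifs <;> ring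

theorem lie_smul_left (c : ℂ) (X Y : Mat n) : ⁅c • X, Y⁆ = c • ⁅X, Y⁆ := by
  simp only [Ring.lie_def, smul_mul_assoc, mul_smul_comm, smul_sub]

theorem duMat_eq {k : ℕ} (j : Fin k) (w : Fin k → ℂ) :
    duMat n j w = Complex.exp (-(w j)) •
      Matrix.diagonal fun i : Fin n => uDeriv w (Pi.single j 1) (i.val + 1) := by
  rw [duMat, ← Matrix.diagonal_smul]
  rfl

theorem isoOp_single {k : ℕ} (j : Fin k) (w : Fin k → ℂ) (Y : Mat n) :
    adInv (uDiag n w) ⁅duMat n j w, Y⁆ - (Complex.exp (w j))⁻¹ • Y =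
      Complex.exp (-(w j)) • isoOp n w (Pi.single j 1) Y := by
  rw [duMat_eq, lie_smul_left, adInv_smul, isoOp, smul_sub, Finset.sum_pi_single', ← Complex.exp_neg]
  simp

/-- `isoOp` as a linear map in the direction. -/
def isoOpL (n : ℕ) {k : ℕ} (w : Fin k → ℂ) (Y : Mat n) : (Fin k → ℂ) →ₗ[ℂ] Mat n where
  toFun h := isoOp n w h Y
  map_add' h h' := by
    ext i j
    simp only [isoOp_apply, Matrix.add_apply, uDeriv, map_add, Pi.add_apply,
      Finset.sum_add_distrib]
    split_ifs <;> ring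
  map_smul' c h := by
    ext i j
    simp only [isoOp_apply, Matrix.smul_apply, uDeriv, map_smul, Pi.smul_apply, smul_eq_mul,
      ← Finset.mul_sum, RingHom.id_apply]
    split_ifs <;> ring

theorem IsoSol.isDegenerateSolution {k : ℕ} {S : Set (Fin k → ℂ)} {Φ : (Fin k → ℂ) → Mat n}
    (h : IsoSol n S Φ) : IsDegenerateSolution k S Φ where
  holomorphic a b w hw := by
    obtain ⟨L, hL, -⟩ := h w hw
    exact (hasFDerivAt_matrix hL a b).differentiableAt.differentiableWithinAt
  equation w hw j a b := by
    obtain ⟨L, hL, e⟩ := h w hw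
    rw [dz, (hasFDerivAt_matrix hL a b).fderiv, isoOp_single, lie_smul_left, ← e]
    rfl

theorem IsDegenerateSolution.isoSol {k : ℕ} {S : Set (Fin k → ℂ)} (hS : IsOpen S)
    {Φ : (Fin k → ℂ) → Mat n} (h : IsDegenerateSolution k S Φ) : IsoSol n S Φ := by
  intro w hw
  obtain ⟨L, hL, e⟩ := hasFDerivAt_of_entries (f := Φ) (w := w) fun a b =>
    (h.holomorphic a b w hw).differentiableAt (hS.mem_nhds hw)
  refine ⟨L, hL, ?_⟩
  let M : (Fin k → ℂ) →ₗ[ℂ] Mat n :=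
    { toFun := fun d => ⁅isoOpL n w (delta k (Φ w)) d, Φ w⁆
      map_add' := fun d d' => by simp only [map_add, Ring.lie_def]; noncomm_ring
      map_smul' := fun c d => by rw [map_smul, lie_smul_left, RingHom.id_apply] }
  have key : (L : (Fin k → ℂ) →ₗ[ℂ] Mat n) = M := by
    refine (Pi.basisFun ℂ (Fin k)).ext fun j => ?_
    rw [Pi.basisFun_apply]
    ext a b
    have h1 := h.equation w hw j a b
    rw [isoOp_single, lie_smul_left, dz, ← e, Matrix.smul_apply, smul_eq_mul] at h1
    exact mul_left_cancel₀ (Complex.exp_ne_zero _) h1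
  intro d
  exact LinearMap.congr_fun key d

/-- At the top level δ_n is the identity, and the extra term z_j⁻¹ Φ commutes with Φ. -/
theorem IsIsomonodromySolution.isDegenerateSolution {Ω : Set (Fin n → ℂ)}
    {Φ : (Fin n → ℂ) → Mat n} (h : IsIsomonodromySolution Ω Φ) : IsDegenerateSolution n Ω Φ where
  holomorphic := h.holomorphic
  equation w hw j a b := by
    rw [h.equation w hw j a b, delta_top]
    have e : ∀ (X Y : Mat n) (c : ℂ), ⁅X - c • Y, Y⁆ = ⁅X, Y⁆ := fun X Y c => by
      simp only [Ring.lie_def, sub_mul, mul_sub, smul_mul_assoc, mul_smul_comm, sub_sub_sub_cancel_right]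
    rw [e]

/-! ### The equations near the boundary -/

theorem UMat_mul (v : Fin K → ℂ) {i : Fin n} (hi : i.val < K) :
    Complex.exp (∑ j, v j) * UMat n v i i = uVal v K - uVal v (i.val + 1) := by
  rw [UMat, Matrix.diagonal_apply_eq, if_pos hi, ← Complex.exp_sum, mul_div_assoc',
    mul_div_cancel_left₀ _ (Complex.exp_ne_zero _)]

theorem uDiag_extend_of_lt {i : Fin n} (hi : i.val < K) (v : Fin K → ℂ) (s : ℂ) :
    uDiag n (extend v s) i = uDiag n v i := uVal_extend hi v s

theorem uDiag_extend_sub {i j : Fin n} (hi : i.val = K) (hj : j.val < K) (v : Fin K → ℂ) (s : ℂ) :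
    uDiag n (extend v s) i - uDiag n (extend v s) j =
      Complex.exp (∑ j, v j) * (Complex.exp s + UMat n v j j) := by
  rw [uDiag_extend_of_lt hj, uDiag, hi, uVal_extend_succ, mul_add, UMat_mul v hj, uDiag]
  ring

theorem deltaDiff_entry_left {Φ : Mat n} {i j : Fin n} (hi : i.val < K) (hj : j.val = K) :
    deltaDiff K Φ i j = Φ i j := by
  rw [deltaDiff_apply, if_pos (Or.inl ⟨hi, hj⟩)]

theorem deltaDiff_entry_right {Φ : Mat n} {i j : Fin n} (hi : i.val = K) (hj : j.val < K) :
    deltaDiff K Φ i j = Φ i j := by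
  rw [deltaDiff_apply, if_pos (Or.inr ⟨hi, hj⟩)]

/-- Decomposition of the operator of the `(k+1)`-st equation. -/
theorem isoOp_extend_eq {v h : Fin K → ℂ} {s t : ℂ} {Φ B : Mat n} {ω : Fin n → ℂ}
    (hω0 : ∀ i : Fin n, ¬ i.val < K → ω i = 0) (hB : B ∈ deltaAlg n K)
    (hBe : ∀ i j : Fin n, (i.val < K ∧ j.val < K) ∨ i = j → B i j = (if i = j then 0 else
      (uDeriv v h (i.val + 1) - uDeriv v h (j.val + 1)) / (uDiag n v i - uDiag n v j)) * Φ i j -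
        (∑ j, h j + t) * Φ i j)
    (hω : ∀ i j : Fin n, i.val < K → j.val = K →
      (uDeriv (extend v s) (extend h t) (j.val + 1) - uDeriv (extend v s) (extend h t) (i.val + 1)) /
        (uDiag n (extend v s) j - uDiag n (extend v s) i) - (∑ j, h j + t) = ω i) :
    isoOp n (extend v s) (extend h t) (delta (K + 1) Φ) =
      B + (Matrix.diagonal ω * deltaDiff K Φ + deltaDiff K Φ * Matrix.diagonal ω) := by
  ext i j
  rw [isoOp_apply, Matrix.add_apply, Matrix.add_apply, Matrix.diagonal_mul, Matrix.mul_diagonal,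
    sum_extend, delta_apply, ← mem_deltaAlg.1 hB, delta_apply]
  by_cases hij : i = j
  · subst hij
    rw [if_pos rfl, if_pos (Or.inr rfl), if_pos (Or.inr rfl), hBe i i (Or.inr rfl), if_pos rfl,
      deltaDiff_apply, if_neg (by omega)]
    ring
  rw [if_neg hij]
  rcases lt_trichotomy i.val K with hi | hi | hi
  · rcases lt_trichotomy j.val K with hj | hj | hj
    · rw [if_pos (Or.inl ⟨by omega, by omega⟩), if_pos (Or.inl ⟨hi, hj⟩), hBe i j (Or.inl ⟨hi, hj⟩),
        if_neg hij, deltaDiff_apply, if_neg (by omega), uDeriv_extend hi, uDeriv_extend hj,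
        uDiag_extend_of_lt hi, uDiag_extend_of_lt hj]
      ring
    · rw [if_pos (Or.inl ⟨by omega, by omega⟩), if_neg (by omega), deltaDiff_entry_left hi hj,
        hω0 j (by omega), ← hω i j hi hj, ← neg_sub (uDeriv _ _ (j.val + 1)),
        ← neg_sub (uDiag n (extend v s) j), neg_div_neg_eq]
      ring
    · rw [if_neg (by omega), if_neg (by omega), deltaDiff_apply, if_neg (by omega)]
      ring
  · rcases lt_trichotomy j.val K with hj | hj | hj
    · rw [if_pos (Or.inl ⟨by omega, by omega⟩), if_neg (by omega), deltaDiff_entry_right hi hj,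
        hω0 i (by omega), ← hω j i hj hi]
      ring
    · exact absurd (Fin.ext (hi.trans hj.symm)) hij
    · rw [if_neg (by omega), if_neg (by omega), deltaDiff_apply, if_neg (by omega)]
      ring
  · rw [if_neg (by omega), if_neg (by omega), deltaDiff_apply, if_neg (by omega)]
    ring

/-- The points of the domain avoid the zeros of `z + U`. -/
def OffDiag (n : ℕ) (v : Fin K → ℂ) (s : ℂ) : Prop :=
  ∀ i : Fin n, i.val < K → Complex.exp s + UMat n v i i ≠ 0

theorem uDeriv_zero {k : ℕ} (w : Fin k → ℂ) (m : ℕ) : uDeriv w 0 m = 0 := map_zero _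

/-- In the direction of ln z only u_{K+1} moves. The coupling entries are multiplied by z/(z + U_i)
- 1 = -U_i/(z + U_i), and on the block only the term -τ with τ = 1 is left. -/
theorem isoOp_extend_radial {v : Fin K → ℂ} {s : ℂ} (ho : OffDiag n v s) (Φ : Mat n) :
    isoOp n (extend v s) (extend 0 1) (delta (K + 1) Φ) =
      -delta K Φ + (pert n v s * deltaDiff K Φ + deltaDiff K Φ * pert n v s) := by
  refine isoOp_extend_eq (fun i hi => by rw [UMat_apply_of_not_lt v hi]; simp)
    (Subalgebra.neg_mem _ (delta_mem K Φ)) (fun i j hij => ?_) fun i j hi hj => ?_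
  · rw [Matrix.neg_apply, delta_apply, if_pos hij, uDeriv_zero, uDeriv_zero]
    simp
  · rw [uDiag_extend_sub hj hi, uDeriv_extend hi, hj, uDeriv_extend_succ, uDeriv_zero, uDeriv_zero]
    have h1 := Complex.exp_ne_zero (∑ j, v j)
    have h2 := ho i hi
    simp only [Pi.zero_apply, Finset.sum_const_zero, zero_add, mul_one, sub_zero]
    rw [mul_div_mul_left _ _ h1]
    field_simp
    ring

/-- The tangential perturbation coefficients. -/
def pertDir (n : ℕ) (v h : Fin K → ℂ) : Mat n :=
  Matrix.diagonal fun i => if i.val < K then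
    (uDeriv v h K - uDeriv v h (i.val + 1)) / Complex.exp (∑ j, v j) -
      (∑ j, h j) * UMat n v i i else 0

/-- The inverse `(z + U)⁻¹` on the head. -/
def shiftInv (n : ℕ) (v : Fin K → ℂ) (s : ℂ) : Mat n :=
  Matrix.diagonal fun i => if i.val < K then (Complex.exp s + UMat n v i i)⁻¹ else 0

theorem isoOp_mem {k l : ℕ} (w h : Fin k → ℂ) {Y : Mat n} (hY : Y ∈ deltaAlg n l) :
    isoOp n w h Y ∈ deltaAlg n l := by
  rw [mem_deltaAlg]
  ext i j
  rw [delta_apply]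
  split_ifs with hij
  · rfl
  · rw [isoOp_apply, ← mem_deltaAlg.1 hY, delta_apply, if_neg hij]
    simp

/-- Subtracting τ removes the leading part of the ratio of the u-differences on the coupling
entries. What remains carries (z + U)⁻¹ and is therefore a small head matrix. -/
theorem isoOp_extend_tangential {v h : Fin K → ℂ} {s : ℂ} (ho : OffDiag n v s) (Φ : Mat n) :
    isoOp n (extend v s) (extend h 0) (delta (K + 1) Φ) = isoOp n v h (delta K Φ) +
      ((pertDir n v h * shiftInv n v s) * deltaDiff K Φ +
        deltaDiff K Φ * (pertDir n v h * shiftInv n v s)) := by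
  rw [pertDir, shiftInv, Matrix.diagonal_mul_diagonal]
  refine isoOp_extend_eq (fun i hi => by rw [if_neg hi, zero_mul]) (isoOp_mem _ _ (delta_mem K Φ))
    (fun i j hij => ?_) fun i j hi hj => ?_
  · rw [isoOp_apply, delta_apply, if_pos hij, add_zero]
  · rw [uDiag_extend_sub hj hi, uDeriv_extend hi, hj, uDeriv_extend_succ, if_pos hi, if_pos hi,
      add_zero]
    have h1 := Complex.exp_ne_zero (∑ j, v j)
    have h2 := ho i hi
    field_simp
    ring

theorem offDiag_of_mem {Ω : Set (Fin n → ℂ)} (hd : ∀ w ∈ Ω, Function.Injective (uDiag n w))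
    (hK : K < n) {v : Fin K → ℂ} {s : ℂ} (hvs : extend v s ∈ proj (K + 1) Ω) : OffDiag n v s := by
  intro i hi h0
  have h1 := injOn_uDiag hd (Nat.succ_le_of_lt hK) hvs (i := ⟨K, hK⟩) (j := i)
    (Nat.lt_succ_self K) (by omega) (by intro e; rw [← e] at hi; exact lt_irrefl _ hi)
  have h2 := uDiag_extend_sub (n := n) (i := ⟨K, hK⟩) (j := i) rfl hi v s
  exact h1 (h2.trans (by rw [h0, mul_zero]))

end

/-! ### The sector filter, exchange of limit and derivative, and conjugation-equivariant functions.
-/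

section



variable {n : ℕ} {K : ℕ}

/-! ### The sector filter -/

theorem hasBasis_sector (a b : ℝ) :
    (sector a b).HasBasis (fun _ : ℝ => True) fun R => {s | R ≤ s.re ∧ s.im ∈ Set.Icc a b} := by
  have h := (atTop_basis (α := ℝ)).comap Complex.re |>.inf_principal {s : ℂ | s.im ∈ Set.Icc a b}
  exact h

theorem sector_neBot {a b : ℝ} (h : a ≤ b) : (sector a b).NeBot := by
  rw [(hasBasis_sector a b).neBot_iff]
  intro R _
  exact ⟨⟨R, a⟩, le_rfl, le_rfl, h⟩

theorem eventually_im_sector (a b : ℝ) : ∀ᶠ s in sector a b, s.im ∈ Set.Icc a b :=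
  (hasBasis_sector a b).eventually_iff.2 ⟨0, trivial, fun _ hs => hs.2⟩

theorem tendsto_re_sector (a b : ℝ) : Tendsto Complex.re (sector a b) atTop :=
  tendsto_comap.mono_left inf_le_left

theorem eventually_shift_sector {a b : ℝ} {P : ℂ → Prop} (h : ∀ᶠ s in sector a b, P s) :
    ∀ᶠ s in sector a b, ∀ t : ℝ, 0 ≤ t → P (s + t) := by
  obtain ⟨R, -, hR⟩ := (hasBasis_sector a b).eventually_iff.1 h
  refine (hasBasis_sector a b).eventually_iff.2 ⟨R, trivial, fun s hs t ht => hR ⟨?_, ?_⟩⟩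
  · simp; linarith [hs.1]
  · simpa using hs.2

theorem eventually_shift {E : Type*} {l : Filter E} {a b : ℝ} {P : E × ℂ → Prop}
    (h : ∀ᶠ p in l ×ˢ sector a b, P p) :
    ∀ᶠ p in l ×ˢ sector a b, ∀ t : ℝ, 0 ≤ t → P (p.1, p.2 + t) := by
  obtain ⟨pa, ha, pb, hb, hab⟩ := eventually_prod_iff.1 h
  exact eventually_prod_iff.2 ⟨pa, ha, _, eventually_shift_sector hb,
    fun hx _ hy t ht => hab hx (hy t ht)⟩

theorem tendsto_ray_sector {a b : ℝ} {s : ℂ} (hs : s.im ∈ Set.Icc a b) :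
    Tendsto (fun t : ℝ => s + t) atTop (sector a b) := by
  refine tendsto_inf.2 ⟨tendsto_comap_iff.2 ?_, tendsto_principal.2 (Eventually.of_forall fun t => ?_)⟩
  · refine (tendsto_atTop_add_const_left atTop s.re tendsto_id).congr fun t => ?_
    simp
  · simpa using hs

theorem tendsto_zero_of_norm_le_exp {E F : Type*} [NormedAddCommGroup F] {l : Filter E} {a b : ℝ}
    {f : E × ℂ → F} {B η : ℝ} (hη : 0 < η)
    (h : ∀ᶠ p in l ×ˢ sector a b, ‖f p‖ ≤ B * Real.exp (-η * p.2.re)) :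
    Tendsto f (l ×ˢ sector a b) (𝓝 0) := by
  refine squeeze_zero_norm' h ?_
  exact (tendsto_mul_exp_neg hη B).comp ((tendsto_re_sector a b).comp tendsto_snd)

/-- Interchange of limit and derivative, with the limit of the derivatives taken jointly. -/
theorem hasFDerivAt_of_tendsto_joint {F : Type*} [NormedAddCommGroup F] [NormedSpace ℂ F]
    {l : Filter ℂ} [l.NeBot] {f : ℂ → (Fin K → ℂ) → F}
    {f' : ℂ → (Fin K → ℂ) → (Fin K → ℂ) → F} {g : (Fin K → ℂ) → F} {x : Fin K → ℂ}
    {D : (Fin K → ℂ) → F}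
    (hf : ∀ᶠ p in 𝓝 x ×ˢ l, ∃ L : (Fin K → ℂ) →L[ℂ] F, HasFDerivAt (f p.2) L p.1 ∧
      ∀ h, L h = f' p.2 p.1 h)
    (hf' : ∀ h, Tendsto (fun p : (Fin K → ℂ) × ℂ => f' p.2 p.1 h) (𝓝 x ×ˢ l) (𝓝 (D h)))
    (hfg : ∀ᶠ y in 𝓝 x, Tendsto (fun s => f s y) l (𝓝 (g y))) :
    ∃ L : (Fin K → ℂ) →L[ℂ] F, HasFDerivAt g L x ∧ ∀ h, L h = D h := by
  -- Rebuilds a linear map from its values on the standard basis, so that convergence in each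
  -- direction upgrades to convergence of operators.
  let B : ((Fin K → ℂ) → F) → ((Fin K → ℂ) →L[ℂ] F) := fun φ =>
    ∑ j, (ContinuousLinearMap.proj (R := ℂ) (φ := fun _ : Fin K => ℂ) j).smulRight
      (φ (Pi.single j 1))
  have hB : ∀ L : (Fin K → ℂ) →L[ℂ] F, B L = L := by
    intro L
    ext h : 1
    have : h = ∑ j, h j • (Pi.single j 1 : Fin K → ℂ) := by
      ext i; simp [Finset.sum_apply, Pi.single_apply]
    conv_rhs => rw [this, map_sum]
    simp only [B, sum_apply, ContinuousLinearMap.smulRight_apply, map_smul]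
    rfl
  have hev : ∀ᶠ p in 𝓝 x ×ˢ l, HasFDerivAt (f p.2) (B (f' p.2 p.1)) p.1 ∧
      ∀ h, B (f' p.2 p.1) h = f' p.2 p.1 h := by
    filter_upwards [hf] with p ⟨L, hL, e⟩
    have : B (f' p.2 p.1) = L := by
      rw [← hB L]
      simp only [B, e]
    rw [this]
    exact ⟨hL, e⟩
  have hlim : Tendsto (fun p : (Fin K → ℂ) × ℂ => B (f' p.2 p.1)) (𝓝 x ×ˢ l) (𝓝 (B D)) := by
    refine tendsto_finsetSum _ fun j _ => ?_
    exact ((ContinuousLinearMap.smulRightL ℂ (Fin K → ℂ) (F)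
      (ContinuousLinearMap.proj (R := ℂ) (φ := fun _ : Fin K => ℂ) j)).continuous.tendsto _).comp
      (hf' (Pi.single j 1))
  have hsw : Tendsto Prod.swap (l ×ˢ 𝓝 x) (𝓝 x ×ˢ l) := by
    rw [prod_comm]; exact tendsto_map
  refine ⟨B D, ?_, fun h => ?_⟩
  · refine hasFDerivAt_of_tendstoUniformlyOnFilter (l := l) (f := f)
      (f' := fun s v => B (f' s v)) (g' := fun _ => B D) ?_ ?_ hfg
    · rw [tendstoUniformlyOnFilter_iff_tendsto]
      exact Uniform.tendsto_nhds_right.1 (hlim.comp hsw)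
    · have := hsw.eventually hev
      exact this.mono fun p hp => hp.1
  · have h1 : Tendsto (fun p : (Fin K → ℂ) × ℂ => B (f' p.2 p.1) h) (𝓝 x ×ˢ l) (𝓝 (B D h)) :=
      ((ContinuousLinearMap.apply ℂ (F) h).continuous.tendsto _).comp hlim
    exact tendsto_nhds_unique (h1.congr' (hev.mono fun p hp => hp.2 h)) (hf' h)

/-! ### Equivariant functions -/

/-- The derivative of a conjugation-equivariant function along a commutator. -/
theorem fderiv_lie_of_equivariant {F : Type*} [NormedAddCommGroup F] [NormedSpace ℂ F]
    {f : Mat n → F} {f' : Mat n →L[ℂ] F} {B A : Mat n} (hf : HasFDerivAt f f' A) {y : F}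
    (h : HasDerivAt (fun t : ℂ => f (adPow t B A)) y 0) : f' ⁅B, A⁆ = y := by
  have h0 : adPow 0 B A = A := by simp
  have h1 : HasDerivAt (fun t : ℂ => adPow t B A) ⁅B, A⁆ 0 := by
    have := hasDerivAt_adPow (X := B) (hasDerivAt_const (0 : ℂ) A)
    rw [h0, adPow_zero_right, add_zero] at this
    exact this
  have h2 : HasFDerivAt f f' (adPow 0 B A) := by rw [h0]; exact hf
  exact (h2.comp_hasDerivAt (0 : ℂ) h1).unique h

theorem exp_adPow (t : ℂ) (B A : Mat n) :
    NormedSpace.exp (adPow t B A) = adPow t B (NormedSpace.exp A) := by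
  have hu : IsUnit (NormedSpace.exp (t • B)) :=
    ⟨⟨_, _, exp_smul_mul_exp_neg t B, exp_neg_mul_exp_smul t B⟩, rfl⟩
  have hinv : NormedSpace.exp (-(t • B)) = (NormedSpace.exp (t • B))⁻¹ :=
    (Matrix.inv_eq_right_inv (exp_smul_mul_exp_neg t B)).symm
  rw [adPow, adPow, hinv]
  exact Matrix.exp_conj _ _ hu

theorem differentiableAt_exp (A : Mat n) : DifferentiableAt ℂ (NormedSpace.exp : Mat n → Mat n) A :=
  (NormedSpace.exp_analytic (𝕂 := ℂ) A).differentiableAt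

theorem hasDerivAt_adPow_zero (B Y : Mat n) : HasDerivAt (fun t : ℂ => adPow t B Y) ⁅B, Y⁆ 0 := by
  have := hasDerivAt_adPow (X := B) (hasDerivAt_const (0 : ℂ) Y)
  rw [adPow_zero_right, add_zero] at this
  simpa using this

/-- The exponential is conjugation-equivariant, so along a commutator its derivative is explicit; no
general formula for the derivative of the matrix exponential is required. -/
theorem fderiv_exp_lie (B A : Mat n) :
    fderiv ℂ (NormedSpace.exp : Mat n → Mat n) A ⁅B, A⁆ = ⁅B, NormedSpace.exp A⁆ := by
  refine fderiv_lie_of_equivariant (differentiableAt_exp A).hasFDerivAt ?_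
  simp only [exp_adPow]
  exact hasDerivAt_adPow_zero B _

end

/-! ### One level of the chain: setting and uniform control near a base point. -/

section



variable {n : ℕ} {K : ℕ}

/-! ### Passing from level `K + 1` to level `K` -/

/-- The solution in the gauge given by the limit. -/
def gaugeFun (Φ : (Fin (K + 1) → ℂ) → Mat n) (Ψ : (Fin K → ℂ) → Mat n) (v : Fin K → ℂ) (s : ℂ) :
    Mat n :=
  adPow s (delta K (Ψ v)) (Φ (extend v s))

theorem gaugeFun_neg (Φ : (Fin (K + 1) → ℂ) → Mat n) (Ψ : (Fin K → ℂ) → Mat n) (v : Fin K → ℂ)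
    (s : ℂ) : adPow (-s) (delta K (Ψ v)) (gaugeFun Φ Ψ v s) = Φ (extend v s) :=
  adPow_neg_adPow _ _ _

theorem delta_gaugeFun_sub (Φ : (Fin (K + 1) → ℂ) → Mat n) (Ψ : (Fin K → ℂ) → Mat n)
    (v : Fin K → ℂ) (s : ℂ) :
    adPow (-s) (delta K (Ψ v)) (delta K (gaugeFun Φ Ψ v s) - delta K (Ψ v)) =
      delta K (Φ (extend v s)) - delta K (Ψ v) := by
  rw [adPow_sub_right, adPow_self, ← delta_adPow (delta_mem K _), gaugeFun_neg]

/-- A solution `Φ` of the `(K+1)`-st equation with boundary value `Ψ`. -/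
structure Level (n K : ℕ) (a b : ℝ) (S : Set (Fin K → ℂ)) (S' : Set (Fin (K + 1) → ℂ))
    (Φ : (Fin (K + 1) → ℂ) → Mat n) (Ψ : (Fin K → ℂ) → Mat n) : Prop where
  le : a ≤ b
  isOpen : IsOpen S
  sol : IsoSol n S' Φ
  offDiag : ∀ v s, extend v s ∈ S' → OffDiag n v s
  distinct : ∀ v ∈ S, ∀ i j : Fin n, i.val < K → j.val < K → i ≠ j →
    uDiag n v i - uDiag n v j ≠ 0
  mem : ∀ v ∈ S, ∀ᶠ p in 𝓝 v ×ˢ sector a b, extend p.1 p.2 ∈ S'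
  lim_block : ∀ v ∈ S, Tendsto (fun p : (Fin K → ℂ) × ℂ => delta K (Φ (extend p.1 p.2)))
    (𝓝 v ×ˢ sector a b) (𝓝 (delta K (Ψ v)))
  lim : ∀ v ∈ S, Tendsto (fun p : (Fin K → ℂ) × ℂ => gaugeFun Φ Ψ p.1 p.2)
    (𝓝 v ×ˢ sector a b) (𝓝 (Ψ v))
  cont : ContinuousOn Ψ S

theorem hasDerivAt_extend (v : Fin K → ℂ) (s : ℂ) : HasDerivAt (extend v) (extend 0 1) s := by
  have h := ((hasDerivAt_id s).smul_const (Pi.single (Fin.last K) 1 : Fin (K + 1) → ℂ)).const_add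
    (extendL K v)
  rw [one_smul, single_last_eq] at h
  refine h.congr_of_eventuallyEq (Eventually.of_forall fun s => ?_)
  rw [extendL_add_single, single_last_eq]
  rfl

theorem hasFDerivAt_extend (v : Fin K → ℂ) (s : ℂ) :
    HasFDerivAt (fun v => extend v s) (extendL K) v := by
  have h := (extendL K).hasFDerivAt.add_const (x := v) (s • (Pi.single (Fin.last K) 1))
  refine h.congr_of_eventuallyEq (Eventually.of_forall fun v => ?_)
  exact extendL_add_single v s

theorem IsoSol.hasDerivAt_gaugeFun {S' : Set (Fin (K + 1) → ℂ)} {Φ : (Fin (K + 1) → ℂ) → Mat n}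
    (h : IsoSol n S' Φ) (Ψ : (Fin K → ℂ) → Mat n) {v : Fin K → ℂ} {s : ℂ} (hm : extend v s ∈ S')
    (ho : OffDiag n v s) :
    HasDerivAt (gaugeFun Φ Ψ v)
      (gaugeRHS K (delta K (Ψ v)) (pert n v s) s (gaugeFun Φ Ψ v s)) s := by
  obtain ⟨L, hL, e⟩ := h _ hm
  have h1 := hL.comp_hasDerivAt s (hasDerivAt_extend v s)
  have h2 := hasDerivAt_adPow (X := delta K (Ψ v)) h1
  refine h2.congr_deriv ?_
  have e1 : L (extend 0 1) = ⁅-delta K (Φ (extend v s)) + (pert n v s *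
      deltaDiff K (Φ (extend v s)) + deltaDiff K (Φ (extend v s)) * pert n v s),
      Φ (extend v s)⁆ := by
    rw [e, isoOp_extend_radial ho]
  have hA := delta_mem K (Ψ v)
  have e2 : adPow s (delta K (Ψ v)) (L (extend 0 1)) = ⁅-delta K (gaugeFun Φ Ψ v s) +
      (adPow s (delta K (Ψ v)) (pert n v s) * deltaDiff K (gaugeFun Φ Ψ v s) +
        deltaDiff K (gaugeFun Φ Ψ v s) * adPow s (delta K (Ψ v)) (pert n v s)),
      gaugeFun Φ Ψ v s⁆ := by
    rw [e1, adPow_lie, adPow_add_right, adPow_add_right, adPow_mul, adPow_mul, gaugeFun,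
      delta_adPow hA, deltaDiff_adPow hA]
    congr 2
    exact map_neg (adPowL s (delta K (Ψ v))) _
  refine (congrArg (fun z => ⁅delta K (Ψ v), gaugeFun Φ Ψ v s⁆ + z) e2).trans ?_
  rw [gaugeRHS]
  simp only [Ring.lie_def]
  noncomm_ring

/-- Quantitative control at the point `(v, s)`. -/
structure Control (Φ : (Fin (K + 1) → ℂ) → Mat n) (Ψ : (Fin K → ℂ) → Mat n) (T C σ u R M : ℝ)
    (v : Fin K → ℂ) (s : ℂ) : Prop where
  conj : ConjBound K (delta K (Ψ v)) T C σ
  norm_U : ‖UMat n v‖ ≤ u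
  R_nonneg : 0 ≤ R
  u_le : u * Real.exp (-R) ≤ 1 / 2
  re : R ≤ s.re
  im : |s.im| ≤ T
  sol : GaugeSol K (delta K (Ψ v)) (pert n v) (gaugeFun Φ Ψ v) (Ψ v) M s

theorem continuous_UMat : Continuous fun v : Fin K → ℂ => UMat n v := by
  unfold UMat
  refine Continuous.matrix_diagonal (continuous_pi fun i => ?_)
  by_cases hi : i.val < K
  · simp only [if_pos hi]
    refine ((differentiable_uVal K).continuous.sub (differentiable_uVal _).continuous).div
      (by fun_prop) fun v => ?_
    exact Finset.prod_ne_zero_iff.2 fun j _ => Complex.exp_ne_zero _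
  · simp only [if_neg hi]
    exact continuous_const

theorem tendsto_along_ray {E F : Type*} [TopologicalSpace E] {l : Filter F} {a b : ℝ}
    {f : E → ℂ → F} {v : E} (h : Tendsto (fun p : E × ℂ => f p.1 p.2) (𝓝 v ×ˢ sector a b) l) {s : ℂ}
    (hs : s.im ∈ Set.Icc a b) : Tendsto (fun t : ℝ => f v (s + t)) atTop l :=
  h.comp (tendsto_const_nhds.prodMk (tendsto_ray_sector hs))

/-- All constants depend only on the centre v₀. This uniformity in v is what allows derivatives in v
to be passed to the limit. -/
theorem Level.eventually_control {a b : ℝ} {S : Set (Fin K → ℂ)} {S' : Set (Fin (K + 1) → ℂ)}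
    {Φ : (Fin (K + 1) → ℂ) → Mat n} {Ψ : (Fin K → ℂ) → Mat n} (h : Level n K a b S S' Φ Ψ)
    (hK : K ≤ n) {v₀ : Fin K → ℂ} (hv : v₀ ∈ S) (hgap : BlockGap hK (delta K (Ψ v₀))) :
    ∃ C σ u R M : ℝ, 0 < C ∧ 0 ≤ σ ∧ σ < 1 ∧ 0 ≤ u ∧ 0 ≤ M ∧ ∀ᶠ p in 𝓝 v₀ ×ˢ sector a b,
      p.1 ∈ S ∧ extend p.1 p.2 ∈ S' ∧ Control Φ Ψ (max |a| |b|) C σ u R M p.1 p.2 := by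
  obtain ⟨σ, C, hσ0, hσ1, hC, hev⟩ := exists_headBound hK (delta_mem K (Ψ v₀)) hgap (max |a| |b|)
  have hcA : ContinuousAt Ψ v₀ := h.cont.continuousAt (h.isOpen.mem_nhds hv)
  have hA : Tendsto (fun v => delta K (Ψ v)) (𝓝 v₀) (𝓝 (delta K (Ψ v₀))) :=
    ((deltaL K).continuous.tendsto _).comp hcA
  have hbd : ∀ᶠ v in 𝓝 v₀, ConjBound K (delta K (Ψ v)) (max |a| |b|) C σ :=
    (hA.eventually hev).mono fun v hv => ⟨delta_mem K _, hv (delta_mem K _), hC, hσ0, hσ1⟩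
  set u := ‖UMat n v₀‖ + 1 with hu
  have hU : ∀ᶠ v in 𝓝 v₀, ‖UMat n v‖ ≤ u :=
    ((continuous_UMat (n := n) (K := K)).norm.tendsto v₀).eventually_le_const (by linarith)
  obtain ⟨R, hR0, hR⟩ : ∃ R : ℝ, 0 ≤ R ∧ u * Real.exp (-R) ≤ 1 / 2 := by
    have h1 := (tendsto_mul_exp_neg one_pos u).eventually_le_const (by norm_num : (0 : ℝ) < 1 / 2)
    obtain ⟨R, h1, h2⟩ := (h1.and (eventually_ge_atTop 0)).exists
    exact ⟨R, h2, by rwa [neg_one_mul] at h1⟩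
  have hM : ∀ᶠ p in 𝓝 v₀ ×ˢ sector a b, ‖gaugeFun Φ Ψ p.1 p.2‖ ≤ ‖Ψ v₀‖ + 1 :=
    (h.lim v₀ hv).norm.eventually_le_const (by linarith)
  refine ⟨C, σ, u, R, ‖Ψ v₀‖ + 1, hC, hσ0, hσ1, by positivity, by positivity, ?_⟩
  have hfst : Tendsto Prod.fst (𝓝 v₀ ×ˢ sector a b) (𝓝 v₀) := tendsto_fst
  have hsnd : Tendsto Prod.snd (𝓝 v₀ ×ˢ sector a b) (sector a b) := tendsto_snd
  have e1 : ∀ᶠ p in 𝓝 v₀ ×ˢ sector a b, p.1 ∈ S := hfst.eventually (h.isOpen.mem_nhds hv)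
  have e2 := hfst.eventually (hbd.and hU)
  have e3 := hsnd.eventually ((eventually_im_sector a b).and
    ((tendsto_re_sector a b).eventually_ge_atTop R))
  -- The estimates integrate to infinity, so the properties are needed on the whole horizontal ray
  -- from each point.
  have e4 := eventually_shift ((h.mem v₀ hv).and hM)
  refine (e1.and (e2.and (e3.and e4))).mono ?_
  rintro p ⟨h1, ⟨h2, h3⟩, ⟨h4, h5⟩, h67⟩
  have h6 : ∀ t : ℝ, 0 ≤ t → extend p.1 (p.2 + t) ∈ S' := fun t ht => (h67 t ht).1
  have h7 : ∀ t : ℝ, 0 ≤ t → ‖gaugeFun Φ Ψ p.1 (p.2 + t)‖ ≤ ‖Ψ v₀‖ + 1 :=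
    fun t ht => (h67 t ht).2
  have hm : extend p.1 p.2 ∈ S' := by simpa using h6 0 le_rfl
  have hl := tendsto_along_ray (f := gaugeFun Φ Ψ) (h.lim p.1 h1) h4
  have hl' := tendsto_along_ray (f := fun v s => delta K (Φ (extend v s))) (h.lim_block p.1 h1) h4
  have h8 : Tendsto (fun t : ℝ => adPow (-(p.2 + t)) (delta K (Ψ p.1))
      (delta K (gaugeFun Φ Ψ p.1 (p.2 + t)) - delta K (Ψ p.1))) atTop (𝓝 0) := by
    simp only [delta_gaugeFun_sub]
    have := hl'.sub_const (delta K (Ψ p.1))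
    rwa [sub_self] at this
  have hsol : GaugeSol K (delta K (Ψ p.1)) (pert n p.1) (gaugeFun Φ Ψ p.1) (Ψ p.1)
      (‖Ψ v₀‖ + 1) p.2 :=
    { deriv := fun t ht => h.sol.hasDerivAt_gaugeFun Ψ (h6 t ht) (h.offDiag _ _ (h6 t ht))
      bound := h7
      lim := hl
      limD := h8 }
  have him : |p.2.im| ≤ max |a| |b| := abs_le_max_abs_abs h4.1 h4.2
  exact ⟨h1, hm, h2, h3, hR0, hR, h5, him, hsol⟩

section Control

variable {Φ : (Fin (K + 1) → ℂ) → Mat n} {Ψ : (Fin K → ℂ) → Mat n} {T C σ u R M : ℝ}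
  {v : Fin K → ℂ} {s : ℂ}

theorem Control.smallHead (h : Control Φ Ψ T C σ u R M v s) : SmallHead K (pert n v) (2 * u) R :=
  smallHead_pert h.norm_U h.R_nonneg h.u_le

theorem Control.shift (h : Control Φ Ψ T C σ u R M v s) {t : ℝ} (ht : 0 ≤ t) :
    Control Φ Ψ T C σ u R M v (s + t) where
  conj := h.conj
  norm_U := h.norm_U
  R_nonneg := h.R_nonneg
  u_le := h.u_le
  re := by simp; linarith [h.re]
  im := by simpa using h.im
  sol := h.sol.shift ht

/-- The control constants force ‖U‖ ≤ |z|/2. -/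
theorem Control.norm_shift_ge (h : Control Φ Ψ T C σ u R M v s) (i : Fin n) :
    Real.exp s.re / 2 ≤ ‖Complex.exp s + UMat n v i i‖ := by
  have h1 : ‖UMat n v i i‖ ≤ u := (norm_entry_le _ i i).trans h.norm_U
  have h2 : u ≤ Real.exp s.re / 2 := by
    have h3 := mul_le_mul_of_nonneg_right h.u_le (Real.exp_pos R).le
    rw [mul_assoc, ← Real.exp_add, neg_add_cancel, Real.exp_zero, mul_one] at h3
    have h4 := Real.exp_le_exp.2 h.re
    linarith
  have h5 := norm_sub_le_norm_add (Complex.exp s) (UMat n v i i)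
  rw [Complex.norm_exp] at h5
  linarith

theorem Control.offDiag (h : Control Φ Ψ T C σ u R M v s) : OffDiag n v s := fun i _ h0 => by
  have h1 := h.norm_shift_ge i
  rw [h0, norm_zero] at h1
  linarith [Real.exp_pos s.re]

theorem Control.norm_shiftInv_le (h : Control Φ Ψ T C σ u R M v s) :
    ‖shiftInv n v s‖ ≤ 2 * Real.exp (-s.re) := by
  rw [shiftInv, Matrix.linfty_opNorm_diagonal]
  refine (pi_norm_le_iff_of_nonneg (by positivity)).2 fun i => ?_
  split_ifs
  · rw [norm_inv, Real.exp_neg]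
    have h1 := h.norm_shift_ge i
    have h2 := inv_anti₀ (by positivity) h1
    refine h2.trans (le_of_eq ?_)
    rw [inv_div, div_eq_mul_inv]
  · rw [norm_zero]; positivity

theorem Control.norm_pertDir_le (h : Control Φ Ψ T C σ u R M v s) (d : Fin K → ℂ) :
    ‖pertDir n v d * shiftInv n v s‖ ≤ 2 * ‖pertDir n v d‖ * Real.exp (-s.re) := by
  refine (norm_mul_le _ _).trans ?_
  have := mul_le_mul_of_nonneg_left h.norm_shiftInv_le (norm_nonneg (pertDir n v d))
  linarith

/-- The derivatives `u_i'`, normalised. -/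
def dirMat (n : ℕ) (v d : Fin K → ℂ) : Mat n :=
  Matrix.diagonal fun i => if i.val < K then
    uDeriv v d (i.val + 1) / Complex.exp (∑ j, v j) else 0

theorem isHead_dirMat (v d : Fin K → ℂ) : IsHead K (dirMat n v d) :=
  isHead_diagonal fun _ hi => if_neg hi

/-- `isoOp` as a continuous linear map. -/
def isoOpCLM (n : ℕ) {k : ℕ} (w d : Fin k → ℂ) : Mat n →L[ℂ] Mat n :=
  LinearMap.toContinuousLinearMap
    { toFun := isoOp n w d
      map_add' := fun A B => by ext i j; simp only [isoOp_apply, Matrix.add_apply]; ring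
      map_smul' := fun c A => by
        ext i j
        simp only [isoOp_apply, Matrix.smul_apply, smul_eq_mul, RingHom.id_apply]
        ring }

theorem isoOp_sub {k : ℕ} (w d : Fin k → ℂ) (A B : Mat n) :
    isoOp n w d (A - B) = isoOp n w d A - isoOp n w d B := map_sub (isoOpCLM n w d) A B

/-- With g_i = -U_i/(z + U_i) one has g_i - g_j = z⁻¹ (U_j - U_i)(1 + g_i)(1 + g_j), while u_i - u_j
is U_j - U_i times z_1 ⋯ z_K. The denominators of ad_u⁻¹ therefore cancel, and what is left is a
commutator with a diagonal head matrix of size 1/z, to which the kernel estimate applies. -/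
theorem isoOp_lie_pert {d : Fin K → ℂ} (ho : OffDiag n v s)
    (hd : ∀ i j : Fin n, i.val < K → j.val < K → i ≠ j → uDiag n v i - uDiag n v j ≠ 0) {Y : Mat n}
    (hY : Y ∈ deltaAlg n K) :
    isoOp n v d ⁅pert n v s, Y⁆ =
      ⁅Complex.exp (-s) • dirMat n v d,
        (headProj n K + pert n v s) * Y * (headProj n K + pert n v s)⁆ -
      (∑ j, d j) • ⁅pert n v s, Y⁆ := by
  have hsum : headProj n K + pert n v s = Matrix.diagonal fun i : Fin n =>
      (if i.val < K then 1 else 0) + -(UMat n v i i) / (Complex.exp s + UMat n v i i) := by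
    rw [headProj, pert, Matrix.diagonal_add]
  rw [hsum, pert, dirMat, ← Matrix.diagonal_smul]
  ext i j
  rw [isoOp_apply, Matrix.sub_apply, Matrix.smul_apply, lie_diagonal_apply, lie_diagonal_apply,
    Matrix.mul_diagonal, Matrix.diagonal_mul, smul_eq_mul, Pi.smul_apply, Pi.smul_apply]
  congr 1
  by_cases hij : i = j
  · subst hij; simp
  rw [if_neg hij]
  by_cases hb : i.val < K ∧ j.val < K
  swap
  · have : Y i j = 0 := by
      rw [← mem_deltaAlg.1 hY, delta_apply, if_neg]
      tauto
    rw [this]; simp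
  obtain ⟨hi, hj⟩ := hb
  rw [if_pos hi, if_pos hj, if_pos hi, if_pos hj, smul_eq_mul, smul_eq_mul]
  have h1 := ho i hi
  have h2 := ho j hj
  have h3 := hd i j hi hj hij
  have h4 := Complex.exp_ne_zero (∑ j, v j)
  have h5 := Complex.exp_ne_zero s
  have h6 : uDiag n v i - uDiag n v j =
      Complex.exp (∑ j, v j) * (UMat n v j j - UMat n v i i) := by
    rw [mul_sub, UMat_mul v hi, UMat_mul v hj, uDiag, uDiag]; ring
  rw [h6] at h3 ⊢
  have h7 : UMat n v j j - UMat n v i i ≠ 0 := right_ne_zero_of_mul h3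
  rw [Complex.exp_neg]
  field_simp
  ring

end Control

end

/-! ### Decay of the conjugated operator term in the tangential equation. -/

section



variable {n : ℕ} {K : ℕ}

/-- The outer factors 1 + g are absorbed into Y: after conjugation by z^A they become a bounded head
matrix Q, and the previous kernel bound applies to Q Y Q. -/
theorem ConjBound.norm_kernel_conj {A : Mat n} {T C σ : ℝ} (h : ConjBound K A T C σ)
    {g D Y : Mat n} (hg : IsHead K g) (hD : IsHead K D) (hY : Y ∈ deltaAlg n K) {s : ℂ}
    (hs : |s.im| ≤ T) (hs0 : 0 ≤ s.re) {t : ℝ} (ht : 0 ≤ t) {γ κ y : ℝ} (hγ0 : 0 ≤ γ)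
    (hγ : ‖g‖ ≤ γ * Real.exp (-(s + t).re)) (hκ : ‖D‖ ≤ κ) (hy : ‖Y‖ ≤ y) :
    ‖adPow s A ⁅Complex.exp (-(s + t)) • D,
      (headProj n K + g) * adPow (-(s + t)) A Y * (headProj n K + g)⁆‖ ≤
      2 * C ^ 2 * κ * ((1 + C * γ) * y * (1 + C * γ)) * Real.exp (-(1 - σ) * (s.re + t)) := by
  have hC := h.C_pos
  have hre : (s + t).re = s.re + t := by simp
  set r : ℂ := s + t with hr
  have hr0 : 0 ≤ r.re := by rw [hre]; linarith
  have him : |r.im| ≤ T := by simpa [hr] using hs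
  have hGs : ‖adPow r A g‖ ≤ C * γ := by
    refine (h.norm_head_small hg him hr0 hγ).trans ?_
    have : Real.exp (-(1 - σ) * r.re) ≤ 1 := by
      rw [Real.exp_le_one_iff]
      have := h.σ_lt
      nlinarith
    exact mul_le_of_le_one_right (by positivity) this
  obtain ⟨Q, hQ⟩ : ∃ Q, Q = headProj n K + adPow r A g := ⟨_, rfl⟩
  have hQn : ‖Q‖ ≤ 1 + C * γ := by
    rw [hQ]
    exact (norm_add_le _ _).trans (add_le_add (norm_headProj_le K) hGs)
  have hQm : Q ∈ deltaAlg n K := by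
    rw [hQ]
    exact Subalgebra.add_mem _ (headProj_mem K) (adPow_mem_deltaAlg h.mem _ hg.mem)
  have hconj : (headProj n K + g) * adPow (-r) A Y * (headProj n K + g) =
      adPow (-r) A (Q * Y * Q) := by
    have : adPow (-r) A Q = headProj n K + g := by
      rw [hQ, adPow_add_right, adPow_headProj h.mem, adPow_neg_adPow]
    rw [adPow_mul (-r) A (Q * Y) Q, adPow_mul (-r) A Q Y, this]
  have hy0 : 0 ≤ y := (norm_nonneg _).trans hy
  have hQY : ‖Q * Y * Q‖ ≤ (1 + C * γ) * y * (1 + C * γ) := by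
    refine (norm_mul_le _ _).trans ?_
    refine mul_le_mul ((norm_mul_le _ _).trans ?_) hQn (norm_nonneg _) (by positivity)
    exact mul_le_mul hQn hy (norm_nonneg _) (by positivity)
  have hκ0 : 0 ≤ κ := (norm_nonneg _).trans hκ
  rw [hconj]
  refine (h.norm_kernel (γ := κ) (isHead_smul hD _)
    (Subalgebra.mul_mem _ (Subalgebra.mul_mem _ hQm hY) hQm) hs hs0 ht ?_).trans ?_
  · rw [norm_smul, Complex.norm_exp, Complex.neg_re, hre, mul_comm]
    gcongr
  · gcongr

section Control

variable {Φ : (Fin (K + 1) → ℂ) → Mat n} {Ψ : (Fin K → ℂ) → Mat n} {T C σ u R M : ℝ}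
  {v : Fin K → ℂ} {s : ℂ}

/-- The constant in `Control.norm_isoOp_le`. -/
def isoBound (C σ u M κ τ : ℝ) : ℝ :=
  (2 * C ^ 2 * κ * ((1 + C * (2 * u)) * M ^ 2 * (1 + C * (2 * u))) +
    τ * (2 * C ^ 2 * (2 * u) * M ^ 2)) / (1 - σ)

theorem Control.norm_kernel_le (h : Control Φ Ψ T C σ u R M v s) {d : Fin K → ℂ}
    (hd : ∀ i j : Fin n, i.val < K → j.val < K → i ≠ j → uDiag n v i - uDiag n v j ≠ 0) {κ : ℝ}
    (hκ : ‖dirMat n v d‖ ≤ κ) {t : ℝ} (ht : 0 ≤ t) :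
    ‖adPow s (delta K (Ψ v)) (isoOp n v d ⁅pert n v (s + t), adPow (-(s + t)) (delta K (Ψ v))
      (deltaDiff K (gaugeFun Φ Ψ v (s + t)) * deltaDiff K (gaugeFun Φ Ψ v (s + t)))⁆)‖ ≤
    (2 * C ^ 2 * κ * ((1 + C * (2 * u)) * M ^ 2 * (1 + C * (2 * u))) +
      ‖∑ j, d j‖ * (2 * C ^ 2 * (2 * u) * M ^ 2)) * Real.exp (-(1 - σ) * (s.re + t)) := by
  have hs0 : 0 ≤ s.re := h.R_nonneg.trans h.re
  have g := h.shift ht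
  have hu : 0 ≤ u := (norm_nonneg _).trans h.norm_U
  have hGb := h.smallHead.bound _ g.re
  have hGh := h.smallHead.head (s + t)
  have hYm := deltaDiff_mul_deltaDiff_mem K (gaugeFun Φ Ψ v (s + t)) (gaugeFun Φ Ψ v (s + t))
  have hYn := norm_sq_deltaDiff_le (K := K) (h.sol.bound t ht)
  have b1 := h.conj.norm_kernel_conj hGh (isHead_dirMat v d) hYm h.im hs0 ht (by positivity) hGb
    hκ hYn
  have b2 := (h.conj.norm_kernel (γ := 2 * u) hGh hYm h.im hs0 ht (by simpa using hGb)).trans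
    (b := _) (c := 2 * C ^ 2 * (2 * u) * M ^ 2 * Real.exp (-(1 - σ) * (s.re + t)))
    (by gcongr)
  rw [isoOp_lie_pert g.offDiag hd (adPow_mem_deltaAlg h.conj.mem _ hYm), adPow_sub_right,
    adPow_smul_right]
  refine (_root_.norm_sub_le _ _).trans ?_
  rw [norm_smul]
  refine (add_le_add b1 (mul_le_mul_of_nonneg_left b2 (norm_nonneg _))).trans (le_of_eq ?_)
  ring

/-- Since the operator does not commute with z^{ad A}, decay of the block difference alone would not
suffice. The difference is written as an integral to infinity of commutators with the perturbation,
and the operator and the conjugation at s are applied under the integral. -/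
theorem Control.norm_isoOp_le (h : Control Φ Ψ T C σ u R M v s) {d : Fin K → ℂ}
    (hd : ∀ i j : Fin n, i.val < K → j.val < K → i ≠ j → uDiag n v i - uDiag n v j ≠ 0) {κ : ℝ}
    (hκ : ‖dirMat n v d‖ ≤ κ) :
    ‖adPow s (delta K (Ψ v)) (isoOp n v d (delta K (Φ (extend v s)) - delta K (Ψ v)))‖ ≤
      isoBound C σ u M κ ‖∑ j, d j‖ * Real.exp (-(1 - σ) * s.re) := by
  set A := delta K (Ψ v) with hA
  have hη : 0 < 1 - σ := sub_pos.2 h.conj.σ_lt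
  let L : Mat n →L[ℂ] Mat n := adPowL s A ∘L isoOpCLM n v d
  have key := norm_le_of_deriv_le (s := s)
    (f := fun r => L (adPow (-r) A (delta K (gaugeFun Φ Ψ v r) - A)))
    (f' := fun r => L ⁅pert n v r, adPow (-r) A
      (deltaDiff K (gaugeFun Φ Ψ v r) * deltaDiff K (gaugeFun Φ Ψ v r))⁆)
    (B := 2 * C ^ 2 * κ * ((1 + C * (2 * u)) * M ^ 2 * (1 + C * (2 * u))) +
      ‖∑ j, d j‖ * (2 * C ^ 2 * (2 * u) * M ^ 2)) hη
    (fun t ht => L.hasFDerivAt.comp_hasDerivAt _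
      (hasDerivAt_of_gaugeRHS h.conj.mem (h.smallHead.head _) (h.sol.deriv t ht)))
    (fun t ht => h.norm_kernel_le hd hκ ht)
    (by
      have := (L.continuous.tendsto 0).comp h.sol.limD
      rwa [map_zero] at this)
  have e := delta_gaugeFun_sub Φ Ψ v s
  rw [← hA] at e
  rw [← e]
  exact key

end Control

end

/-! ### The limit of a solution solves the equation of the lower level. -/

section



variable {n : ℕ} {K : ℕ}

/-! ### Continuity in the base point -/

theorem tendsto_of_entries {E : Type*} {l : Filter E} {f : E → Mat n} {Y : Mat n}
    (h : ∀ i j, Tendsto (fun p => f p i j) l (𝓝 (Y i j))) : Tendsto f l (𝓝 Y) :=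
  tendsto_pi_nhds.2 fun i => tendsto_pi_nhds.2 fun j => h i j

theorem tendsto_entry {E : Type*} {l : Filter E} {f : E → Mat n} {Y : Mat n}
    (h : Tendsto f l (𝓝 Y)) (i j : Fin n) : Tendsto (fun p => f p i j) l (𝓝 (Y i j)) :=
  tendsto_pi_nhds.1 (tendsto_pi_nhds.1 h i) j

theorem contDiff_uVal {k : ℕ} (m : ℕ) : ContDiff ℂ 1 fun w : Fin k → ℂ => uVal w m := by
  unfold uVal
  fun_prop

theorem continuous_uDeriv {k : ℕ} (d : Fin k → ℂ) (m : ℕ) :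
    Continuous fun w : Fin k → ℂ => uDeriv w d m :=
  ((contDiff_uVal m).continuous_fderiv one_ne_zero).clm_apply continuous_const

theorem continuous_dirMat (d : Fin K → ℂ) : Continuous fun v : Fin K → ℂ => dirMat n v d := by
  unfold dirMat
  refine Continuous.matrix_diagonal (continuous_pi fun i => ?_)
  by_cases hi : i.val < K
  · simp only [if_pos hi]
    exact (continuous_uDeriv d _).div (by fun_prop) fun v => Complex.exp_ne_zero _
  · simp only [if_neg hi]
    exact continuous_const

theorem continuous_pertDir (d : Fin K → ℂ) : Continuous fun v : Fin K → ℂ => pertDir n v d := by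
  unfold pertDir
  refine Continuous.matrix_diagonal (continuous_pi fun i => ?_)
  by_cases hi : i.val < K
  · simp only [if_pos hi]
    refine (((continuous_uDeriv d _).sub (continuous_uDeriv d _)).div (by fun_prop)
      fun v => Complex.exp_ne_zero _).sub (continuous_const.mul ?_)
    exact (continuous_UMat (n := n)).matrix_elem i i
  · simp only [if_neg hi]
    exact continuous_const

theorem tendsto_isoOp {E : Type*} {l : Filter E} {p : E → Fin K → ℂ} {Y : E → Mat n}
    {v₀ : Fin K → ℂ} {Y₀ : Mat n} (hp : Tendsto p l (𝓝 v₀)) (hY : Tendsto Y l (𝓝 Y₀))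
    (hd : ∀ i j : Fin n, i.val < K → j.val < K → i ≠ j → uDiag n v₀ i - uDiag n v₀ j ≠ 0)
    (d : Fin K → ℂ) :
    Tendsto (fun x => isoOp n (p x) d (delta K (Y x))) l (𝓝 (isoOp n v₀ d (delta K Y₀))) := by
  refine tendsto_of_entries fun i j => ?_
  simp only [isoOp_apply]
  by_cases hij : (i.val < K ∧ j.val < K) ∨ i = j
  swap
  · simp only [delta_apply, if_neg hij, mul_zero, sub_zero]
    exact tendsto_const_nhds
  · simp only [delta_apply, if_pos hij]
    have hYij := tendsto_entry hY i j
    refine Tendsto.sub ?_ (tendsto_const_nhds.mul hYij)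
    refine Tendsto.mul ?_ hYij
    by_cases e : i = j
    · simp only [if_pos e]; exact tendsto_const_nhds
    · simp only [if_neg e]
      have hb : i.val < K ∧ j.val < K := hij.resolve_right e
      have hu : ∀ i : Fin n, Tendsto (fun x => uDiag n (p x) i) l (𝓝 (uDiag n v₀ i)) := fun i =>
        ((differentiable_uVal (i.val + 1)).continuous.tendsto v₀).comp hp
      have hu' : ∀ m, Tendsto (fun x => uDeriv (p x) d m) l (𝓝 (uDeriv v₀ d m)) := fun m =>
        ((continuous_uDeriv d m).tendsto v₀).comp hp
      exact ((hu' _).sub (hu' _)).div ((hu i).sub (hu j)) (hd i j hb.1 hb.2 e)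

theorem tendsto_lie {E : Type*} {l : Filter E} {f g : E → Mat n} {A B : Mat n}
    (hf : Tendsto f l (𝓝 A)) (hg : Tendsto g l (𝓝 B)) :
    Tendsto (fun x => ⁅f x, g x⁆) l (𝓝 ⁅A, B⁆) := by
  simp only [Ring.lie_def]
  exact (hf.mul hg).sub (hg.mul hf)

theorem lie_add_left (A B Y : Mat n) : ⁅A + B, Y⁆ = ⁅A, Y⁆ + ⁅B, Y⁆ := by
  simp only [Ring.lie_def]; noncomm_ring

theorem lie_zero_left (Y : Mat n) : ⁅(0 : Mat n), Y⁆ = 0 := by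
  rw [Ring.lie_def, zero_mul, mul_zero, sub_zero]

theorem lie_smul_right (c : ℂ) (B Y : Mat n) : ⁅B, c • Y⁆ = c • ⁅B, Y⁆ := by
  simp only [Ring.lie_def, smul_mul_assoc, mul_smul_comm, smul_sub]

theorem lie_neg_right (B Y : Mat n) : ⁅B, -Y⁆ = -⁅B, Y⁆ := by
  simp only [Ring.lie_def]; noncomm_ring

/-! ### The direction matrix of the tangential equation -/

/-- The off-block part of the operator in the directions of the first `K` variables. -/
def tangMat (n : ℕ) (v d : Fin K → ℂ) (s : ℂ) : Mat n := pertDir n v d * shiftInv n v s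

theorem isHead_tangMat (v d : Fin K → ℂ) (s : ℂ) : IsHead K (tangMat n v d s) := by
  rw [tangMat, pertDir, shiftInv, Matrix.diagonal_mul_diagonal]
  exact isHead_diagonal fun i hi => by rw [if_neg hi, zero_mul]

theorem IsoSol.hasFDerivAt_tangential {S' : Set (Fin (K + 1) → ℂ)} {Φ : (Fin (K + 1) → ℂ) → Mat n}
    (h : IsoSol n S' Φ) {v : Fin K → ℂ} {s : ℂ} (hm : extend v s ∈ S') (ho : OffDiag n v s) :
    ∃ L : (Fin K → ℂ) →L[ℂ] Mat n, HasFDerivAt (fun v => Φ (extend v s)) L v ∧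
      ∀ d, L d = ⁅isoOp n v d (delta K (Φ (extend v s))) +
        (tangMat n v d s * deltaDiff K (Φ (extend v s)) +
          deltaDiff K (Φ (extend v s)) * tangMat n v d s), Φ (extend v s)⁆ := by
  obtain ⟨L, hL, e⟩ := h _ hm
  refine ⟨L ∘L extendL K, hL.comp v (hasFDerivAt_extend v s), fun d => ?_⟩
  rw [ContinuousLinearMap.comp_apply, extendL_apply, e, isoOp_extend_tangential ho, tangMat]

section Control

variable {Φ : (Fin (K + 1) → ℂ) → Mat n} {Ψ : (Fin K → ℂ) → Mat n} {T C σ u R M : ℝ}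
  {v : Fin K → ℂ} {s : ℂ}

theorem Control.norm_tangMat_le (h : Control Φ Ψ T C σ u R M v s) {d : Fin K → ℂ} {q : ℝ}
    (hq : ‖pertDir n v d‖ ≤ q) : ‖tangMat n v d s‖ ≤ 2 * q * Real.exp (-s.re) :=
  (h.norm_pertDir_le d).trans (by gcongr)

theorem Control.norm_adPow_tangMat_le (h : Control Φ Ψ T C σ u R M v s) {d : Fin K → ℂ} {q : ℝ}
    (hq : ‖pertDir n v d‖ ≤ q) :
    ‖adPow s (delta K (Ψ v)) (tangMat n v d s)‖ ≤ C * (2 * q) * Real.exp (-(1 - σ) * s.re) :=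
  h.conj.norm_head_small (isHead_tangMat v d s) h.im (h.R_nonneg.trans h.re) (h.norm_tangMat_le hq)

/-- The square of the off-block part of Φ is z^{-ad A} of a bounded matrix, so its head part grows
at most like |z|^σ, against the factor 1/z of the tangential head matrix. -/
theorem Control.norm_lie_tangMat_le (h : Control Φ Ψ T C σ u R M v s) {d : Fin K → ℂ} {q : ℝ}
    (hq : ‖pertDir n v d‖ ≤ q) :
    ‖⁅tangMat n v d s, deltaDiff K (Φ (extend v s)) * deltaDiff K (Φ (extend v s))⁆‖ ≤
      4 * q * C * M ^ 2 * Real.exp (-(1 - σ) * s.re) := by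
  have hA := h.conj.mem
  have hs0 : 0 ≤ s.re := h.R_nonneg.trans h.re
  have hC := h.conj.C_pos
  have hq0 : 0 ≤ q := (norm_nonneg _).trans hq
  have e : deltaDiff K (Φ (extend v s)) * deltaDiff K (Φ (extend v s)) =
      adPow (-s) (delta K (Ψ v))
        (deltaDiff K (gaugeFun Φ Ψ v s) * deltaDiff K (gaugeFun Φ Ψ v s)) := by
    rw [adPow_mul, ← deltaDiff_adPow hA, gaugeFun_neg]
  have hm := deltaDiff_mul_deltaDiff_mem K (gaugeFun Φ Ψ v s) (gaugeFun Φ Ψ v s)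
  have hb := norm_sq_deltaDiff_le (K := K) (h.sol.bound 0 le_rfl)
  rw [Complex.ofReal_zero, add_zero] at hb
  have e2 : headProj n K * adPow (-s) (delta K (Ψ v))
      (deltaDiff K (gaugeFun Φ Ψ v s) * deltaDiff K (gaugeFun Φ Ψ v s)) =
      adPow (-s) (delta K (Ψ v)) (headProj n K *
        (deltaDiff K (gaugeFun Φ Ψ v s) * deltaDiff K (gaugeFun Φ Ψ v s))) := by
    rw [adPow_mul (-s) _ (headProj n K), adPow_headProj hA]
  rw [e, lie_head_eq (isHead_tangMat v d s) (adPow_mem_deltaAlg hA _ hm), e2]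
  have b1 := h.conj.bound.norm_adPow_le hA (isHead_headProj_mul hm) (w := -s) (by simpa using h.im)
  rw [Complex.neg_re, abs_neg, abs_of_nonneg hs0] at b1
  have b2 := (norm_headProj_mul_le K _).trans hb
  calc _ ≤ 2 * ‖tangMat n v d s‖ * _ := norm_lie_le _ _
    _ ≤ 2 * (2 * q * Real.exp (-s.re)) * (C * Real.exp (σ * s.re) * M ^ 2) :=
        mul_le_mul (mul_le_mul_of_nonneg_left (h.norm_tangMat_le hq) zero_le_two)
          (b1.trans (mul_le_mul_of_nonneg_left b2 (by positivity))) (norm_nonneg _) (by positivity)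
    _ = 4 * q * C * M ^ 2 * (Real.exp (-s.re) * Real.exp (σ * s.re)) := by ring
    _ = _ := by rw [← Real.exp_add]; congr 2; ring

end Control

variable {a b : ℝ} {S : Set (Fin K → ℂ)} {S' : Set (Fin (K + 1) → ℂ)}
    {Φ : (Fin (K + 1) → ℂ) → Mat n} {Ψ : (Fin K → ℂ) → Mat n}

theorem tendsto_slice {E F G : Type*} [TopologicalSpace E] {l : Filter F} {m : Filter G}
    {f : E → F → G} {v : E} (h : Tendsto (fun p : E × F => f p.1 p.2) (𝓝 v ×ˢ l) m) :
    Tendsto (f v) l m :=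
  h.comp (tendsto_const_nhds.prodMk tendsto_id)

theorem delta_lie_of_mem_left {B : Mat n} (hB : B ∈ deltaAlg n K) (Y : Mat n) :
    delta K ⁅B, Y⁆ = ⁅B, delta K Y⁆ := by
  rw [Ring.lie_def, Ring.lie_def, delta_sub, delta_mul_of_mem_left hB, delta_mul_of_mem_right hB]

/-- The upper left block of the boundary value solves the equation. -/
theorem Level.hasFDerivAt_delta (h : Level n K a b S S' Φ Ψ) (hK : K ≤ n) {v₀ : Fin K → ℂ}
    (hv : v₀ ∈ S) (hgap : BlockGap hK (delta K (Ψ v₀))) :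
    ∃ L : (Fin K → ℂ) →L[ℂ] Mat n, HasFDerivAt (fun v => delta K (Ψ v)) L v₀ ∧
      ∀ d, L d = ⁅isoOp n v₀ d (delta K (Ψ v₀)), delta K (Ψ v₀)⁆ := by
  have := sector_neBot h.le
  obtain ⟨C, σ, u, R, M, hC, hσ0, hσ1, hu, hM, hctl⟩ := h.eventually_control hK hv hgap
  refine hasFDerivAt_of_tendsto_joint (l := sector a b)
    (f := fun s v => delta K (Φ (extend v s)))
    (f' := fun s v d => ⁅isoOp n v d (delta K (Φ (extend v s))), delta K (Φ (extend v s))⁆ +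
      ⁅tangMat n v d s, deltaDiff K (Φ (extend v s)) * deltaDiff K (Φ (extend v s))⁆)
    ?_ ?_ ?_
  · filter_upwards [hctl] with p hp
    obtain ⟨L, hL, e⟩ := h.sol.hasFDerivAt_tangential hp.2.1 (h.offDiag _ _ hp.2.1)
    refine ⟨deltaL K ∘L L, (deltaL K).hasFDerivAt.comp p.1 hL, fun d => ?_⟩
    change delta K (L d) = _
    rw [e, ← delta_anti_lie (isHead_tangMat _ _ _).mem, lie_add_left, delta_add,
      delta_lie_of_mem_left (isoOp_mem _ _ (delta_mem K _))]
  · intro d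
    have hfst : Tendsto Prod.fst (𝓝 v₀ ×ˢ sector a b) (𝓝 v₀) := tendsto_fst
    have h1 := h.lim_block v₀ hv
    have h2 := tendsto_isoOp hfst h1 (h.distinct v₀ hv) d
    simp only [delta_delta] at h2
    have h3 := tendsto_lie h2 h1
    have hq := hfst.eventually (((continuous_pertDir (n := n) d).norm.tendsto v₀).eventually_le_const
      (lt_add_one ‖pertDir n v₀ d‖))
    have h4 : Tendsto (fun p : (Fin K → ℂ) × ℂ => ⁅tangMat n p.1 d p.2,
        deltaDiff K (Φ (extend p.1 p.2)) * deltaDiff K (Φ (extend p.1 p.2))⁆)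
        (𝓝 v₀ ×ˢ sector a b) (𝓝 0) :=
      tendsto_zero_of_norm_le_exp (sub_pos.2 hσ1)
        ((hctl.and hq).mono fun p hp => hp.1.2.2.norm_lie_tangMat_le hp.2)
    have h5 := h3.add h4
    rw [add_zero] at h5
    exact h5
  · filter_upwards [h.isOpen.mem_nhds hv] with v hv'
    exact tendsto_slice (f := fun v s => delta K (Φ (extend v s))) (h.lim_block v hv')

/-- The derivative of conjugation by `z ^ A` when `A` moves by conjugation. -/
theorem hasFDerivAt_adPow_of_lie {F : Type*} [NormedAddCommGroup F] [NormedSpace ℂ F]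
    {A f : F → Mat n} {A' f' : F →L[ℂ] Mat n} {v : F} (hA : HasFDerivAt A A' v)
    (hf : HasFDerivAt f f' v) (s : ℂ) :
    ∃ L : F →L[ℂ] Mat n, HasFDerivAt (fun v => adPow s (A v) (f v)) L v ∧
      ∀ (d : F) (B : Mat n), A' d = ⁅B, A v⁆ →
        L d = ⁅B, adPow s (A v) (f v)⁆ + adPow s (A v) (f' d - ⁅B, f v⁆) := by
  have h1 := (differentiableAt_exp (s • A v)).hasFDerivAt.comp v (hA.const_smul s)
  have h2 := (differentiableAt_exp (-(s • A v))).hasFDerivAt.comp v (hA.const_smul s).neg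
  have h3 := (h1.mul' hf).mul' h2
  refine ⟨_, h3, fun d B hB => ?_⟩
  have e1 : fderiv ℂ (NormedSpace.exp : Mat n → Mat n) (s • A v) (s • A' d) =
      ⁅B, NormedSpace.exp (s • A v)⁆ := by
    rw [← fderiv_exp_lie, hB, lie_smul_right]
  have e2 : fderiv ℂ (NormedSpace.exp : Mat n → Mat n) (-(s • A v)) (-(s • A' d)) =
      ⁅B, NormedSpace.exp (-(s • A v))⁆ := by
    rw [← fderiv_exp_lie, hB, lie_neg_right, lie_smul_right]
  have e3 : ∀ E E' E₁ E₁' : Mat n, E₁ = ⁅B, E⁆ → E₁' = ⁅B, E'⁆ →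
      E * f v * E₁' + (E * f' d + E₁ * f v) * E' = ⁅B, E * f v * E'⁆ +
        E * (f' d - ⁅B, f v⁆) * E' := by
    rintro E E' _ _ rfl rfl
    simp only [Ring.lie_def]
    noncomm_ring
  exact e3 _ _ _ _ e1 e2

/-- The boundary value solves the equation. -/
theorem Level.isoSol (h : Level n K a b S S' Φ Ψ) (hK : K ≤ n)
    (hgap : ∀ v ∈ S, BlockGap hK (delta K (Ψ v))) : IsoSol n S Ψ := by
  intro v₀ hv
  have := sector_neBot h.le
  obtain ⟨C, σ, u, R, M, hC, hσ0, hσ1, hu, hM, hctl⟩ := h.eventually_control hK hv (hgap v₀ hv)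
  -- With B the operator at δ_K Ψ, the function A = δ_K Ψ has derivative ⁅B, A⁆. Differentiating
  -- z^{ad A}Φ then gives the expected commutator with B, plus conjugates of the difference of the
  -- operators at Φ and at Ψ and of the small off-block terms.
  refine hasFDerivAt_of_tendsto_joint (l := sector a b)
    (f := fun s v => gaugeFun Φ Ψ v s)
    (f' := fun s v d => ⁅isoOp n v d (delta K (Ψ v)), gaugeFun Φ Ψ v s⁆ +
      ⁅adPow s (delta K (Ψ v)) (isoOp n v d (delta K (Φ (extend v s)) - delta K (Ψ v))) +
        (adPow s (delta K (Ψ v)) (tangMat n v d s) * deltaDiff K (gaugeFun Φ Ψ v s) +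
          deltaDiff K (gaugeFun Φ Ψ v s) * adPow s (delta K (Ψ v)) (tangMat n v d s)),
        gaugeFun Φ Ψ v s⁆)
    ?_ ?_ ?_
  · filter_upwards [hctl] with p hp
    obtain ⟨L, hL, e⟩ := h.sol.hasFDerivAt_tangential hp.2.1 (h.offDiag _ _ hp.2.1)
    obtain ⟨LA, hLA, eA⟩ := h.hasFDerivAt_delta hK hp.1 (hgap p.1 hp.1)
    obtain ⟨L', hL', e'⟩ := hasFDerivAt_adPow_of_lie hLA hL p.2
    refine ⟨L', hL', fun d => (e' d _ (eA d)).trans ?_⟩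
    refine congrArg₂ (· + ·) rfl ?_
    rw [e, isoOp_sub, gaugeFun, deltaDiff_adPow (delta_mem K _), ← adPow_mul, ← adPow_mul,
      ← adPow_add_right, ← adPow_add_right, ← adPow_lie]
    refine congrArg _ ?_
    simp only [Ring.lie_def]
    noncomm_ring
  · intro d
    have hfst : Tendsto Prod.fst (𝓝 v₀ ×ˢ sector a b) (𝓝 v₀) := tendsto_fst
    have hcΨ : Tendsto (fun p : (Fin K → ℂ) × ℂ => Ψ p.1) (𝓝 v₀ ×ˢ sector a b) (𝓝 (Ψ v₀)) :=
      Tendsto.comp (h.cont.continuousAt (h.isOpen.mem_nhds hv)) hfst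
    have hl := h.lim v₀ hv
    have h3 := tendsto_lie (tendsto_isoOp hfst hcΨ (h.distinct v₀ hv) d) hl
    have hq := hfst.eventually (((continuous_pertDir (n := n) d).norm.tendsto v₀).eventually_le_const
      (lt_add_one ‖pertDir n v₀ d‖))
    have hκ := hfst.eventually (((continuous_dirMat (n := n) d).norm.tendsto v₀).eventually_le_const
      (lt_add_one ‖dirMat n v₀ d‖))
    have h4 : Tendsto (fun p : (Fin K → ℂ) × ℂ => adPow p.2 (delta K (Ψ p.1))
        (isoOp n p.1 d (delta K (Φ (extend p.1 p.2)) - delta K (Ψ p.1))))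
        (𝓝 v₀ ×ˢ sector a b) (𝓝 0) :=
      tendsto_zero_of_norm_le_exp (sub_pos.2 hσ1)
        ((hctl.and hκ).mono fun p hp => hp.1.2.2.norm_isoOp_le (h.distinct p.1 hp.1.1) hp.2)
    have h5 : Tendsto (fun p : (Fin K → ℂ) × ℂ => adPow p.2 (delta K (Ψ p.1))
        (tangMat n p.1 d p.2)) (𝓝 v₀ ×ˢ sector a b) (𝓝 0) :=
      tendsto_zero_of_norm_le_exp (sub_pos.2 hσ1)
        ((hctl.and hq).mono fun p hp => hp.1.2.2.norm_adPow_tangMat_le hp.2)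
    have h6 := ((deltaDiffL K).continuous.tendsto _).comp hl
    have h7 := h3.add (tendsto_lie (h4.add ((h5.mul h6).add (h6.mul h5))) hl)
    rw [zero_mul, mul_zero, add_zero, add_zero, lie_zero_left, add_zero] at h7
    exact h7
  · filter_upwards [h.isOpen.mem_nhds hv] with v hv'
    exact tendsto_slice (f := gaugeFun Φ Ψ) (h.lim v hv')

end

/-! ### Isospectrality of the head block, and joint limits from locally uniform ones. -/

section



variable {n : ℕ} {K : ℕ}

/-! ### The spectrum of the upper left block is constant -/

theorem subset_of_isPreconnected {E : Type*} [TopologicalSpace E] {S P : Set E}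
    (hS : IsPreconnected S) (hSo : IsOpen S) (hne : (S ∩ P).Nonempty)
    (ho : ∀ v ∈ S, v ∈ P → ∀ᶠ w in 𝓝 v, w ∈ P) (hc : ∀ v ∈ S, v ∈ closure (S ∩ P) → v ∈ P) :
    S ⊆ P := by
  have h1 : IsOpen (S ∩ P) := isOpen_iff_mem_nhds.2 fun v hv =>
    inter_mem (hSo.mem_nhds hv.1) (ho v hv.1 hv.2)
  refine (hS.subset_of_closure_inter_subset h1 ?_ fun v hv => ⟨hv.2, hc v hv.2 hv.1⟩).trans
    Set.inter_subset_right
  rwa [← Set.inter_assoc, Set.inter_self]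

/-- The characteristic polynomial of the upper left block. -/
def headDet (h : K ≤ n) (x : ℂ) (A : Mat n) : ℂ := (algebraMap ℂ (Mat K) x - headBlock h A).det

theorem mem_spectrum_headBlock (h : K ≤ n) (x : ℂ) (A : Mat n) :
    x ∈ spectrum ℂ (headBlock h A) ↔ headDet h x A = 0 := by
  rw [spectrum.mem_iff, Matrix.isUnit_iff_isUnit_det, isUnit_iff_ne_zero, not_not, headDet]

theorem BlockGap.of_headDet_eq {h : K ≤ n} {A B : Mat n} (hA : BlockGap h A)
    (e : ∀ x, headDet h x B = headDet h x A) : BlockGap h B := by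
  intro x hx y hy
  rw [mem_spectrum_headBlock, e, ← mem_spectrum_headBlock] at hx hy
  exact hA x hx y hy

theorem headDet_adPow (h : K ≤ n) {B : Mat n} (hB : B ∈ deltaAlg n K) (t x : ℂ) (Y : Mat n) :
    headDet h x (adPow t B Y) = headDet h x Y := by
  have h1 := exp_mem_deltaAlg (smul_mem_deltaAlg hB t)
  have h2 := exp_mem_deltaAlg (Subalgebra.neg_mem _ (smul_mem_deltaAlg hB t))
  have hone : headBlock h (1 : Mat n) = 1 := by
    rw [headBlock_eq, Matrix.mul_one, headIncl_transpose_mul]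
  have e1 : headBlock h (NormedSpace.exp (t • B)) * headBlock h (NormedSpace.exp (-(t • B))) = 1 := by
    rw [← headBlock_mul_left h h1, exp_smul_mul_exp_neg, hone]
  have e2 : algebraMap ℂ (Mat K) x - headBlock h (adPow t B Y) =
      headBlock h (NormedSpace.exp (t • B)) * (algebraMap ℂ (Mat K) x - headBlock h Y) *
        headBlock h (NormedSpace.exp (-(t • B))) := by
    rw [headBlock_adPow h le_rfl hB, mul_sub, sub_mul, ← Algebra.commutes,
      mul_assoc (algebraMap ℂ (Mat K) x), e1, mul_one]
  rw [headDet, e2, Matrix.det_mul, Matrix.det_mul, mul_comm, ← mul_assoc, ← Matrix.det_mul,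
    mul_eq_one_comm.1 e1, Matrix.det_one, one_mul, headDet]

theorem differentiable_headDet (h : K ≤ n) (x : ℂ) : Differentiable ℂ fun A : Mat n => headDet h x A := by
  have he : ∀ i j : Fin n, Differentiable ℂ fun A : Mat n => A i j := fun i j =>
    ((Matrix.entryLinearMap ℂ ℂ i j).toContinuousLinearMap (E := Mat n)).differentiable
  simp only [headDet, Matrix.det_apply, Matrix.sub_apply]
  refine Differentiable.fun_sum fun σ _ => Differentiable.const_smul (fun A => ?_) _
  exact (HasFDerivAt.finsetProd fun i _ =>
    (((differentiable_const _).sub (he _ _)) A).hasFDerivAt).differentiableAt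

variable {a b : ℝ} {S : Set (Fin K → ℂ)} {S' : Set (Fin (K + 1) → ℂ)}
    {Φ : (Fin (K + 1) → ℂ) → Mat n} {Ψ : (Fin K → ℂ) → Mat n}

/-- The equation for the head block is available only where the gap already holds, so the argument
is open-closed: the gap is open, on a ball where it holds the characteristic polynomial is constant
because the block moves by commutators, and continuity gives closedness. -/
theorem Level.blockGap (h : Level n K a b S S' Φ Ψ) (hK : K ≤ n) (hS : IsPreconnected S)
    {v₁ : Fin K → ℂ} (hv₁ : v₁ ∈ S) (hgap : BlockGap hK (delta K (Ψ v₁))) :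
    ∀ v ∈ S, BlockGap hK (delta K (Ψ v)) := by
  have hcA : ∀ v ∈ S, ContinuousAt (fun v => delta K (Ψ v)) v := fun v hv =>
    Tendsto.comp (g := deltaL K) ((deltaL K).continuous.tendsto _) (h.cont.continuousAt (h.isOpen.mem_nhds hv))
  let P : Set (Fin K → ℂ) := {v | ∀ x, headDet hK x (delta K (Ψ v)) = headDet hK x (delta K (Ψ v₁))}
  have hP : S ⊆ P := by
    refine subset_of_isPreconnected hS h.isOpen ⟨v₁, hv₁, fun x => rfl⟩ ?_ ?_
    · intro v hv hvP
      have hg : BlockGap hK (delta K (Ψ v)) := hgap.of_headDet_eq hvP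
      -- The gap is needed at every point of a ball, since the differential equation for the block
      -- is used throughout it.
      have hev : ∀ᶠ w in 𝓝 v, w ∈ S ∧ BlockGap hK (delta K (Ψ w)) :=
        (h.isOpen.eventually_mem hv).and ((hcA v hv).eventually ((isOpen_blockGap hK).eventually_mem hg))
      obtain ⟨r, hr, hball⟩ := Metric.eventually_nhds_iff_ball.1 hev
      refine Metric.eventually_nhds_iff_ball.2 ⟨r, hr, fun w hw x => ?_⟩
      rw [← hvP x]
      have hd : ∀ w ∈ Metric.ball v r,
          HasFDerivAt (fun w => headDet hK x (delta K (Ψ w))) (0 : (Fin K → ℂ) →L[ℂ] ℂ) w := by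
        intro w hw
        obtain ⟨L, hL, e⟩ := h.hasFDerivAt_delta hK (hball w hw).1 (hball w hw).2
        have h1 := ((differentiable_headDet hK x) (delta K (Ψ w))).hasFDerivAt
        have h2 := h1.comp w hL
        refine h2.congr_fderiv ?_
        ext d : 1
        change fderiv ℂ (fun A : Mat n => headDet hK x A) (delta K (Ψ w)) (L d) = 0
        rw [e]
        refine fderiv_lie_of_equivariant h1 ?_
        simp only [headDet_adPow hK (isoOp_mem _ _ (delta_mem K _))]
        exact hasDerivAt_const _ _
      exact (convex_ball v r).is_const_of_fderivWithin_eq_zero (𝕜 := ℂ)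
        (fun w hw => (hd w hw).differentiableAt.differentiableWithinAt)
        (fun w hw => by
          rw [fderivWithin_of_isOpen Metric.isOpen_ball hw, (hd w hw).fderiv]) hw
        (Metric.mem_ball_self hr)
    · intro v hv hcl
      change ∀ x, _
      intro x
      have hcont : ContinuousAt (fun v => headDet hK x (delta K (Ψ v))) v :=
        Tendsto.comp (g := fun A : Mat n => headDet hK x A) ((differentiable_headDet hK x).continuous.tendsto _) (hcA v hv)
      have hne : (𝓝[S ∩ P] v).NeBot := mem_closure_iff_nhdsWithin_neBot.1 hcl
      refine tendsto_nhds_unique (l := 𝓝[S ∩ P] v) (hcont.mono_left nhdsWithin_le_nhds) ?_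
      refine tendsto_const_nhds.congr' ?_
      filter_upwards [self_mem_nhdsWithin] with w hw
      exact (hw.2 x).symm
  exact fun v hv => hgap.of_headDet_eq (hP hv)

/-! ### Locally uniform limits -/

/-- Locally uniform convergence makes the limit continuous, and then v and s may tend to their
limits simultaneously. All later estimates use limits in this joint form. -/
theorem tendsto_joint_of_locallyUniform {E : Type*} [TopologicalSpace E] {F : ℂ → E → ℂ} {f : E → ℂ}
    {l : Filter ℂ} [l.NeBot] {S : Set E} (hS : IsOpen S) (h : TendstoLocallyUniformlyOn F f l S)
    {v : E} (hv : v ∈ S) (hc : ∀ᶠ s in l, ContinuousAt (F s) v) :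
    ContinuousAt f v ∧ Tendsto (fun p : E × ℂ => F p.2 p.1) (𝓝 v ×ˢ l) (𝓝 (f v)) := by
  have hcf : ContinuousAt f v := by
    refine continuousAt_of_locally_uniform_approx_of_continuousAt fun u hu => ?_
    obtain ⟨t, ht, h1⟩ := h u hu v hv
    rw [hS.nhdsWithin_eq hv] at ht
    obtain ⟨s, hs1, hs2⟩ := (h1.and hc).exists
    exact ⟨t, ht, F s, hs2, hs1⟩
  refine ⟨hcf, ?_⟩
  have h1 := tendstoLocallyUniformlyOn_iff_forall_tendsto.1 h v hv
  rw [hS.nhdsWithin_eq hv] at h1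
  have hsw : Tendsto Prod.swap (𝓝 v ×ˢ l) (l ×ˢ 𝓝 v) := by
    rw [prod_comm]; exact tendsto_map
  have h2 := Uniform.tendsto_nhds_right.1 hcf
  have h3 : Tendsto (fun p : E × ℂ => (f v, f p.1)) (𝓝 v ×ˢ l) (uniformity ℂ) := h2.comp tendsto_fst
  exact Uniform.tendsto_nhds_right.2 (h3.uniformity_trans (h1.comp hsw))

end

/-! ### The chain of boundary values: descending the equations, ascending the gap condition. -/

section



variable {n : ℕ} {K : ℕ}

/-! ### The chain of boundary values -/

theorem tendsto_joint_matrix {E : Type*} [TopologicalSpace E] {F : ℂ → E → Mat n} {f : E → Mat n}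
    {l : Filter ℂ} [l.NeBot] {S : Set E} (hS : IsOpen S)
    (h : ∀ i j, TendstoLocallyUniformlyOn (fun s v => F s v i j) (fun v => f v i j) l S)
    {v : E} (hv : v ∈ S) (hc : ∀ᶠ s in l, ContinuousAt (F s) v) :
    ContinuousAt f v ∧ Tendsto (fun p : E × ℂ => F p.2 p.1) (𝓝 v ×ˢ l) (𝓝 (f v)) := by
  have key := fun i j => tendsto_joint_of_locallyUniform hS (h i j) hv
    (hc.mono fun s hs => tendsto_entry hs i j)
  exact ⟨tendsto_of_entries fun i j => (key i j).1, tendsto_of_entries fun i j => (key i j).2⟩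

/-- The hypotheses on the chain of limits. -/
structure LimitChain (a b : Fin n → ℝ) (Ω : Set (Fin n → ℂ)) (Ψ : (k : ℕ) → (Fin k → ℂ) → Mat n) :
    Prop where
  domain : IsSectorialDomain a b Ω
  lim_block : ∀ (k : Fin n) (i j : Fin n), TendstoLocallyUniformlyOn
    (fun (s : ℂ) (v : Fin k.val → ℂ) => delta k.val (Ψ (k.val + 1) (extend v s)) i j)
    (fun v => delta k.val (Ψ k.val v) i j) (sector (a k) (b k)) (proj k.val Ω)
  lim : ∀ (k : Fin n) (i j : Fin n), TendstoLocallyUniformlyOn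
    (fun (s : ℂ) (v : Fin k.val → ℂ) =>
      adPow s (delta k.val (Ψ k.val v)) (Ψ (k.val + 1) (extend v s)) i j)
    (fun v => Ψ k.val v i j) (sector (a k) (b k)) (proj k.val Ω)

variable {a b : Fin n → ℝ} {Ω : Set (Fin n → ℂ)} {Ψ : (k : ℕ) → (Fin k → ℂ) → Mat n}

theorem LimitChain.level (h : LimitChain a b Ω Ψ) (k : Fin n)
    (hsol : IsoSol n (proj (k.val + 1) Ω) (Ψ (k.val + 1))) :
    Level n k.val (a k) (b k) (proj k.val Ω) (proj (k.val + 1) Ω) (Ψ (k.val + 1)) (Ψ k.val) := by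
  have hne := sector_neBot (h.domain.nonempty_sector k)
  have hS : IsOpen (proj k.val Ω) := isOpen_proj k.2.le h.domain.isOpen
  have hcont : ∀ v ∈ proj k.val Ω, ∀ᶠ s in sector (a k) (b k),
      ContinuousAt (fun v => Ψ (k.val + 1) (extend v s)) v := fun v hv => by
    have h1 := tendsto_slice (f := fun v s => extend v s) (v := v) (tendsto_map
      (f := fun p : (Fin k.val → ℂ) × ℂ => extend p.1 p.2) (x := 𝓝 v ×ˢ sector (a k) (b k)))
    refine (h1.eventually (h.domain.sector_mem k v hv)).mono fun s hs => ?_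
    obtain ⟨L, hL, -⟩ := hsol _ hs
    exact (hL.comp v (hasFDerivAt_extend v s)).continuousAt
  have hblock : ∀ v ∈ proj k.val Ω,
      ContinuousAt (fun v => delta k.val (Ψ k.val v)) v ∧
      Tendsto (fun p : (Fin k.val → ℂ) × ℂ => delta k.val (Ψ (k.val + 1) (extend p.1 p.2)))
        (𝓝 v ×ˢ sector (a k) (b k)) (𝓝 (delta k.val (Ψ k.val v))) := fun v hv =>
    tendsto_joint_matrix (F := fun s v => delta k.val (Ψ (k.val + 1) (extend v s))) hS
      (h.lim_block k) hv ((hcont v hv).mono fun s hs =>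
        Tendsto.comp (g := deltaL k.val) ((deltaL k.val).continuous.tendsto _) hs)
  have hfull : ∀ v ∈ proj k.val Ω, ContinuousAt (Ψ k.val) v ∧
      Tendsto (fun p : (Fin k.val → ℂ) × ℂ => gaugeFun (Ψ (k.val + 1)) (Ψ k.val) p.1 p.2)
        (𝓝 v ×ˢ sector (a k) (b k)) (𝓝 (Ψ k.val v)) := fun v hv => by
    refine tendsto_joint_matrix (F := fun s v => gaugeFun (Ψ (k.val + 1)) (Ψ k.val) v s) hS
      (h.lim k) hv ((hcont v hv).mono fun s hs => ?_)
    have hexp : Continuous (NormedSpace.exp : Mat n → Mat n) := NormedSpace.exp_continuous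
    have hA := ((hblock v hv).1.const_smul s)
    exact ((Tendsto.comp (hexp.tendsto _) hA).mul hs).mul (Tendsto.comp (hexp.tendsto _) hA.neg)
  exact
    { le := h.domain.nonempty_sector k
      isOpen := hS
      sol := hsol
      offDiag := fun v s hm => offDiag_of_mem h.domain.distinct k.2 hm
      distinct := fun v hv i j hi hj hij => injOn_uDiag h.domain.distinct k.2.le hv hi hj hij
      mem := h.domain.sector_mem k
      lim_block := fun v hv => (hblock v hv).2
      lim := fun v hv => (hfull v hv).2
      cont := fun v hv => (hfull v hv).1.continuousWithinAt }

theorem LimitChain.tendsto_gauge (h : LimitChain a b Ω Ψ) (k : Fin n) {v : Fin k.val → ℂ}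
    (hv : v ∈ proj k.val Ω) :
    Tendsto (fun s => adPow s (delta k.val (Ψ k.val v)) (Ψ (k.val + 1) (extend v s)))
      (sector (a k) (b k)) (𝓝 (Ψ k.val v)) :=
  tendsto_of_entries fun i j => (h.lim k i j).tendsto_at hv

/-- For a fixed block size K the gap climbs from Ψ_0 to Ψ_K: the conjugate of Ψ_{k+1} tends to Ψ_k,
the gap is open, and conjugation by a block matrix of size k ≤ K does not change the spectrum. No
differential equation is used, so the result is available before the descending induction. -/
theorem LimitChain.exists_blockGap (h : LimitChain a b Ω Ψ)
    (hb : BoundaryCondition (Ψ 0 Fin.elim0)) {K : ℕ} (hK : K < n) :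
    ∃ v ∈ proj K Ω, BlockGap hK.le (Ψ K v) := by
  have key : ∀ k ≤ K, ∃ v ∈ proj k Ω, BlockGap hK.le (Ψ k v) := by
    intro k
    induction k with
    | zero =>
      intro _
      obtain ⟨v, hv⟩ := (isConnected_proj (Nat.zero_le n) h.domain.isConnected).nonempty
      refine ⟨v, hv, ?_⟩
      rw [Subsingleton.elim v Fin.elim0]
      exact hb K hK
    | succ k ih =>
      intro hk
      obtain ⟨v, hv, hg⟩ := ih (by omega)
      have hkn : k < n := by omega
      have hne := sector_neBot (h.domain.nonempty_sector ⟨k, hkn⟩)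
      have h1 := (h.tendsto_gauge ⟨k, hkn⟩ hv).eventually ((isOpen_blockGap hK.le).eventually_mem hg)
      have h2 := tendsto_slice (f := fun v s => extend v s) (v := v) (tendsto_map
        (f := fun p : (Fin k → ℂ) × ℂ => extend p.1 p.2) (x := 𝓝 v ×ˢ sector (a ⟨k, hkn⟩) (b ⟨k, hkn⟩)))
      obtain ⟨s, hs1, hs2⟩ := (h1.and (h2.eventually (h.domain.sector_mem ⟨k, hkn⟩ v hv))).exists
      exact ⟨extend v s, hs2, (blockGap_adPow_iff hK.le (by omega : k ≤ K) (delta_mem k _) s _).1 hs1⟩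
  exact key K le_rfl

/-- The limit functions are solutions, and the gap condition holds everywhere. -/
theorem LimitChain.isoSol (h : LimitChain a b Ω Ψ) (hb : BoundaryCondition (Ψ 0 Fin.elim0))
    (hsol : IsIsomonodromySolution Ω (Ψ n)) : ∀ k ≤ n, IsoSol n (proj k Ω) (Ψ k) := by
  intro k hk
  induction hk using Nat.decreasingInduction with
  -- The descent starts at the given isomonodromy solution.
  | self =>
    rw [proj_self]
    exact hsol.isDegenerateSolution.isoSol h.domain.isOpen
  | of_succ k hk ih =>
    obtain ⟨v, hv, hg⟩ := h.exists_blockGap hb hk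
    have hl := h.level ⟨k, hk⟩ ih
    exact hl.isoSol hk.le (hl.blockGap hk.le (isConnected_proj hk.le h.domain.isConnected).isPreconnected
      hv ((blockGap_delta_iff hk.le le_rfl _).2 hg))

theorem LimitChain.blockGap (h : LimitChain a b Ω Ψ) (hb : BoundaryCondition (Ψ 0 Fin.elim0))
    (hsol : IsIsomonodromySolution Ω (Ψ n)) {k : ℕ} (hk : k < n) :
    ∀ v ∈ proj k Ω, BlockGap hk.le (delta k (Ψ k v)) := by
  obtain ⟨v, hv, hg⟩ := h.exists_blockGap hb hk
  exact (h.level ⟨k, hk⟩ (h.isoSol hb hsol _ hk)).blockGap hk.le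
    (isConnected_proj hk.le h.domain.isConnected).isPreconnected hv
    ((blockGap_delta_iff hk.le le_rfl _).2 hg)

end

/-! ### Convergence of the series to the given chain, and uniqueness. -/

section



variable {n : ℕ} {K : ℕ}

/-! ### Convergence of the series to the solution -/

theorem GaugeSol.mono {A X : Mat n} {G Θ : ℂ → Mat n} {M M' : ℝ} {s : ℂ}
    (h : GaugeSol K A G Θ X M s) (hM : M ≤ M') : GaugeSol K A G Θ X M' s where
  deriv := h.deriv
  bound t ht := (h.bound t ht).trans hM
  lim := h.lim
  limD := h.limD

/-- Both the sum of the series and the gauged function Ψ_{K+1} solve the same gauged equation with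
the same asymptotics, so they coincide for large z by the contraction argument. -/
theorem Level.exists_series {a b : ℝ} {S : Set (Fin K → ℂ)} {S' : Set (Fin (K + 1) → ℂ)}
    {Φ : (Fin (K + 1) → ℂ) → Mat n} {Ψ : (Fin K → ℂ) → Mat n} (h : Level n K a b S S' Φ Ψ)
    (hK : K ≤ n) {v : Fin K → ℂ} (hv : v ∈ S) (hgap : BlockGap hK (delta K (Ψ v))) :
    ∃ φ : ℕ → ℂ → Mat n, IsSeriesCoeff v (Ψ v) φ ∧ ∀ᶠ s in sector a b,
      HasSum (fun m : ℕ => Complex.exp (-((m : ℂ) * s)) • φ m s) (Φ (extend v s)) := by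
  obtain ⟨φ, Θ, hφ, hsum⟩ := exists_series_sum hK v hgap
  refine ⟨φ, hφ, ?_⟩
  obtain ⟨C, σ, u, R, M, hC, hσ0, hσ1, hu, hM, hctl⟩ := h.eventually_control hK hv hgap
  have hctl' := tendsto_slice (f := fun v s => (v, s)) (v := v)
    (tendsto_id (x := 𝓝 v ×ˢ sector a b)) |>.eventually hctl
  -- The strip is enlarged by 1 because the series is controlled on an open strip, while the sector
  -- is closed.
  obtain ⟨σ', C', hσ0', hσ1', hC', hev⟩ :=
    exists_headBound hK (delta_mem K (Ψ v)) hgap (max |a| |b| + 1)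
  have hcb : ConjBound K (delta K (Ψ v)) (max |a| |b| + 1) C' σ' :=
    ⟨delta_mem K _, hev.self_of_nhds (delta_mem K _), hC', hσ0', hσ1'⟩
  obtain ⟨R', hR'⟩ := (hsum _ _ _ hcb).exists
  -- The comparison requires one common bound for the two solutions.
  set M' := max M (‖Ψ v‖ + 1) with hM'
  have hlarge := (tendsto_re_sector a b).eventually
    ((tendsto_mul_exp_neg (sub_pos.2 hσ1) ((12 * C ^ 2 * (2 * u) * M' ^ 2 / (1 - σ) +
      8 * C * (2 * u) * M') / (1 - σ))).eventually_le_const (by norm_num : (0 : ℝ) < 1 / 2))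
  filter_upwards [hctl', hlarge, eventually_im_sector a b,
    (tendsto_re_sector a b).eventually_gt_atTop R'] with s h1 h2 h3 h4
  have him : |s.im| ≤ max |a| |b| := abs_le_max_abs_abs h3.1 h3.2
  obtain ⟨g, hs⟩ := hR' s h4 (by linarith)
  have hc := h1.2.2
  have e : Θ s = gaugeFun Φ Ψ v s :=
    (g.mono (le_max_right M _)).eq_of_large hc.conj hc.smallHead
      (hc.sol.mono (le_max_left _ (‖Ψ v‖ + 1))) hc.im hc.re h2
  rwa [e, gaugeFun_neg] at hs

/-! ### Uniqueness of solutions of the differential equation -/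

/-- The operator acts by entrywise multiplication, and its value on the all-ones matrix is the
multiplier. A bound on the multiplier therefore gives a Lipschitz bound along a compact segment. -/
theorem isoOp_delta_apply {k : ℕ} (w d : Fin k → ℂ) (Y : Mat n) (i j : Fin n) :
    isoOp n w d (delta k Y) i j =
      isoOp n w d (delta k (Matrix.of fun _ _ => 1)) i j * Y i j := by
  rw [isoOp_apply, isoOp_apply, delta_apply, delta_apply]
  split_ifs <;> simp
  ring

theorem norm_isoOp_delta_le {k : ℕ} {w d : Fin k → ℂ} {κ : ℝ} (hκ0 : 0 ≤ κ)
    (hκ : ‖isoOp n w d (delta k (Matrix.of fun _ _ => 1))‖ ≤ κ) (Y : Mat n) :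
    ‖isoOp n w d (delta k Y)‖ ≤ κ * ‖Y‖ := by
  have h : ‖isoOp n w d (delta k Y)‖ ≤ ‖(κ : ℂ) • Y‖ := by
    refine norm_matrix_le fun i j => ?_
    rw [isoOp_delta_apply, Matrix.smul_apply, smul_eq_mul, norm_mul, norm_mul, Complex.norm_real,
      Real.norm_of_nonneg hκ0]
    gcongr
    exact (norm_entry_le _ i j).trans hκ
  rwa [norm_smul, Complex.norm_real, Real.norm_of_nonneg hκ0] at h

theorem IsoSol.continuousAt {k : ℕ} {S : Set (Fin k → ℂ)} {Φ : (Fin k → ℂ) → Mat n}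
    (h : IsoSol n S Φ) {w : Fin k → ℂ} (hw : w ∈ S) : ContinuousAt Φ w := by
  obtain ⟨L, hL, -⟩ := h w hw
  exact hL.continuousAt

/-- Two solutions that agree at the centre of a ball agree on the ball. -/
theorem IsoSol.eq_of_segment {k : ℕ} {S : Set (Fin k → ℂ)} {Φ₁ Φ₂ : (Fin k → ℂ) → Mat n}
    (h₁ : IsoSol n S Φ₁) (h₂ : IsoSol n S Φ₂)
    (hd : ∀ w ∈ S, ∀ i j : Fin n, i.val < k → j.val < k → i ≠ j →
      uDiag n w i - uDiag n w j ≠ 0) {v d : Fin k → ℂ}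
    (hseg : ∀ t : ℝ, t ∈ Set.Icc (0 : ℝ) 1 → v + (t : ℂ) • d ∈ S) (he : Φ₁ v = Φ₂ v) :
    Φ₁ (v + d) = Φ₂ (v + d) := by
  set γ : ℝ → Fin k → ℂ := fun t => v + (t : ℂ) • d with hγ
  have hγc : Continuous γ := by fun_prop
  have hc1 : ContinuousOn (fun t => Φ₁ (γ t)) (Set.Icc 0 1) := fun t ht =>
    (Tendsto.comp (h₁.continuousAt (hseg t ht)) (hγc.tendsto t)).mono_left nhdsWithin_le_nhds
  have hc2 : ContinuousOn (fun t => Φ₂ (γ t)) (Set.Icc 0 1) := fun t ht =>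
    (Tendsto.comp (h₂.continuousAt (hseg t ht)) (hγc.tendsto t)).mono_left nhdsWithin_le_nhds
  have hc3 : ContinuousOn (fun t => isoOp n (γ t) d (delta k (Matrix.of fun _ _ => 1)))
      (Set.Icc 0 1) := fun t ht =>
    (tendsto_isoOp (hγc.tendsto t) (tendsto_const_nhds (x := (Matrix.of fun _ _ => 1 : Mat n)))
      (hd _ (hseg t ht)) d).mono_left nhdsWithin_le_nhds
  obtain ⟨M₁, hM₁⟩ := isCompact_Icc.exists_bound_of_continuousOn hc1
  obtain ⟨M₂, hM₂⟩ := isCompact_Icc.exists_bound_of_continuousOn hc2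
  obtain ⟨κ, hκ⟩ := isCompact_Icc.exists_bound_of_continuousOn hc3
  have h0 : (0 : ℝ) ∈ Set.Icc (0 : ℝ) 1 := by simp
  have hκ0 : 0 ≤ κ := (norm_nonneg _).trans (hκ 0 h0)
  have hM₁0 : 0 ≤ M₁ := (norm_nonneg _).trans (hM₁ 0 h0)
  have hM₂0 : 0 ≤ M₂ := (norm_nonneg _).trans (hM₂ 0 h0)
  have hder : ∀ (Φ : (Fin k → ℂ) → Mat n), IsoSol n S Φ → ∀ t ∈ Set.Icc (0 : ℝ) 1,
      HasDerivAt (fun t => Φ (γ t)) ⁅isoOp n (γ t) d (delta k (Φ (γ t))), Φ (γ t)⁆ t := by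
    intro Φ h t ht
    obtain ⟨L, hL, e⟩ := h _ (hseg t ht)
    have hγd : HasDerivAt γ d t := by
      have h1 := (Complex.ofRealCLM.hasDerivAt (x := t)).smul_const d
      rw [Complex.ofRealCLM_apply, Complex.ofReal_one, one_smul] at h1
      exact h1.const_add v
    have h2 := (hL.restrictScalars ℝ).comp_hasDerivAt t hγd
    refine h2.congr_deriv ?_
    exact e d
  -- Grönwall: the right-hand side is quadratic, so on a compact segment it is Lipschitz with a
  -- constant built from the bounds of the two solutions and of the multiplier.
  have key := eq_zero_of_abs_deriv_le_mul_abs_self_of_eq_zero_right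
    (f := fun t => Φ₁ (γ t) - Φ₂ (γ t))
    (f' := fun t => ⁅isoOp n (γ t) d (delta k (Φ₁ (γ t))), Φ₁ (γ t)⁆ -
      ⁅isoOp n (γ t) d (delta k (Φ₂ (γ t))), Φ₂ (γ t)⁆)
    (K := 2 * κ * M₁ + 2 * (κ * M₂)) (a := 0) (b := 1) (hc1.sub hc2)
    (fun t ht => ((hder Φ₁ h₁ t ⟨ht.1, ht.2.le⟩).sub (hder Φ₂ h₂ t ⟨ht.1, ht.2.le⟩)).hasDerivWithinAt)
    (by simp [hγ, he])
    (fun t ht => by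
      have ht' : t ∈ Set.Icc (0 : ℝ) 1 := ⟨ht.1, ht.2.le⟩
      rw [lie_sub_lie, ← isoOp_sub, ← delta_sub]
      have b1 := norm_isoOp_delta_le hκ0 (hκ t ht') (Φ₁ (γ t) - Φ₂ (γ t))
      have b2 := norm_isoOp_delta_le hκ0 (hκ t ht') (Φ₂ (γ t))
      have b3 := hM₁ t ht'
      have b4 := hM₂ t ht'
      calc _ ≤ 2 * ‖isoOp n (γ t) d (delta k (Φ₁ (γ t) - Φ₂ (γ t)))‖ * ‖Φ₁ (γ t)‖ +
            2 * ‖isoOp n (γ t) d (delta k (Φ₂ (γ t)))‖ * ‖Φ₁ (γ t) - Φ₂ (γ t)‖ :=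
            (norm_add_le _ _).trans (add_le_add (norm_lie_le _ _) (norm_lie_le _ _))
        _ ≤ 2 * (κ * ‖Φ₁ (γ t) - Φ₂ (γ t)‖) * M₁ + 2 * (κ * M₂) * ‖Φ₁ (γ t) - Φ₂ (γ t)‖ := by
            gcongr
            exact b2.trans (by gcongr)
        _ = _ := by ring)
    1 (by simp)
  have e1 : γ 1 = v + d := by simp [hγ]
  rw [e1] at key
  exact sub_eq_zero.1 key

theorem IsoSol.eqOn {k : ℕ} {S : Set (Fin k → ℂ)} {Φ₁ Φ₂ : (Fin k → ℂ) → Mat n}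
    (h₁ : IsoSol n S Φ₁) (h₂ : IsoSol n S Φ₂)
    (hd : ∀ w ∈ S, ∀ i j : Fin n, i.val < k → j.val < k → i ≠ j →
      uDiag n w i - uDiag n w j ≠ 0) (hS : IsPreconnected S) (hSo : IsOpen S) {v : Fin k → ℂ}
    (hv : v ∈ S) (he : Φ₁ v = Φ₂ v) : Set.EqOn Φ₁ Φ₂ S := by
  refine subset_of_isPreconnected (P := {w | Φ₁ w = Φ₂ w}) hS hSo ⟨v, hv, he⟩ ?_ ?_
  · intro w hw hwe
    obtain ⟨r, hr, hball⟩ := Metric.eventually_nhds_iff_ball.1 (hSo.eventually_mem hw)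
    refine Metric.eventually_nhds_iff_ball.2 ⟨r, hr, fun y hy => ?_⟩
    have := h₁.eq_of_segment h₂ hd (v := w) (d := y - w) (fun t ht => hball _ ?_) hwe
    · rw [add_sub_cancel] at this
      exact this
    · rw [mem_ball_iff_norm, add_sub_cancel_left, norm_smul, Complex.norm_real,
        Real.norm_of_nonneg ht.1]
      rw [mem_ball_iff_norm] at hy
      exact (mul_le_of_le_one_left (norm_nonneg _) ht.2).trans_lt hy
  · intro w hw hcl
    have hne : (𝓝[S ∩ {w | Φ₁ w = Φ₂ w}] w).NeBot := mem_closure_iff_nhdsWithin_neBot.1 hcl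
    refine tendsto_nhds_unique (l := 𝓝[S ∩ {w | Φ₁ w = Φ₂ w}] w)
      ((h₁.continuousAt hw).mono_left nhdsWithin_le_nhds) ?_
    refine ((h₂.continuousAt hw).mono_left nhdsWithin_le_nhds).congr' ?_
    filter_upwards [self_mem_nhdsWithin] with y hy
    exact hy.2.symm

/-! ### Existence and uniqueness of the shrinking solution -/

variable {a b : Fin n → ℝ} {Ω : Set (Fin n → ℂ)} {Ψ : (k : ℕ) → (Fin k → ℂ) → Mat n}

theorem LimitChain.exists_series (h : LimitChain a b Ω Ψ) (hb : BoundaryCondition (Ψ 0 Fin.elim0))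
    (hsol : IsIsomonodromySolution Ω (Ψ n)) (k : Fin n) {v : Fin k.val → ℂ}
    (hv : v ∈ proj k.val Ω) : ∃ φ : ℕ → ℂ → Mat n, IsSeriesCoeff v (Ψ k.val v) φ ∧
      ∀ᶠ s in sector (a k) (b k),
        HasSum (fun m : ℕ => Complex.exp (-((m : ℂ) * s)) • φ m s) (Ψ (k.val + 1) (extend v s)) :=
  (h.level k (h.isoSol hb hsol _ k.2)).exists_series k.2.le hv (h.blockGap hb hsol k.2 v hv)

theorem LimitChain.isShrinkingSolution (h : LimitChain a b Ω Ψ)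
    (hb : BoundaryCondition (Ψ 0 Fin.elim0)) (hsol : IsIsomonodromySolution Ω (Ψ n)) :
    IsShrinkingSolution a b Ω (Ψ 0 Fin.elim0) (Ψ n) :=
  ⟨hb, hsol, Ψ, rfl, fun _ _ => rfl, fun k hk => (h.isoSol hb hsol k hk).isDegenerateSolution,
    fun k _ hv => h.exists_series hb hsol k hv⟩

/-- Level by level: equal functions at level k have equal series, hence equal values at some point
of level k + 1, and both are solutions of the same equation on a connected domain. -/
theorem LimitChain.eqOn_of_isShrinkingSolution (h : LimitChain a b Ω Ψ)
    (hb : BoundaryCondition (Ψ 0 Fin.elim0)) (hsol : IsIsomonodromySolution Ω (Ψ n))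
    {Φ : (Fin n → ℂ) → Mat n} (hΦ : IsShrinkingSolution a b Ω (Ψ 0 Fin.elim0) Φ) :
    Set.EqOn Φ (Ψ n) Ω := by
  obtain ⟨-, -, F, hF0, hFn, hFs, hF⟩ := hΦ
  have key : ∀ k ≤ n, Set.EqOn (F k) (Ψ k) (proj k Ω) := by
    intro k
    induction k with
    | zero =>
      intro _ v _
      rw [Subsingleton.elim v Fin.elim0, hF0]
    | succ k ih =>
      intro hk
      -- A single base point suffices: one common value of the two sums at a large s determines the
      -- solution on the whole domain.
      obtain ⟨v, hv⟩ := (isConnected_proj (Nat.le_of_succ_le hk) h.domain.isConnected).nonempty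
      obtain ⟨φ, hφ, hφs⟩ := h.exists_series hb hsol ⟨k, hk⟩ hv
      obtain ⟨φ', hφ', hφs'⟩ := hF ⟨k, hk⟩ v hv
      rw [show F k v = Ψ k v from ih (Nat.le_of_succ_le hk) hv] at hφ'
      have hne := sector_neBot (h.domain.nonempty_sector ⟨k, hk⟩)
      have hm := tendsto_slice (f := fun v s => (v, s)) (v := v)
        (tendsto_id (x := 𝓝 v ×ˢ sector (a ⟨k, hk⟩) (b ⟨k, hk⟩))) |>.eventually
        (h.domain.sector_mem ⟨k, hk⟩ v hv)
      obtain ⟨s, h1, h2, h3⟩ := (hφs.and (hφs'.and hm)).exists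
      rw [hφ'.unique hφ] at h2
      exact IsoSol.eqOn ((hFs _ hk).isoSol (isOpen_proj hk h.domain.isOpen)) (h.isoSol hb hsol _ hk)
        (fun w hw i j hi hj hij => injOn_uDiag h.domain.distinct hk hw hi hj hij)
        (isConnected_proj hk h.domain.isConnected).isPreconnected
        (isOpen_proj hk h.domain.isOpen) h3 (h2.unique h1)
  intro w hw
  rw [← hFn hw]
  exact key n le_rfl (by rwa [proj_self])

end

end Shrinking

end

open Shrinking in
theorem theorem3p1 (n : ℕ) (a b : Fin n → ℝ) (Ω : Set (Fin n → ℂ))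
    (hΩ : IsSectorialDomain a b Ω)
    (Ψ : (k : ℕ) → (Fin k → ℂ) → Matrix (Fin n) (Fin n) ℂ)
    (hsol : IsIsomonodromySolution Ω (Ψ n))
    (hlim₁ : ∀ (k : Fin n) (i j : Fin n), TendstoLocallyUniformlyOn
      (fun (s : ℂ) (v : Fin k.val → ℂ) => delta k.val (Ψ (k.val + 1) (extend v s)) i j)
      (fun v => delta k.val (Ψ k.val v) i j)
      (sector (a k) (b k)) (proj k.val Ω))
    (hlim₂ : ∀ (k : Fin n) (i j : Fin n), TendstoLocallyUniformlyOn
      (fun (s : ℂ) (v : Fin k.val → ℂ) =>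
        adPow s (delta k.val (Ψ k.val v)) (Ψ (k.val + 1) (extend v s)) i j)
      (fun v => Ψ k.val v i j)
      (sector (a k) (b k)) (proj k.val Ω))
    (hbdry : BoundaryCondition (Ψ 0 Fin.elim0)) :
    IsShrinkingSolution a b Ω (Ψ 0 Fin.elim0) (Ψ n) ∧
    ∀ Φ : (Fin n → ℂ) → Matrix (Fin n) (Fin n) ℂ,
      IsShrinkingSolution a b Ω (Ψ 0 Fin.elim0) Φ → Set.EqOn Φ (Ψ n) Ω := by
  have h : LimitChain a b Ω Ψ := ⟨hΩ, hlim₁, hlim₂⟩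
  exact ⟨h.isShrinkingSolution hbdry hsol, fun Φ hΦ => h.eqOn_of_isShrinkingSolution hbdry hsol hΦ⟩
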